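/- For $\phi\in(0,\pi)$ let $\Omega_\phi=\{(r\cos\theta,r\sin\theta): r>0,\ 0<\theta<\phi\}\subset\mathbb R^2$ be the open wedge of aperture $\phi$, and let $\Gamma=\partial\Omega_\phi$ be its boundary with the arc-length measure. Let $A(x_1,x_2)=\tfrac12(-x_2,x_1)$, $\nabla_A:=i\nabla+A$, and let $$H^1_A(\Omega_\phi)=\{u\in L^2(\Omega_\phi):\ \nabla_A u\in L^2(\Omega_\phi;\mathbb C^2)\},$$ where $\nabla_A u$ is understood in the sense of distributions. For $\beta\in\mathbb R$ let $\mathsf H_{\phi,\beta}$ (the magnetic Robin Laplacian on $\Omega_\phi$) be the self-adjoint operator in $L^2(\Omega_\phi)$ associated with the closed, densely defined, semibounded quadratic form $$H^1_A(\Omega_\phi)\ni u\mapsto \|\nabla_A u\|^2_{L^2(\Omega_\phi;\mathbb C^2)}-\beta\,\|u|_\Gamma\|^2_{L^2(\Gamma)},$$ where $u|_\Gamma$ is the trace of $u$ on $\Gamma$. Let $\sigma_{\rm d}(\mathsf H_{\phi,\beta})$ be its discrete spectrum (the isolated eigenvalues of finite multiplicity), let $\sigma_{\rm ess}(\mathsf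 H_{\phi,\beta})=\sigma(\mathsf H_{\phi,\beta})\setminus\sigma_{\rm d}(\mathsf H_{\phi,\beta})$ be its essential spectrum, and let $\Theta_{R,\beta}:=\inf\sigma_{\rm ess}(\mathsf H_{\phi,\beta})$ (a number which in fact does not depend on $\phi$). **Theorem.** Let $\phi\in(0,\pi)$ and $\beta\in\mathbb R$, and let $$P_{\phi,\beta}(x)=x^4\bigl(2\phi-\pi\tanh(\tfrac{\phi}{2})\bigr)-8\Theta_{R,\beta}\,\phi\,x^2-16\beta\sqrt{\pi}\,x+8\phi .$$ If $\min_{x\in(0,\infty)}P_{\phi,\beta}(x)<0$, that is, if $P_{\phi,\beta}(x)<0$ for some $x>0$, then $\sigma_{\rm d}(\mathsf H_{\phi,\beta})\cap(-\infty,\Theta_{R,\beta})\neq\varnothing$. -/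

import Mathlib

open MeasureTheory
open scoped ContDiff

namespace MagneticWedge

noncomputable section

/-! ### Geometry -/

/-- The Euclidean plane. -/
abbrev Plane : Type := EuclideanSpace ℝ (Fin 2)

/-- The point with polar coordinates `(r, θ)`. -/
def polar (r θ : ℝ) : Plane := !₂[r * Real.cos θ, r * Real.sin θ]

/-- The open wedge `{(r, θ) : r > 0, 0 < θ < φ}` of aperture `φ`. -/
def wedge (φ : ℝ) : Set Plane := {x | ∃ r θ : ℝ, 0 < r ∧ 0 < θ ∧ θ < φ ∧ x = polar r θ}

/-- Arc length on the broken line `Γ` which bounds the wedge, that is, on the union of the two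
half-lines `θ = 0` and `θ = φ`. -/
def boundaryMeasure (φ : ℝ) : Measure Plane :=
  (volume.restrict (Set.Ioi (0 : ℝ))).map (fun r => polar r 0) +
    (volume.restrict (Set.Ioi (0 : ℝ))).map (fun r => polar r φ)

/-- The complex Hilbert space `L²(Ω)` over the wedge `Ω`. -/
abbrev L2Wedge (φ : ℝ) := Lp ℂ 2 ((volume : Measure Plane).restrict (wedge φ))

/-- The complex Hilbert space `L²(Γ)` over the boundary of the wedge. -/
abbrev L2Boundary (φ : ℝ) := Lp ℂ 2 (boundaryMeasure φ)

/-! ### The magnetic Sobolev space -/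

/-- The vector potential `A(x₁, x₂) = (-x₂, x₁) / 2` of the homogeneous magnetic field `B = 1`. -/
def vectorPotential (x : Plane) : Plane := !₂[-(x 1) / 2, x 0 / 2]

/-- `p` is the `j`-th component of the magnetic gradient `(i∇ + A) u` in the sense of
distributions on the wedge. -/
def IsMagneticDeriv (φ : ℝ) (j : Fin 2) (u p : L2Wedge φ) : Prop :=
  ∀ η : Plane → ℝ, ContDiff ℝ ∞ η → HasCompactSupport η → tsupport η ⊆ wedge φ →
    ∫ x in wedge φ, u x * (-Complex.I * ((fderiv ℝ η x (EuclideanSpace.single j 1) : ℝ) : ℂ)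
        + ((vectorPotential x j * η x : ℝ) : ℂ)) =
      ∫ x in wedge φ, p x * ((η x : ℝ) : ℂ)



theorem isOpen_wedge (φ : ℝ) : IsOpen (wedge φ) := by
  have h1 : IsOpen (Complex.exp '' {z : ℂ | 0 < z.im ∧ z.im < φ}) :=
    Complex.isOpenMap_exp _ ((isOpen_lt continuous_const Complex.continuous_im).inter
      (isOpen_lt Complex.continuous_im continuous_const))
  have h2 : Continuous fun x : Plane => ((x 0 : ℝ) : ℂ) + ((x 1 : ℝ) : ℂ) * Complex.I := by
    fun_prop
  convert h1.preimage h2 using 1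
  ext x
  simp only [wedge, Set.mem_ofPred_eq, Set.mem_preimage, Set.mem_image]
  constructor
  · rintro ⟨r, θ, hr, h0, hφ, rfl⟩
    refine ⟨Real.log r + θ * Complex.I, by simpa using ⟨h0, hφ⟩, ?_⟩
    rw [Complex.exp_add, ← Complex.ofReal_exp, Real.exp_log hr, Complex.exp_mul_I]
    simp [polar]
    ring
  · rintro ⟨z, ⟨h0, hφ⟩, hz⟩
    refine ⟨Real.exp z.re, z.im, Real.exp_pos _, h0, hφ, ?_⟩
    have hre := congrArg Complex.re hz
    have him := congrArg Complex.im hz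
    rw [Complex.exp_re] at hre
    rw [Complex.exp_im] at him
    ext i
    fin_cases i
    · simpa [polar] using hre.symm
    · simpa [polar] using him.symm

theorem integrable_mul_test {φ : ℝ} (u : L2Wedge φ) {g : Plane → ℂ} (hg : Continuous g)
    (hc : HasCompactSupport g) :
    Integrable (fun x => u x * g x) ((volume : Measure Plane).restrict (wedge φ)) :=
  MemLp.integrable_mul (p := 2) (q := 2) (Lp.memLp u) (hg.memLp_of_hasCompactSupport hc)

theorem locallyIntegrableOn_coe {φ : ℝ} (p : L2Wedge φ) :
    LocallyIntegrableOn (p : Plane → ℂ) (wedge φ) :=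
  locallyIntegrableOn_of_locallyIntegrable_restrict
    ((Lp.memLp p).locallyIntegrable (by norm_num))

theorem eq_of_forall_integral_test {φ : ℝ} {p q : L2Wedge φ}
    (h : ∀ η : Plane → ℝ, ContDiff ℝ ∞ η → HasCompactSupport η → tsupport η ⊆ wedge φ →
      ∫ x in wedge φ, p x * ((η x : ℝ) : ℂ) = ∫ x in wedge φ, q x * ((η x : ℝ) : ℂ)) :
    p = q := by
  have key : ∀ᵐ x ∂(volume : Measure Plane), x ∈ wedge φ → (p : Plane → ℂ) x - q x = 0 := by
    refine (isOpen_wedge φ).ae_eq_zero_of_integral_contDiff_smul_eq_zero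
      ((locallyIntegrableOn_coe p).sub (locallyIntegrableOn_coe q)) fun η hη hc hs => ?_
    have hη' : Continuous fun x => ((η x : ℝ) : ℂ) :=
      Complex.continuous_ofReal.comp hη.continuous
    have hc' : HasCompactSupport fun x => ((η x : ℝ) : ℂ) :=
      hc.comp_left (g := ((↑) : ℝ → ℂ)) Complex.ofReal_zero
    have h0 : ∫ x in wedge φ, η x • ((p : Plane → ℂ) x - q x) = 0 := by
      have := sub_eq_zero.mpr (h η hη hc hs)
      rw [← integral_sub (integrable_mul_test p hη' hc') (integrable_mul_test q hη' hc')] at this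
      rw [← this]
      congr 1
      ext x
      rw [Complex.real_smul]
      ring
    rw [← h0]
    symm
    apply setIntegral_eq_integral_of_forall_compl_eq_zero
    intro x hx
    rw [image_eq_zero_of_notMem_tsupport (fun hx' => hx (hs hx')), zero_smul]
  apply Lp.ext
  refine (ae_restrict_iff' (isOpen_wedge φ).measurableSet).mpr ?_
  filter_upwards [key] with x hx hxw
  exact sub_eq_zero.mp (hx hxw)

theorem IsMagneticDeriv.unique {φ : ℝ} {j : Fin 2} {u p q : L2Wedge φ}
    (hp : IsMagneticDeriv φ j u p) (hq : IsMagneticDeriv φ j u q) : p = q :=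
  eq_of_forall_integral_test fun η h1 h2 h3 => (hp η h1 h2 h3).symm.trans (hq η h1 h2 h3)

theorem continuous_vectorPotential (j : Fin 2) : Continuous fun x => vectorPotential x j := by
  fin_cases j
  · simp only [vectorPotential]; fun_prop
  · simp only [vectorPotential]; fun_prop

theorem test_regular {η : Plane → ℝ} (hη : ContDiff ℝ ∞ η) (hc : HasCompactSupport η)
    (j : Fin 2) :
    (Continuous fun x => -Complex.I * ((fderiv ℝ η x (EuclideanSpace.single j 1) : ℝ) : ℂ)
        + ((vectorPotential x j * η x : ℝ) : ℂ)) ∧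
      HasCompactSupport fun x =>
        -Complex.I * ((fderiv ℝ η x (EuclideanSpace.single j 1) : ℝ) : ℂ)
          + ((vectorPotential x j * η x : ℝ) : ℂ) := by
  have h1 : Continuous fun x => fderiv ℝ η x (EuclideanSpace.single j 1) :=
    (hη.continuous_fderiv (by simp)).clm_apply continuous_const
  have h2 := continuous_vectorPotential j
  have h3 := hη.continuous
  refine ⟨by fun_prop, HasCompactSupport.intro hc fun x hx => ?_⟩
  have h4 : fderiv ℝ η x = 0 :=
    image_eq_zero_of_notMem_tsupport fun h => hx (tsupport_fderiv_subset ℝ h)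
  simp [h4, image_eq_zero_of_notMem_tsupport hx]

theorem IsMagneticDeriv.add {φ : ℝ} {j : Fin 2} {u v p q : L2Wedge φ}
    (hp : IsMagneticDeriv φ j u p) (hq : IsMagneticDeriv φ j v q) :
    IsMagneticDeriv φ j (u + v) (p + q) := by
  intro η hη hc hs
  have hη' : Continuous fun x => ((η x : ℝ) : ℂ) := Complex.continuous_ofReal.comp hη.continuous
  have hc' : HasCompactSupport fun x => ((η x : ℝ) : ℂ) :=
    hc.comp_left (g := ((↑) : ℝ → ℂ)) Complex.ofReal_zero
  obtain ⟨hr, hr'⟩ := test_regular hη hc j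
  have key : ∀ (a b : L2Wedge φ) (g : Plane → ℂ), Continuous g → HasCompactSupport g →
      ∫ x in wedge φ, (a + b : L2Wedge φ) x * g x =
        (∫ x in wedge φ, a x * g x) + ∫ x in wedge φ, b x * g x := by
    intro a b g hg hg'
    rw [← integral_add (integrable_mul_test a hg hg') (integrable_mul_test b hg hg')]
    refine integral_congr_ae ?_
    filter_upwards [Lp.coeFn_add a b] with x hx
    rw [hx, Pi.add_apply, add_mul]
  rw [key u v _ hr hr', key p q _ hη' hc', hp η hη hc hs, hq η hη hc hs]

theorem IsMagneticDeriv.smul {φ : ℝ} {j : Fin 2} {u p : L2Wedge φ} (c : ℂ)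
    (hp : IsMagneticDeriv φ j u p) : IsMagneticDeriv φ j (c • u) (c • p) := by
  intro η hη hc hs
  have key : ∀ (a : L2Wedge φ) (g : Plane → ℂ),
      ∫ x in wedge φ, (c • a : L2Wedge φ) x * g x = c * ∫ x in wedge φ, a x * g x := by
    intro a g
    rw [← integral_const_mul]
    refine integral_congr_ae ?_
    filter_upwards [Lp.coeFn_smul c a] with x hx
    rw [hx, Pi.smul_apply, smul_eq_mul, mul_assoc]
  rw [key, key, hp η hη hc hs]

theorem IsMagneticDeriv.zero (φ : ℝ) (j : Fin 2) : IsMagneticDeriv φ j 0 0 := by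
  have key : ∀ g : Plane → ℂ, ∫ x in wedge φ, (0 : L2Wedge φ) x * g x = 0 := by
    intro g
    rw [← integral_zero Plane ℂ (μ := volume.restrict (wedge φ))]
    refine integral_congr_ae ?_
    filter_upwards [Lp.coeFn_zero ℂ 2 ((volume : Measure Plane).restrict (wedge φ))] with x hx
    rw [hx, Pi.zero_apply, zero_mul]
  intro η _ _ _
  rw [key, key]

/-- The magnetic Sobolev space `H¹_A(Ω)`: all `u ∈ L²(Ω)` whose distributional magnetic gradient
`(i∇ + A) u` belongs to `L²(Ω; ℂ²)`. -/
def magneticSobolev (φ : ℝ) : Submodule ℂ (L2Wedge φ) where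
  carrier := {u | ∀ j, ∃ p, IsMagneticDeriv φ j u p}
  add_mem' hu hv j := by
    obtain ⟨p, hp⟩ := hu j
    obtain ⟨q, hq⟩ := hv j
    exact ⟨p + q, hp.add hq⟩
  zero_mem' j := ⟨0, IsMagneticDeriv.zero φ j⟩
  smul_mem' c u hu j := by
    obtain ⟨p, hp⟩ := hu j
    exact ⟨c • p, hp.smul c⟩

/-- The `j`-th component of the magnetic gradient `(i∇ + A) u` of `u ∈ H¹_A(Ω)`. -/
def magneticDeriv (φ : ℝ) (j : Fin 2) : magneticSobolev φ →ₗ[ℂ] L2Wedge φ where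
  toFun u := (u.2 j).choose
  map_add' u v := ((u + v).2 j).choose_spec.unique ((u.2 j).choose_spec.add (v.2 j).choose_spec)
  map_smul' c u := ((c • u).2 j).choose_spec.unique ((u.2 j).choose_spec.smul c)

theorem magneticDeriv_spec {φ : ℝ} (j : Fin 2) (u : magneticSobolev φ) :
    IsMagneticDeriv φ j u (magneticDeriv φ j u) :=
  (u.2 j).choose_spec

/-- Smooth functions with compact support lie in `H¹_A(Ω)`, with the classical gradient. -/
theorem isMagneticDeriv_of_contDiff {φ : ℝ} (j : Fin 2) {w : Plane → ℂ} (hw : ContDiff ℝ 1 w)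
    {u p : L2Wedge φ} (hu : u =ᵐ[(volume : Measure Plane).restrict (wedge φ)] w)
    (hp : p =ᵐ[(volume : Measure Plane).restrict (wedge φ)] fun x =>
      Complex.I * fderiv ℝ w x (EuclideanSpace.single j 1) + (vectorPotential x j : ℂ) * w x) :
    IsMagneticDeriv φ j u p := by
  intro η hη hc hs
  set e : Plane := EuclideanSpace.single j 1
  have hη1 : Continuous fun x => fderiv ℝ η x e :=
    (hη.continuous_fderiv (by simp)).clm_apply continuous_const
  have hw1 : Continuous fun x => fderiv ℝ w x e :=
    (hw.continuous_fderiv (by simp)).clm_apply continuous_const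
  have hA := continuous_vectorPotential j
  have hη0 := hη.continuous
  have hw0 := hw.continuous
  have hz : ∀ x, x ∉ tsupport η → η x = 0 ∧ fderiv ℝ η x = 0 := fun x hx =>
    ⟨image_eq_zero_of_notMem_tsupport hx,
      image_eq_zero_of_notMem_tsupport fun h => hx (tsupport_fderiv_subset ℝ h)⟩
  have i1 : Integrable fun x => (fderiv ℝ η x e) • w x :=
    (by fun_prop : Continuous fun x => (fderiv ℝ η x e) • w x).integrable_of_hasCompactSupport
      (HasCompactSupport.intro hc fun x hx => by simp [(hz x hx).2])
  have i2 : Integrable fun x => η x • fderiv ℝ w x e :=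
    (by fun_prop : Continuous fun x => η x • fderiv ℝ w x e).integrable_of_hasCompactSupport
      (HasCompactSupport.intro hc fun x hx => by simp [(hz x hx).1])
  have i3 : Integrable fun x => η x • w x :=
    (by fun_prop : Continuous fun x => η x • w x).integrable_of_hasCompactSupport
      (HasCompactSupport.intro hc fun x hx => by simp [(hz x hx).1])
  have i4 : Integrable fun x => (vectorPotential x j : ℂ) * (η x * w x) :=
    (by fun_prop : Continuous fun x => (vectorPotential x j : ℂ) * (η x * w x)
      ).integrable_of_hasCompactSupport
      (HasCompactSupport.intro hc fun x hx => by simp [(hz x hx).1])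
  have parts := integral_smul_fderiv_eq_neg_fderiv_smul_of_integrable (v := e) i1 i2 i3
    (fun x _ => (hη.differentiable (by simp)) x) (fun x _ => (hw.differentiable (by simp)) x)
  calc ∫ x in wedge φ, u x * (-Complex.I * ((fderiv ℝ η x e : ℝ) : ℂ)
        + ((vectorPotential x j * η x : ℝ) : ℂ))
      = ∫ x in wedge φ, (-Complex.I * ((fderiv ℝ η x e) • w x)
          + (vectorPotential x j : ℂ) * (η x * w x)) := by
        refine integral_congr_ae ?_
        filter_upwards [hu] with x hx
        rw [hx, Complex.real_smul]
        push_cast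
        ring
    _ = ∫ x, (-Complex.I * ((fderiv ℝ η x e) • w x)
          + (vectorPotential x j : ℂ) * (η x * w x)) := by
        apply setIntegral_eq_integral_of_forall_compl_eq_zero
        intro x hx
        simp [hz x fun h => hx (hs h)]
    _ = ∫ x, (Complex.I * (η x • fderiv ℝ w x e)
          + (vectorPotential x j : ℂ) * (η x * w x)) := by
        rw [integral_add (i1.const_mul _) i4, integral_add (i2.const_mul _) i4,
          integral_const_mul, integral_const_mul, parts]
        ring
    _ = ∫ x in wedge φ, (Complex.I * (η x • fderiv ℝ w x e)
          + (vectorPotential x j : ℂ) * (η x * w x)) := by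
        symm
        apply setIntegral_eq_integral_of_forall_compl_eq_zero
        intro x hx
        simp [hz x fun h => hx (hs h)]
    _ = ∫ x in wedge φ, p x * ((η x : ℝ) : ℂ) := by
        refine integral_congr_ae ?_
        filter_upwards [hp] with x hx
        rw [hx, Complex.real_smul]
        ring

theorem exists_magneticSobolev_of_contDiff (φ : ℝ) {w : Plane → ℂ} (hw : ContDiff ℝ ∞ w)
    (hc : HasCompactSupport w) :
    ∃ u : magneticSobolev φ, (u : L2Wedge φ) =ᵐ[(volume : Measure Plane).restrict (wedge φ)] w := by
  have hu : MemLp w 2 ((volume : Measure Plane).restrict (wedge φ)) :=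
    hw.continuous.memLp_of_hasCompactSupport hc
  refine ⟨⟨hu.toLp w, fun j => ?_⟩, hu.coeFn_toLp⟩
  have hw1 : Continuous fun x => fderiv ℝ w x (EuclideanSpace.single j 1) :=
    (hw.continuous_fderiv (by simp)).clm_apply continuous_const
  have hA := continuous_vectorPotential j
  have hw0 := hw.continuous
  have hp : MemLp (fun x => Complex.I * fderiv ℝ w x (EuclideanSpace.single j 1)
      + (vectorPotential x j : ℂ) * w x) 2 ((volume : Measure Plane).restrict (wedge φ)) := by
    refine Continuous.memLp_of_hasCompactSupport (by fun_prop)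
      (HasCompactSupport.intro hc fun x hx => ?_)
    have h4 : fderiv ℝ w x = 0 :=
      image_eq_zero_of_notMem_tsupport fun h => hx (tsupport_fderiv_subset ℝ h)
    simp [h4, image_eq_zero_of_notMem_tsupport hx]
  exact ⟨hp.toLp _, isMagneticDeriv_of_contDiff j (hw.of_le (by simp)) hu.coeFn_toLp hp.coeFn_toLp⟩

/-! ### The trace -/

/-- `T` is a bounded operator from `H¹_A(Ω)` to `L²(Γ)` which restricts every function that is
smooth up to the boundary, with bounded support, to `Γ`. -/
def IsTraceOperator (φ : ℝ) (T : magneticSobolev φ →ₗ[ℂ] L2Boundary φ) : Prop :=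
  (∃ C : ℝ, ∀ u : magneticSobolev φ,
      ‖T u‖ ≤ C * (‖(u : L2Wedge φ)‖ + ∑ j, ‖magneticDeriv φ j u‖)) ∧
    ∀ w : Plane → ℂ, ContDiff ℝ ∞ w → HasCompactSupport w → ∀ u : magneticSobolev φ,
      (u : L2Wedge φ) =ᵐ[(volume : Measure Plane).restrict (wedge φ)] w →
        T u =ᵐ[boundaryMeasure φ] w

open Classical in
/-- The trace `u ↦ u|_Γ` from `H¹_A(Ω)` to `L²(Γ)`: the unique bounded extension of the restriction
of smooth functions. (For the apertures `0 < φ < π` it exists by the trace theorem, and is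
unique because the smooth functions are dense; the value `0` is never used there.) -/
def trace (φ : ℝ) : magneticSobolev φ →ₗ[ℂ] L2Boundary φ :=
  if h : ∃ T, IsTraceOperator φ T then h.choose else 0

/-! ### The magnetic Robin Laplacian -/

/-- The sesquilinear form of the magnetic Robin Laplacian with parameter `β`, conjugate-linear in
the first argument; on the diagonal it is `‖(i∇ + A) u‖² - β ‖u|_Γ‖²`. -/
def robinForm (φ β : ℝ) (v u : magneticSobolev φ) : ℂ :=
  (∑ j, inner ℂ (magneticDeriv φ j v) (magneticDeriv φ j u))
    - (β : ℂ) * inner ℂ (trace φ v) (trace φ u)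

/-- The graph of the operator associated with the form: all pairs `(u, w)` such that `u` lies in
the form domain `H¹_A(Ω)` and `h(v, u) = ⟪v, w⟫` for every `v` in the form domain. -/
def robinGraph (φ β : ℝ) : Submodule ℂ (L2Wedge φ × L2Wedge φ) where
  carrier := {z | ∃ u : magneticSobolev φ, (u : L2Wedge φ) = z.1 ∧
    ∀ v : magneticSobolev φ, robinForm φ β v u = inner ℂ (v : L2Wedge φ) z.2}
  add_mem' := by
    rintro ⟨_, w⟩ ⟨_, w'⟩ ⟨u, rfl, hu⟩ ⟨u', rfl, hu'⟩
    refine ⟨u + u', rfl, fun v => ?_⟩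
    rw [Prod.mk_add_mk, inner_add_right, ← hu v, ← hu' v]
    simp only [robinForm, map_add, inner_add_right, Finset.sum_add_distrib]
    ring
  zero_mem' := ⟨0, rfl, fun v => by simp [robinForm]⟩
  smul_mem' := by
    rintro c ⟨_, w⟩ ⟨u, rfl, hu⟩
    refine ⟨c • u, rfl, fun v => ?_⟩
    rw [Prod.smul_mk, inner_smul_right, ← hu v]
    simp only [robinForm, map_smul, inner_smul_right, ← Finset.mul_sum]
    ring

/-- The form domain is dense, so that the graph is the graph of an operator. -/
theorem robinGraph_functional (φ β : ℝ) (z : L2Wedge φ × L2Wedge φ) (hz : z ∈ robinGraph φ β)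
    (h0 : z.1 = 0) : z.2 = 0 := by
  obtain ⟨u, hu, hv⟩ := hz
  have hu0 : u = 0 := Subtype.ext (hu.trans h0)
  subst hu0
  refine eq_of_forall_integral_test fun η hη hc hs => ?_
  have hη' : ContDiff ℝ ∞ fun x => ((η x : ℝ) : ℂ) := Complex.ofRealCLM.contDiff.comp hη
  have hc' : HasCompactSupport fun x => ((η x : ℝ) : ℂ) :=
    hc.comp_left (g := ((↑) : ℝ → ℂ)) Complex.ofReal_zero
  obtain ⟨v, hvη⟩ := exists_magneticSobolev_of_contDiff φ hη' hc'
  have h1 : inner ℂ (v : L2Wedge φ) z.2 = 0 := by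
    rw [← hv v]
    simp [robinForm]
  have h2 : ∫ x in wedge φ, (0 : L2Wedge φ) x * ((η x : ℝ) : ℂ) = 0 := by
    rw [← integral_zero Plane ℂ (μ := volume.restrict (wedge φ))]
    refine integral_congr_ae ?_
    filter_upwards [Lp.coeFn_zero ℂ 2 ((volume : Measure Plane).restrict (wedge φ))] with x hx
    rw [hx, Pi.zero_apply, zero_mul]
  rw [h2, ← h1, L2.inner_def]
  refine integral_congr_ae ?_
  filter_upwards [hvη] with x hx
  rw [hx, RCLike.inner_apply, Complex.conj_ofReal]

/-- The magnetic Robin Laplacian on the wedge of aperture `φ` with boundary parameter `β`: the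
operator in `L²(Ω)` associated with the form `robinForm`. -/
def robinLaplacian (φ β : ℝ) : L2Wedge φ →ₗ.[ℂ] L2Wedge φ := (robinGraph φ β).toLinearPMap

/-! ### Spectra of unbounded operators -/

section Spectrum

variable {H : Type*} [NormedAddCommGroup H] [InnerProductSpace ℂ H]

/-- The resolvent set of an unbounded operator: all `z` for which `T - z` is a bijection from the
domain of `T` onto `H` with a bounded inverse `R`. -/
def resolventSet (T : H →ₗ.[ℂ] H) : Set ℂ :=
  {z | ∃ R : H →L[ℂ] H,
    (∀ u : T.domain, R (T u - z • (u : H)) = u) ∧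
      ∀ f : H, ∃ u : T.domain, (u : H) = R f ∧ T u - z • (u : H) = f}

/-- The spectrum of an unbounded operator. -/
def spectrum (T : H →ₗ.[ℂ] H) : Set ℂ := (resolventSet T)ᶜ

/-- The eigenspace `ker (T - z)`. -/
def eigenspace (T : H →ₗ.[ℂ] H) (z : ℂ) : Submodule ℂ T.domain :=
  LinearMap.ker (T.toFun - z • T.domain.subtype)

/-- The discrete spectrum of a self-adjoint operator: the isolated points of the spectrum that are
eigenvalues of finite multiplicity. -/
def discreteSpectrum (T : H →ₗ.[ℂ] H) : Set ℂ :=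
  {z | z ∈ spectrum T ∧ (∃ ε > 0, ∀ z' ∈ spectrum T, dist z' z < ε → z' = z) ∧
    eigenspace T z ≠ ⊥ ∧ FiniteDimensional ℂ (eigenspace T z)}

/-- The essential spectrum of a self-adjoint operator: the rest of its spectrum. -/
def essentialSpectrum (T : H →ₗ.[ℂ] H) : Set ℂ := spectrum T \ discreteSpectrum T

end Spectrum

/-- The bottom `inf σ_ess` of the essential spectrum of the magnetic Robin Laplacian. -/
def robinThreshold (φ β : ℝ) : ℝ :=
  sInf {t : ℝ | (t : ℂ) ∈ essentialSpectrum (robinLaplacian φ β)}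

/-- The polynomial `P_{φ,β}`. -/
def robinPoly (φ β x : ℝ) : ℝ :=
  x ^ 4 * (2 * φ - Real.pi * Real.tanh (φ / 2)) - 8 * robinThreshold φ β * φ * x ^ 2
    - 16 * β * Real.sqrt Real.pi * x + 8 * φ

end

end MagneticWedge

/-!
The proof is variational. A smooth function of finite energy whose Rayleigh quotient lies below
`robinThreshold φ β` forces a point of the spectrum below the threshold
(`exists_discreteSpectrum_lt`), and a spectral point below the infimum of the essential spectrum is
discrete.

*The operator.* The trace inequality makes a shift `h + m` of the form equivalent to the squared
norm of `H¹_A(Ω)`, so that `H¹_A(Ω)` becomes a Hilbert space `V` with an embedding `J : V → L²(Ω)`.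
The graph of the Robin Laplacian `T` consists of the pairs `(x, y)` with `x = J J† (y + m x)`
(`graph_iff_of_form`), that is, `J J†` plays the role of `(T + m)⁻¹`. Hence the resolvent points of
`T` are the `t` for which `1 - (t + m) J J†` is invertible, and the variational principle
(`exists_mem_spectrum_le`) follows from the fact that the norm of the positive operator `J J†` is a
point of its spectrum.

*The trace.* For `0 < φ < π` the wedge is a convex cone, so that convolution with mollifiers
supported in `-Ω` maps `H¹_A(Ω)` into functions that are smooth up to the boundary. Together with
cutoffs this gives density of smooth compactly supported functions (`denseRange_restrictTest`). For
these the trace inequality `‖u‖²_Γ ≤ C ‖u‖ ‖(i∇ + A) u‖` follows from the fundamental theorem of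
calculus along rays parallel to the sides, as `∂ |u|² = 2 Re (ū ∂u)` does not see the real vector
potential (`exists_eLpNorm_boundary_le`). Therefore the trace exists, and it is the restriction for
every smooth function of finite energy (`exists_graph_of_contDiff`).

*The test function.* With `ψ = φ / 2`, consider `exp (-r² / (2 X²)) exp (i k r sinh (θ - ψ))`. The
gradient of the phase has radial component `k sinh (θ - ψ)` and angular component
`k cosh (θ - ψ)`, so that the energy density is
`exp (-r² / X²) (r² / X⁴ + k² sinh² (θ - ψ) + (r / 2 - k cosh (θ - ψ))²)`. Its integral is a
quadratic polynomial in `k`, and for the minimizing `k = √π X / (4 cosh ψ)` the energy minus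
`β ‖u‖²_Γ + Θ ‖u‖²` equals `robinPoly φ β X / 16`. The phase is not smooth at the apex. It
equals `r sinh (arcsin (ℓ / r))` with the linear function `ℓ = r sin (θ - ψ)`; replacing `r` by
`√(r² + ε)` makes it smooth on the plane without changing `|u|`, and dominated
convergence recovers the energy as `ε → 0` (`tendsto_integral_energyDensity`).
-/

namespace MagneticWedge

/-! ### Operators associated with forms, and the bottom of their spectrum -/

section Abstract

open ContinuousLinearMap

variable {H : Type*} [NormedAddCommGroup H] [InnerProductSpace ℂ H]

/-- If the graph of `T` is `{(x, y) | x = B (y + m x)}`, so that formally `B = (T + m)⁻¹`, then the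
resolvent points of `T` correspond to the invertible operators `1 - (t + m) B`. -/
theorem mem_resolventSet_iff_isUnit {T : H →ₗ.[ℂ] H} {B : H →L[ℂ] H} {m : ℂ}
    (hT : ∀ x y : H, (x, y) ∈ T.graph ↔ x = B (y + m • x)) (t : ℂ) :
    t ∈ resolventSet T ↔ IsUnit (1 - (t + m) • B : H →L[ℂ] H) := by
  set s := t + m with hs
  have hdom : ∀ u : T.domain, (u : H) = B (T u + m • (u : H)) := fun u =>
    (hT _ _).1 (T.mem_graph u)
  constructor
  · rintro ⟨R, hR1, hR2⟩
    have h1 : ∀ f, R f - s • B (R f) = B f := by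
      intro f
      obtain ⟨u, hu, huf⟩ := hR2 f
      have h := hdom u
      rw [← hu]
      have e : T u + m • (u : H) = f + s • (u : H) := by
        rw [← huf, hs, add_smul]; abel
      rw [e, map_add, map_smul] at h
      exact sub_eq_of_eq_add h
    have h2 : ∀ f, R f - s • R (B f) = B f := by
      intro f
      have hg : (B f, f - m • B f) ∈ T.graph := (hT _ _).2 (by simp)
      obtain ⟨u, hu, huf⟩ := (LinearPMap.mem_graph_iff T).1 hg
      have h := hR1 u
      simp only at hu huf
      rw [hu, huf, sub_sub, ← add_smul, add_comm m t, ← hs, map_sub, map_smul] at h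
      exact h
    refine isUnit_iff_exists.2 ⟨1 + s • R, ?_, ?_⟩
    · ext f
      change f + s • R f - s • B (f + s • R f) = f
      rw [map_add, map_smul, ← h1 f]
      simp only [smul_sub, smul_add]; abel
    · ext f
      change f - s • B f + s • R (f - s • B f) = f
      rw [map_sub, map_smul, h2 f, sub_add_cancel]
  · intro h
    obtain ⟨S, hS1, hS2⟩ := isUnit_iff_exists.1 h
    have c1 : ∀ x, S x - s • B (S x) = x := fun x => by
      simpa using congrArg (fun A : H →L[ℂ] H => A x) hS1
    have c2 : ∀ x, S x - s • S (B x) = x := fun x => by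
      simpa using congrArg (fun A : H →L[ℂ] H => A x) hS2
    refine ⟨S * B, fun u => ?_, fun f => ?_⟩
    · have h := hdom u
      have e : B (T u - t • (u : H)) = u - s • B u := by
        have e' : T u - t • (u : H) = (T u + m • (u : H)) - s • (u : H) := by
          rw [hs, add_smul]; abel
        rw [e', map_sub, map_smul, ← h]
      change S (B (T u - t • (u : H))) = u
      rw [e, map_sub, map_smul]
      exact c2 _
    · have hg : ((S * B) f, f + t • (S * B) f) ∈ T.graph := by
        refine (hT _ _).2 ?_
        have := c1 (B f)
        change S (B f) = B (f + t • S (B f) + m • S (B f))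
        rw [add_assoc, ← add_smul, map_add, map_smul]
        exact eq_add_of_sub_eq this
      obtain ⟨u, hu, huf⟩ := (LinearPMap.mem_graph_iff T).1 hg
      refine ⟨u, hu, ?_⟩
      simp only at hu huf
      rw [huf, hu]; simp

variable [CompleteSpace H] {V : Type*} [NormedAddCommGroup V] [InnerProductSpace ℂ V]
  [CompleteSpace V]

/-- The graph of the operator associated with the form `⟪v, u⟫ - m ⟪J v, J u⟫` is determined by the
positive operator `J J†`. -/
theorem graph_iff_of_form {T : H →ₗ.[ℂ] H} (J : V →L[ℂ] H) {m : ℂ}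
    (hT : ∀ x y : H, (x, y) ∈ T.graph ↔
      ∃ u : V, J u = x ∧ ∀ v, inner ℂ v u - m * inner ℂ (J v) (J u) = inner ℂ (J v) y) (x y : H) :
    (x, y) ∈ T.graph ↔ x = (J ∘L adjoint J) (y + m • x) := by
  rw [hT]
  have key : ∀ u : V, (∀ v, inner ℂ v u - m * inner ℂ (J v) (J u) = inner ℂ (J v) y) ↔
      u = adjoint J (y + m • J u) := by
    intro u
    constructor
    · intro h
      refine ext_inner_left ℂ fun v => ?_
      rw [adjoint_inner_right, inner_add_right, inner_smul_right, ← h v]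
      ring
    · intro h v
      conv_lhs => enter [1]; rw [h]
      rw [adjoint_inner_right, inner_add_right, inner_smul_right]
      ring
  constructor
  · rintro ⟨u, rfl, hu⟩
    have := (key u).1 hu
    simp only [ContinuousLinearMap.comp_apply]
    exact congrArg J this
  · intro h
    refine ⟨adjoint J (y + m • x), h.symm, (key _).2 ?_⟩
    simp only [ContinuousLinearMap.comp_apply] at h
    rw [← h]

/-- The spectrum of the operator associated with a form that is bounded below by `-m` contains no
real number below `-m`. -/
theorem neg_le_of_mem_spectrum {T : H →ₗ.[ℂ] H} (J : V →L[ℂ] H) {m : ℝ}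
    (hT : ∀ x y : H, (x, y) ∈ T.graph ↔
      ∃ u : V, J u = x ∧
        ∀ v, inner ℂ v u - (m : ℂ) * inner ℂ (J v) (J u) = inner ℂ (J v) y)
    {t : ℝ} (ht : (t : ℂ) ∈ spectrum T) : -m ≤ t := by
  by_contra! hlt
  refine ht ((mem_resolventSet_iff_isUnit (graph_iff_of_form J hT) t).2 ?_)
  have hpos : (0 : ℝ) < -(t + m) := by linarith
  refine isUnit_of_forall_le_norm_inner_map _ (c := 1) one_pos fun x => ?_
  have e : inner ℂ ((1 - ((t : ℂ) + m) • (J ∘L adjoint J)) x) x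
      = ((‖x‖ ^ 2 + -(t + m) * ‖adjoint J x‖ ^ 2 : ℝ) : ℂ) := by
    have h1 : inner ℂ (J (adjoint J x)) x = ((‖adjoint J x‖ : ℂ) ^ 2) := by
      rw [← adjoint_inner_right, inner_self_eq_norm_sq_to_K]; rfl
    simp only [sub_apply, smul_apply, ContinuousLinearMap.comp_apply, inner_sub_left,
      inner_smul_left, h1]
    push_cast
    simp
    ring
  rw [e, Complex.norm_real, Real.norm_eq_abs]
  refine le_trans ?_ (le_abs_self _)
  simp only [NNReal.coe_one, mul_one]
  have : 0 ≤ -(t + m) * ‖adjoint J x‖ ^ 2 := mul_nonneg hpos.le (sq_nonneg _)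
  linarith

/-- The variational principle: some spectral point lies below every Rayleigh quotient. -/
theorem exists_mem_spectrum_le {T : H →ₗ.[ℂ] H} (J : V →L[ℂ] H) {m : ℝ}
    (hT : ∀ x y : H, (x, y) ∈ T.graph ↔
      ∃ u : V, J u = x ∧
        ∀ v, inner ℂ v u - (m : ℂ) * inner ℂ (J v) (J u) = inner ℂ (J v) y)
    {u : V} (hu : J u ≠ 0) :
    ∃ t : ℝ, (t : ℂ) ∈ spectrum T ∧ t * ‖J u‖ ^ 2 ≤ ‖u‖ ^ 2 - m * ‖J u‖ ^ 2 := by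
  have : Nontrivial H := ⟨J u, 0, hu⟩
  set B : H →L[ℂ] H := J ∘L adjoint J with hB
  have hBnn : 0 ≤ B := by
    rw [nonneg_iff_isPositive]
    exact ContinuousLinearMap.isPositive_self_comp_adjoint J
  -- As `B` plays the role of `(T + m)⁻¹`, the point `‖B‖` corresponds to `1 / ‖B‖ - m` for `T`.
  have hmem : ‖B‖ ∈ _root_.spectrum ℝ B := CStarAlgebra.norm_mem_spectrum_of_nonneg hBnn
  have hnorm : ‖B‖ = ‖J‖ ^ 2 := by
    have := ContinuousLinearMap.norm_adjoint_comp_self (adjoint J)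
    rw [adjoint_adjoint] at this
    rw [hB, this]
    simp [sq]
  have hJpos : 0 < ‖J‖ := norm_pos_iff.2 (by rintro rfl; simp at hu)
  set b := ‖B‖ with hb
  have hbpos : 0 < b := by rw [hnorm]; positivity
  have hbC : (b : ℂ) ≠ 0 := by exact_mod_cast hbpos.ne'
  refine ⟨1 / b - m, fun hres => ?_, ?_⟩
  · have h1 := (mem_resolventSet_iff_isUnit (graph_iff_of_form J hT) _).1 hres
    apply _root_.spectrum.mem_iff.1 hmem
    have e : algebraMap ℝ (H →L[ℂ] H) b - B
        = (algebraMap ℂ (H →L[ℂ] H) b) * (1 - (((1 / b - m : ℝ) : ℂ) + m) • (J ∘L adjoint J)) := by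
      have : (((1 / b - m : ℝ) : ℂ) + m) = (b : ℂ)⁻¹ := by push_cast; ring
      rw [this, mul_sub, mul_one, ← Algebra.smul_def, smul_smul, mul_inv_cancel₀ hbC, one_smul]
      rfl
    rw [e]
    exact ((IsUnit.mk0 (b : ℂ) hbC).map _).mul h1
  · have h2 : ‖J u‖ ^ 2 ≤ b * ‖u‖ ^ 2 := by
      rw [hnorm, ← mul_pow]
      exact pow_le_pow_left₀ (norm_nonneg _) (J.le_opNorm u) 2
    have h3 : 1 / b * ‖J u‖ ^ 2 ≤ ‖u‖ ^ 2 := by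
      rw [one_div, inv_mul_le_iff₀ hbpos]; exact h2
    linarith [sub_mul (1 / b) m (‖J u‖ ^ 2)]

end Abstract

open Filter Topology Set

/-! ### The geometry of the wedge -/

/-- For `0 < φ < π` the wedge is the intersection of two open half-planes. -/
theorem mem_wedge_iff {φ : ℝ} (hφ : φ ∈ Ioo 0 Real.pi) (x : Plane) :
    x ∈ wedge φ ↔ 0 < x 1 ∧ 0 < x 0 * Real.sin φ - x 1 * Real.cos φ := by
  constructor
  · rintro ⟨r, θ, hr, h0, hθ, rfl⟩
    have h1 : 0 < Real.sin θ := Real.sin_pos_of_pos_of_lt_pi h0 (hθ.trans hφ.2)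
    have h2 : 0 < Real.sin (φ - θ) :=
      Real.sin_pos_of_pos_of_lt_pi (by linarith) (by linarith [hφ.2])
    rw [Real.sin_sub] at h2
    simp only [polar]
    refine ⟨by simpa using mul_pos hr h1, ?_⟩
    have := mul_pos hr h2
    simp only [Matrix.cons_val_zero, Matrix.cons_val_one]
    nlinarith
  · rintro ⟨h1, h2⟩
    set z : ℂ := ⟨x 0, x 1⟩ with hz
    have hz0 : z ≠ 0 := fun h => by
      have := congrArg Complex.im h
      simp [hz] at this
      exact h1.ne' this
    have hr : 0 < ‖z‖ := norm_pos_iff.2 hz0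
    have hc : ‖z‖ * Real.cos z.arg = x 0 := Complex.norm_mul_cos_arg z
    have hs : ‖z‖ * Real.sin z.arg = x 1 := Complex.norm_mul_sin_arg z
    have h0 : 0 < z.arg := by
      refine lt_of_le_of_ne (Complex.arg_nonneg_iff.2 h1.le) fun h => ?_
      rw [← h] at hs
      simp at hs
      exact h1.ne hs
    refine ⟨‖z‖, z.arg, hr, h0, ?_, ?_⟩
    · by_contra! hle
      have h3 : 0 ≤ Real.sin (z.arg - φ) :=
        Real.sin_nonneg_of_nonneg_of_le_pi (by linarith) (by linarith [Complex.arg_le_pi z, hφ.1])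
      rw [Real.sin_sub] at h3
      rw [← hc, ← hs] at h2
      have := mul_nonneg hr.le h3
      nlinarith
    · ext i
      fin_cases i
      · simpa [polar] using hc.symm
      · simpa [polar] using hs.symm

theorem add_mem_wedge {φ : ℝ} (hφ : φ ∈ Ioo 0 Real.pi) {x y : Plane} (hx : x ∈ wedge φ)
    (hy : y ∈ wedge φ) : x + y ∈ wedge φ := by
  rw [mem_wedge_iff hφ] at *
  simp only [PiLp.add_apply]
  constructor
  · linarith [hx.1, hy.1]
  · nlinarith [hx.2, hy.2]

theorem norm_polar {r : ℝ} (hr : 0 ≤ r) (θ : ℝ) : ‖polar r θ‖ = r := by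
  rw [EuclideanSpace.norm_eq]
  simp only [polar, Fin.sum_univ_two, PiLp.toLp_apply, Matrix.cons_val_zero, Matrix.cons_val_one,
    Real.norm_eq_abs, sq_abs]
  rw [show (r * Real.cos θ) ^ 2 + (r * Real.sin θ) ^ 2 = r ^ 2 by
    nlinarith [Real.sin_sq_add_cos_sq θ], Real.sqrt_sq hr]

/-- Mollifiers supported in `-Ω`, arbitrarily close to the apex. As the wedge is a convex cone,
convolution with them at points of `Ω` involves only values in `Ω`. -/
theorem exists_mollifier {φ : ℝ} (hφ : 0 < φ) {δ : ℝ} (hδ : 0 < δ) :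
    ∃ ρ : Plane → ℝ, ContDiff ℝ ∞ ρ ∧ HasCompactSupport ρ ∧ (∀ x, 0 ≤ ρ x) ∧ ∫ x, ρ x = 1 ∧
      ∀ y ∈ tsupport ρ, -y ∈ wedge φ ∧ ‖y‖ < δ := by
  have hU : IsOpen ({y : Plane | -y ∈ wedge φ} ∩ {y | ‖y‖ < δ}) :=
    ((isOpen_wedge φ).preimage continuous_neg).inter (isOpen_lt continuous_norm continuous_const)
  have hc : -polar (δ / 2) (φ / 2) ∈ ({y : Plane | -y ∈ wedge φ} ∩ {y | ‖y‖ < δ}) := by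
    refine ⟨?_, ?_⟩
    · change - -polar (δ / 2) (φ / 2) ∈ wedge φ
      rw [neg_neg]
      exact ⟨δ / 2, φ / 2, by linarith, by linarith, by linarith, rfl⟩
    · change ‖-polar (δ / 2) (φ / 2)‖ < δ
      rw [norm_neg, norm_polar (by linarith)]
      linarith
  obtain ⟨r, hr, hrU⟩ := Metric.nhds_basis_closedBall.mem_iff.1 (hU.mem_nhds hc)
  let f : ContDiffBump (-polar (δ / 2) (φ / 2)) := ⟨r / 2, r, by linarith, by linarith⟩
  refine ⟨f.normed volume, f.contDiff_normed, f.hasCompactSupport_normed,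
    fun x => f.nonneg_normed x, f.integral_normed, fun y hy => ?_⟩
  rw [f.tsupport_normed_eq] at hy
  exact hrU hy

/-! ### Approximate identities in `L²` -/

/-- Translations act continuously on `L²`. -/
theorem exists_translation_small {g : Plane → ℂ} (hg : MemLp g 2 volume) {ε : ENNReal}
    (hε : ε ≠ 0) : ∃ δ > 0, ∀ y : Plane, ‖y‖ < δ →
      eLpNorm (fun x => g (x - y) - g x) 2 volume ≤ ε := by
  have : Fact ((2 : ENNReal) ≠ ⊤) := ⟨by norm_num⟩
  let f : Lp ℂ 2 (volume : Measure Plane) := hg.toLp g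
  have hcont : Continuous fun y : Plane => (DomAddAct.mk y) +ᵥ f := by fun_prop
  have h0 : Tendsto (fun y : Plane => edist ((DomAddAct.mk (-y)) +ᵥ f) f) (𝓝 0) (𝓝 0) := by
    have h1 : Continuous fun y : Plane => edist ((DomAddAct.mk (-y)) +ᵥ f) f :=
      (hcont.comp continuous_neg).edist continuous_const
    have := h1.tendsto 0
    simpa using this
  have h2 := h0.eventually (ge_mem_nhds (pos_iff_ne_zero.2 hε))
  obtain ⟨δ, hδ, h3⟩ := Metric.eventually_nhds_iff.1 h2
  refine ⟨δ, hδ, fun y hy => ?_⟩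
  have h4 := h3 (y := y) (by simpa using hy)
  rw [Lp.edist_def] at h4
  refine le_trans (le_of_eq (eLpNorm_congr_ae ?_)) h4
  have hmp : MeasurePreserving (fun x : Plane => -y + x) volume volume :=
    measurePreserving_add_left volume (-y)
  have e1 : ((DomAddAct.mk (-y)) +ᵥ f : Lp ℂ 2 (volume : Measure Plane)) =ᵐ[volume]
      fun x => f (-y + x) := Lp.coeFn_compMeasurePreserving f hmp
  have e2 := hmp.quasiMeasurePreserving.ae_eq_comp hg.coeFn_toLp
  filter_upwards [e1, e2, hg.coeFn_toLp] with x h1 h2 h3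
  simp only [Function.comp] at h2
  rw [Pi.sub_apply, h1, h2, h3, neg_add_eq_sub]

/-- Averages over small translations are close in `L²`. -/
theorem exists_average_small {g : Plane → ℂ} (hgm : StronglyMeasurable g)
    (hg : MemLp g 2 volume) {ε : ENNReal} (hε : ε ≠ 0) :
    ∃ δ > 0, ∀ ν : Measure Plane, IsProbabilityMeasure ν → (∀ᵐ y ∂ν, ‖y‖ < δ) →
      (∀ x, Integrable (fun y => g (x - y)) ν) →
      eLpNorm (fun x => (∫ y, g (x - y) ∂ν) - g x) 2 volume ≤ ε := by
  obtain ⟨δ, hδ, h⟩ := exists_translation_small hg hε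
  refine ⟨δ, hδ, fun ν hν hsupp hint => ?_⟩
  have hsq : ∀ F : Plane → ℂ, eLpNorm F 2 volume ^ 2 = ∫⁻ x, ‖F x‖ₑ ^ 2 := fun F => by
    simpa using eLpNorm_nnreal_pow_eq_lintegral (μ := (volume : Measure Plane)) (f := F) (p := 2)
      (by norm_num)
  have hmeas : StronglyMeasurable fun q : Plane × Plane => g (q.1 - q.2) - g q.1 :=
    (hgm.comp_measurable (measurable_fst.sub measurable_snd)).sub
      (hgm.comp_measurable measurable_fst)
  have hpt : ∀ x, ‖(∫ y, g (x - y) ∂ν) - g x‖ₑ ^ 2 ≤ ∫⁻ y, ‖g (x - y) - g x‖ₑ ^ 2 ∂ν := by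
    intro x
    have e : (∫ y, g (x - y) ∂ν) - g x = ∫ y, (g (x - y) - g x) ∂ν := by
      rw [integral_sub (hint x) (integrable_const _)]; simp
    have hm : AEStronglyMeasurable (fun y => g (x - y) - g x) ν :=
      (hmeas.comp_measurable (measurable_const.prodMk measurable_id)).aestronglyMeasurable
    have h1 := eLpNorm_le_eLpNorm_of_exponent_le (μ := ν) (p := 1) (q := 2) (by norm_num) hm
    have h2 : eLpNorm (fun y => g (x - y) - g x) 2 ν ^ 2 = ∫⁻ y, ‖g (x - y) - g x‖ₑ ^ 2 ∂ν := by
      simpa using eLpNorm_nnreal_pow_eq_lintegral (μ := ν) (f := fun y => g (x - y) - g x) (p := 2)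
        (by norm_num)
    rw [← h2, e]
    gcongr
    refine (enorm_integral_le_lintegral_enorm _).trans ?_
    rwa [eLpNorm_one_eq_lintegral_enorm] at h1
  rw [← ENNReal.pow_le_pow_left_iff (n := 2) (by norm_num), hsq]
  calc ∫⁻ x, ‖(∫ y, g (x - y) ∂ν) - g x‖ₑ ^ 2
      ≤ ∫⁻ x, ∫⁻ y, ‖g (x - y) - g x‖ₑ ^ 2 ∂ν := lintegral_mono hpt
    _ = ∫⁻ y, (∫⁻ x, ‖g (x - y) - g x‖ₑ ^ 2) ∂ν :=
        lintegral_lintegral_swap (hmeas.enorm.pow_const 2).aemeasurable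
    _ ≤ ∫⁻ _, ε ^ 2 ∂ν := by
        refine lintegral_mono_ae ?_
        filter_upwards [hsupp] with y hy
        rw [← hsq]
        gcongr
        exact h y hy
    _ = ε ^ 2 := by simp

/-! ### The graph of the magnetic gradient -/

/-- The graph of the magnetic gradient, as a subspace of `L² × L²(·; ℂ²)`. Unlike `magneticSobolev`,
which carries the `L²` norm, this copy of `H¹_A(Ω)` carries the graph norm. -/
noncomputable def sobolevGraph (φ : ℝ) : Submodule ℂ (L2Wedge φ × (Fin 2 → L2Wedge φ)) where
  carrier := {z | ∀ j, IsMagneticDeriv φ j z.1 (z.2 j)}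
  add_mem' hz hz' j := (hz j).add (hz' j)
  zero_mem' j := IsMagneticDeriv.zero φ j
  smul_mem' c _ hz j := (hz j).smul c

/-- The identification of `H¹_A(Ω)` with the graph of the magnetic gradient. -/
noncomputable def toSobolevGraph (φ : ℝ) : magneticSobolev φ →ₗ[ℂ] sobolevGraph φ where
  toFun u := ⟨(u, fun j => magneticDeriv φ j u), fun j => magneticDeriv_spec j u⟩
  map_add' u v := by ext1; simp; rfl
  map_smul' c u := by ext1; simp; rfl

/-- The inverse of `toSobolevGraph`. -/
noncomputable def ofSobolevGraph (φ : ℝ) : sobolevGraph φ →ₗ[ℂ] magneticSobolev φ where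
  toFun z := ⟨z.1.1, fun j => ⟨z.1.2 j, z.2 j⟩⟩
  map_add' _ _ := rfl
  map_smul' _ _ := rfl

theorem magneticDeriv_ofSobolevGraph {φ : ℝ} (z : sobolevGraph φ) (j : Fin 2) :
    magneticDeriv φ j (ofSobolevGraph φ z) = z.1.2 j :=
  (magneticDeriv_spec j _).unique (z.2 j)

theorem sobolevGraph_ext {φ : ℝ} {z z' : sobolevGraph φ} (h : z.1.1 = z'.1.1) : z = z' :=
  Subtype.ext (Prod.ext h (funext fun j => (z.2 j).unique (h ▸ z'.2 j)))

/-- Pairing with a fixed bounded compactly supported function is continuous on `L²`. -/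
theorem continuous_integral_mul {φ : ℝ} {g : Plane → ℂ} (hg : Continuous g)
    (hc : HasCompactSupport g) : Continuous fun u : L2Wedge φ => ∫ x in wedge φ, u x * g x := by
  have hm : MemLp (fun x => starRingEnd ℂ (g x)) 2 (volume.restrict (wedge φ)) :=
    Continuous.memLp_of_hasCompactSupport (Complex.continuous_conj.comp hg)
      (hc.comp_left (g := starRingEnd ℂ) (map_zero _))
  have : (fun u : L2Wedge φ => ∫ x in wedge φ, u x * g x) = fun u => inner ℂ (hm.toLp _) u := by
    ext u
    rw [L2.inner_def]
    refine integral_congr_ae ?_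
    filter_upwards [hm.coeFn_toLp] with x hx
    rw [hx, RCLike.inner_apply, Complex.conj_conj]
  rw [this]
  fun_prop

theorem isClosed_sobolevGraph (φ : ℝ) :
    IsClosed (sobolevGraph φ : Set (L2Wedge φ × (Fin 2 → L2Wedge φ))) := by
  have : (sobolevGraph φ : Set (L2Wedge φ × (Fin 2 → L2Wedge φ))) =
      ⋂ (j : Fin 2) (η : Plane → ℝ) (_ : ContDiff ℝ ∞ η) (_ : HasCompactSupport η)
        (_ : tsupport η ⊆ wedge φ), {z | ∫ x in wedge φ, z.1 x *
          (-Complex.I * ((fderiv ℝ η x (EuclideanSpace.single j 1) : ℝ) : ℂ)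
          + ((vectorPotential x j * η x : ℝ) : ℂ)) =
            ∫ x in wedge φ, z.2 j x * ((η x : ℝ) : ℂ)} := by
    ext z
    simp only [mem_iInter]
    rfl
  rw [this]
  refine isClosed_iInter fun j => isClosed_iInter fun η => isClosed_iInter fun hη =>
    isClosed_iInter fun hc => isClosed_iInter fun _ => ?_
  obtain ⟨h1, h2⟩ := test_regular hη hc j
  refine isClosed_eq ((continuous_integral_mul h1 h2).comp continuous_fst) ?_
  refine (continuous_integral_mul (Complex.continuous_ofReal.comp hη.continuous)
    (hc.comp_left (g := ((↑) : ℝ → ℂ)) Complex.ofReal_zero)).comp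
    ((continuous_apply j).comp continuous_snd)

/-- Smooth compactly supported functions on the whole plane, to be restricted to the wedge. -/
def testSpace : Submodule ℂ (Plane → ℂ) where
  carrier := {w | ContDiff ℝ ∞ w ∧ HasCompactSupport w}
  add_mem' h h' := ⟨h.1.add h'.1, h.2.add h'.2⟩
  zero_mem' := ⟨contDiff_const, HasCompactSupport.zero⟩
  smul_mem' c _ h := ⟨contDiff_const.smul h.1, h.2.comp_left (g := fun z => c • z) (smul_zero c)⟩

/-- The `j`-th component of the classical magnetic gradient `(i∇ + A) w`. -/
noncomputable def magGrad (j : Fin 2) (w : Plane → ℂ) (x : Plane) : ℂ :=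
  Complex.I * fderiv ℝ w x (EuclideanSpace.single j 1) + (vectorPotential x j : ℂ) * w x

theorem continuous_magGrad (j : Fin 2) {w : Plane → ℂ} (hw : ContDiff ℝ 1 w) :
    Continuous (magGrad j w) := by
  have h1 : Continuous fun x => fderiv ℝ w x (EuclideanSpace.single j 1) :=
    (hw.continuous_fderiv (by simp)).clm_apply continuous_const
  have hA := continuous_vectorPotential j
  have hw0 := hw.continuous
  unfold magGrad
  fun_prop

theorem hasCompactSupport_magGrad (j : Fin 2) {w : Plane → ℂ} (hc : HasCompactSupport w) :
    HasCompactSupport (magGrad j w) :=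
  HasCompactSupport.intro hc fun x hx => by
    have h4 : fderiv ℝ w x = 0 :=
      image_eq_zero_of_notMem_tsupport fun h => hx (tsupport_fderiv_subset ℝ h)
    simp [magGrad, h4, image_eq_zero_of_notMem_tsupport hx]

theorem memLp_testSpace (w : testSpace) (μ : Measure Plane) [IsFiniteMeasureOnCompacts μ] :
    MemLp (w : Plane → ℂ) 2 μ :=
  w.2.1.continuous.memLp_of_hasCompactSupport w.2.2

theorem memLp_magGrad (w : testSpace) (j : Fin 2) (φ : ℝ) :
    MemLp (magGrad j w) 2 (volume.restrict (wedge φ)) :=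
  (continuous_magGrad j (w.2.1.of_le (by simp))).memLp_of_hasCompactSupport
    (hasCompactSupport_magGrad j w.2.2)

/-- Elements of the graph represented by functions that are `C¹` on the plane. -/
noncomputable def graphOfContDiff (φ : ℝ) {w : Plane → ℂ} (hw : ContDiff ℝ 1 w)
    (h : MemLp w 2 (volume.restrict (wedge φ)))
    (h' : ∀ j, MemLp (magGrad j w) 2 (volume.restrict (wedge φ))) : sobolevGraph φ :=
  ⟨(h.toLp w, fun j => (h' j).toLp _), fun j =>
    isMagneticDeriv_of_contDiff j hw h.coeFn_toLp (h' j).coeFn_toLp⟩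

/-- The restriction of test functions to the wedge. -/
noncomputable def restrictTest (φ : ℝ) : testSpace →ₗ[ℂ] sobolevGraph φ where
  toFun w := graphOfContDiff φ (w.2.1.of_le (by simp)) (memLp_testSpace w _)
    (fun j => memLp_magGrad w j φ)
  map_add' w w' := sobolevGraph_ext rfl
  map_smul' c w := sobolevGraph_ext rfl

theorem restrictTest_fst {φ : ℝ} (w : testSpace) :
    (restrictTest φ w).1.1 =ᵐ[volume.restrict (wedge φ)] w :=
  (memLp_testSpace w (volume.restrict (wedge φ))).coeFn_toLp

theorem restrictTest_snd {φ : ℝ} (w : testSpace) (j : Fin 2) :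
    (restrictTest φ w).1.2 j =ᵐ[volume.restrict (wedge φ)] magGrad j w :=
  (memLp_magGrad w j φ).coeFn_toLp

attribute [irreducible] restrictTest

theorem norm_restrictTest_fst {φ : ℝ} (w : testSpace) :
    ‖(restrictTest φ w).1.1‖ =
      (eLpNorm (w : Plane → ℂ) 2 (volume.restrict (wedge φ))).toReal := by
  rw [Lp.norm_def, eLpNorm_congr_ae (restrictTest_fst w)]

theorem norm_restrictTest_snd {φ : ℝ} (w : testSpace) (j : Fin 2) :
    ‖(restrictTest φ w).1.2 j‖ =
      (eLpNorm (magGrad j (w : Plane → ℂ)) 2 (volume.restrict (wedge φ))).toReal := by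
  rw [Lp.norm_def, eLpNorm_congr_ae (restrictTest_snd w j)]

theorem norm_le_of_mem_sobolevGraph {φ : ℝ} (z : sobolevGraph φ) :
    ‖z.1.1‖ ≤ ‖z‖ ∧ ∀ j, ‖z.1.2 j‖ ≤ ‖z‖ :=
  ⟨norm_fst_le z.1, fun j => (norm_le_pi_norm z.1.2 j).trans (norm_snd_le z.1)⟩

theorem norm_mul_sum_norm_le {φ : ℝ} (z : sobolevGraph φ) :
    ‖z.1.1‖ * ∑ j, ‖z.1.2 j‖ ≤ 2 * ‖z‖ ^ 2 := by
  obtain ⟨h1, h2⟩ := norm_le_of_mem_sobolevGraph z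
  rw [Fin.sum_univ_two]
  calc ‖z.1.1‖ * (‖z.1.2 0‖ + ‖z.1.2 1‖) ≤ ‖z‖ * (‖z‖ + ‖z‖) := by
        gcongr
        exacts [h2 0, h2 1]
    _ = 2 * ‖z‖ ^ 2 := by ring

theorem norm_sq_le_of_mem_sobolevGraph {φ : ℝ} (z : sobolevGraph φ) :
    ‖z‖ ^ 2 ≤ ‖z.1.1‖ ^ 2 + ∑ j, ‖z.1.2 j‖ ^ 2 := by
  have h1 : ∀ j, ‖z.1.2 j‖ ^ 2 ≤ ∑ j, ‖z.1.2 j‖ ^ 2 := fun j =>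
    Finset.single_le_sum (f := fun j => ‖z.1.2 j‖ ^ 2) (fun _ _ => sq_nonneg _)
      (Finset.mem_univ j)
  have h2 : ‖z‖ ≤ Real.sqrt (‖z.1.1‖ ^ 2 + ∑ j, ‖z.1.2 j‖ ^ 2) := by
    refine max_le (Real.le_sqrt_of_sq_le ?_)
      ((pi_norm_le_iff_of_nonneg (Real.sqrt_nonneg _)).2 fun j => Real.le_sqrt_of_sq_le ?_)
    · exact le_add_of_nonneg_right ((sq_nonneg _).trans (h1 0))
    · exact (h1 j).trans (le_add_of_nonneg_left (sq_nonneg _))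
  have h3 : 0 ≤ ‖z.1.1‖ ^ 2 + ∑ j, ‖z.1.2 j‖ ^ 2 :=
    add_nonneg (sq_nonneg _) ((sq_nonneg _).trans (h1 0))
  exact (Real.le_sqrt (norm_nonneg _) h3).1 h2

/-! ### Cutoffs -/

/-- The product rule `(i∇ + A) (χ u) = χ (i∇ + A) u + i (∇χ) u`. -/
theorem IsMagneticDeriv.smooth_mul {φ : ℝ} {j : Fin 2} {u p u' p' : L2Wedge φ}
    (h : IsMagneticDeriv φ j u p) {χ : Plane → ℝ} (hχ : ContDiff ℝ ∞ χ)
    (hu : u' =ᵐ[volume.restrict (wedge φ)] fun x => (χ x : ℂ) * u x)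
    (hp : p' =ᵐ[volume.restrict (wedge φ)] fun x => (χ x : ℂ) * p x +
      Complex.I * (fderiv ℝ χ x (EuclideanSpace.single j 1) : ℂ) * u x) :
    IsMagneticDeriv φ j u' p' := by
  intro η hη hc hs
  set e : Plane := EuclideanSpace.single j 1
  have hsub : tsupport (fun x => χ x * η x) ⊆ tsupport η := tsupport_mul_subset_right
  have h1 := h (fun x => χ x * η x) (hχ.mul hη) hc.mul_left (hsub.trans hs)
  have hd : ∀ x, fderiv ℝ (fun x => χ x * η x) x e =
      χ x * fderiv ℝ η x e + η x * fderiv ℝ χ x e := by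
    intro x
    rw [fderiv_fun_mul ((hχ.differentiable (by simp)) x) ((hη.differentiable (by simp)) x)]
    simp
  have hη0 := hη.continuous
  have hχ1 : Continuous fun x => fderiv ℝ χ x e :=
    (hχ.continuous_fderiv (by simp)).clm_apply continuous_const
  have i3 : Integrable (fun x => u x * (Complex.I * ((η x : ℂ) * (fderiv ℝ χ x e : ℂ))))
      (volume.restrict (wedge φ)) :=
    integrable_mul_test u (by fun_prop) (HasCompactSupport.intro hc fun x hx => by
      simp [image_eq_zero_of_notMem_tsupport hx])
  have hχ0 := hχ.continuous
  have i1 : Integrable (fun x => p x * (((χ x * η x : ℝ)) : ℂ)) (volume.restrict (wedge φ)) :=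
    integrable_mul_test p (by fun_prop) (HasCompactSupport.intro hc fun x hx => by
      simp [image_eq_zero_of_notMem_tsupport hx])
  obtain ⟨hr, hr'⟩ := test_regular (hχ.mul hη) (hc.mul_left (f := χ)) j
  have i2 := integrable_mul_test u hr hr'
  calc ∫ x in wedge φ, u' x * (-Complex.I * ((fderiv ℝ η x e : ℝ) : ℂ)
        + ((vectorPotential x j * η x : ℝ) : ℂ))
      = ∫ x in wedge φ, (u x * (-Complex.I * ((fderiv ℝ (fun x => χ x * η x) x e : ℝ) : ℂ)
        + ((vectorPotential x j * (χ x * η x) : ℝ) : ℂ))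
        + u x * (Complex.I * ((η x : ℂ) * (fderiv ℝ χ x e : ℂ)))) := by
        refine integral_congr_ae ?_
        filter_upwards [hu] with x hx
        rw [hx, hd]
        push_cast
        ring
    _ = ∫ x in wedge φ, (p x * (((χ x * η x : ℝ)) : ℂ)
        + u x * (Complex.I * ((η x : ℂ) * (fderiv ℝ χ x e : ℂ)))) := by
        rw [integral_add i1 i3, ← h1]
        exact integral_add i2 i3
    _ = _ := by
        refine integral_congr_ae ?_
        filter_upwards [hp] with x hx
        rw [hx]
        push_cast
        ring

/-- A smooth bump that equals `1` on the unit ball and vanishes outside the ball of radius `2`. -/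
def unitBump : ContDiffBump (0 : Plane) := ⟨1, 2, by norm_num, by norm_num⟩

/-- Smooth cutoffs on balls of radius of order `n`. -/
noncomputable def cutoff (n : ℕ) (x : Plane) : ℝ := unitBump ((n + 1 : ℝ)⁻¹ • x)

theorem contDiff_cutoff (n : ℕ) : ContDiff ℝ ∞ (cutoff n) :=
  unitBump.contDiff.comp (contDiff_const_smul _)

theorem cutoff_mem (n : ℕ) (x : Plane) : 0 ≤ cutoff n x ∧ cutoff n x ≤ 1 :=
  ⟨unitBump.nonneg, unitBump.le_one⟩

theorem cutoff_eq_zero {n : ℕ} {x : Plane} (hx : 2 * (n + 1 : ℝ) ≤ ‖x‖) : cutoff n x = 0 := by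
  refine unitBump.zero_of_le_dist ?_
  have : (0 : ℝ) < n + 1 := by positivity
  rw [dist_zero_right, norm_smul, norm_inv, Real.norm_of_nonneg this.le]
  change (2 : ℝ) ≤ _
  rwa [inv_mul_eq_div, le_div_iff₀ this]

theorem hasCompactSupport_cutoff (n : ℕ) : HasCompactSupport (cutoff n) :=
  HasCompactSupport.intro (isCompact_closedBall (0 : Plane) (2 * (n + 1 : ℝ))) fun x hx =>
    cutoff_eq_zero (by simpa using (not_le.1 (by simpa using hx)).le)

theorem eventually_cutoff_eq_one (x : Plane) : ∀ᶠ n in atTop, cutoff n x = 1 := by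
  obtain ⟨N, hN⟩ := exists_nat_ge ‖x‖
  filter_upwards [eventually_ge_atTop N] with n hn
  have h1 : (N : ℝ) ≤ n := by exact_mod_cast hn
  have : (0 : ℝ) < n + 1 := by positivity
  refine unitBump.one_of_mem_closedBall ?_
  rw [mem_closedBall_zero_iff, norm_smul, norm_inv, Real.norm_of_nonneg this.le]
  change _ ≤ (1 : ℝ)
  rw [inv_mul_eq_div, div_le_one this]
  linarith

theorem exists_fderiv_cutoff_le :
    ∃ C : ℝ, 0 ≤ C ∧ ∀ n x, ‖fderiv ℝ (cutoff n) x‖ ≤ C * (n + 1 : ℝ)⁻¹ := by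
  have hf : ContDiff ℝ ∞ (unitBump : Plane → ℝ) := unitBump.contDiff
  obtain ⟨C, hC⟩ := (hf.continuous_fderiv (by simp)).bounded_above_of_compact_support
    (unitBump.hasCompactSupport.fderiv (𝕜 := ℝ))
  refine ⟨C, (norm_nonneg _).trans (hC 0), fun n x => ?_⟩
  have : cutoff n = fun x => unitBump ((n + 1 : ℝ)⁻¹ • x) := rfl
  rw [this, fderiv_comp_smul, norm_smul, norm_inv,
    Real.norm_of_nonneg (by positivity : (0 : ℝ) ≤ n + 1), mul_comm]
  gcongr
  exact hC _

theorem tendsto_eLpNorm_cutoff {φ : ℝ} (u : L2Wedge φ) :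
    Tendsto (fun n => eLpNorm (fun x => (cutoff n x : ℂ) * u x - u x) 2
      (volume.restrict (wedge φ))) atTop (𝓝 0) := by
  set μ := volume.restrict (wedge φ)
  have hu : MemLp u 2 μ := Lp.memLp u
  have hsq : ∀ F : Plane → ℂ,
      eLpNorm F 2 μ = (∫⁻ x, ‖F x‖ₑ ^ (2 : ℝ) ∂μ) ^ (1 / 2 : ℝ) := fun F => by
    simpa using eLpNorm_eq_lintegral_rpow_enorm_toReal (μ := μ) (f := F) (p := 2) (by norm_num)
      (by norm_num)
  refine Tendsto.congr (fun n => (hsq _).symm) ?_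
  have h0 : (0 : ENNReal) = 0 ^ (1 / 2 : ℝ) := by simp
  rw [h0]
  refine Tendsto.ennrpow_const _ ?_
  have hfin : ∫⁻ x, ‖u x‖ₑ ^ (2 : ℝ) ∂μ ≠ ⊤ := by
    have := hu.2
    rw [hsq] at this
    intro h
    rw [h] at this
    simp at this
  have h1 : ∀ n x, ‖(cutoff n x : ℂ) * u x - u x‖ₑ ≤ ‖u x‖ₑ := by
    intro n x
    rw [← sub_one_mul, enorm_mul]
    refine mul_le_of_le_one_left' ?_
    rw [← Complex.ofReal_one, ← Complex.ofReal_sub, ← ofReal_norm, Complex.norm_real,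
      ENNReal.ofReal_le_one, Real.norm_eq_abs, abs_le]
    constructor <;> linarith [(cutoff_mem n x).1, (cutoff_mem n x).2]
  have hm : AEMeasurable u μ := hu.1.aemeasurable
  have := tendsto_lintegral_of_dominated_convergence' (μ := μ) (f := fun _ => 0)
    (F := fun n x => ‖(cutoff n x : ℂ) * u x - u x‖ₑ ^ (2 : ℝ))
    (fun x => ‖u x‖ₑ ^ (2 : ℝ)) (fun n => ?_) (fun n => ?_) hfin ?_
  · simpa using this
  · have : Measurable fun x => (cutoff n x : ℂ) :=
      (Complex.continuous_ofReal.comp (contDiff_cutoff n).continuous).measurable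
    exact (((this.aemeasurable).mul hm).sub hm).enorm.pow_const _
  · filter_upwards with x
    gcongr
    exact h1 n x
  · filter_upwards with x
    refine tendsto_const_nhds.congr' ?_
    filter_upwards [eventually_cutoff_eq_one x] with n hn
    simp [hn]

/-- The product of an element of the graph with a smooth cutoff. -/
theorem exists_cutoff_mul {φ : ℝ} (z : sobolevGraph φ) (n : ℕ) : ∃ z' : sobolevGraph φ,
    (z'.1.1 =ᵐ[volume.restrict (wedge φ)] fun x => (cutoff n x : ℂ) * z.1.1 x) ∧
    ∀ j, z'.1.2 j =ᵐ[volume.restrict (wedge φ)] fun x => (cutoff n x : ℂ) * z.1.2 j x +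
      Complex.I * (fderiv ℝ (cutoff n) x (EuclideanSpace.single j 1) : ℂ) * z.1.1 x := by
  have hb : ∀ (g : Plane → ℝ), Continuous g → HasCompactSupport g → ∀ u : L2Wedge φ,
      MemLp (fun x => (g x : ℂ) * u x) 2 (volume.restrict (wedge φ)) := by
    intro g hg hgc u
    obtain ⟨C, hC⟩ := hg.bounded_above_of_compact_support hgc
    refine (Lp.memLp u).of_le_mul (c := C) ?_ ?_
    · exact (Complex.continuous_ofReal.comp hg).aestronglyMeasurable.mul
        (Lp.aestronglyMeasurable u)
    · filter_upwards with x
      rw [norm_mul, Complex.norm_real]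
      gcongr
      exact hC x
  have h1 := hb _ (contDiff_cutoff n).continuous (hasCompactSupport_cutoff n)
  have h2 : ∀ j, MemLp (fun x => (cutoff n x : ℂ) * z.1.2 j x + Complex.I *
      (fderiv ℝ (cutoff n) x (EuclideanSpace.single j 1) : ℂ) * z.1.1 x) 2
      (volume.restrict (wedge φ)) := by
    intro j
    have h3 := (hb _ (((contDiff_cutoff n).continuous_fderiv (by simp)).clm_apply
      (continuous_const (y := (EuclideanSpace.single j 1 : Plane))))
      ((hasCompactSupport_cutoff n).fderiv_apply (𝕜 := ℝ) _) z.1.1).const_mul Complex.I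
    simp_rw [mul_assoc]
    exact (h1 _).add h3
  exact ⟨⟨((h1 z.1.1).toLp _, fun j => (h2 j).toLp _), fun j =>
    (z.2 j).smooth_mul (contDiff_cutoff n) (h1 _).coeFn_toLp (h2 j).coeFn_toLp⟩,
    (h1 _).coeFn_toLp, fun j => (h2 j).coeFn_toLp⟩

/-- Multiplication by cutoffs converges to the identity in the graph norm. The sequence `s` is
described by its values only, so that the lemma applies both to abstract elements and to smooth
functions. -/
theorem tendsto_cutoff_mul {φ : ℝ} {z : sobolevGraph φ} {s : ℕ → sobolevGraph φ}
    (h1 : ∀ n, (s n).1.1 =ᵐ[volume.restrict (wedge φ)] fun x => (cutoff n x : ℂ) * z.1.1 x)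
    (h2 : ∀ n j, (s n).1.2 j =ᵐ[volume.restrict (wedge φ)] fun x =>
      (cutoff n x : ℂ) * z.1.2 j x +
      Complex.I * (fderiv ℝ (cutoff n) x (EuclideanSpace.single j 1) : ℂ) * z.1.1 x) :
    Tendsto s atTop (𝓝 z) := by
  rw [tendsto_subtype_rng, Prod.tendsto_iff, tendsto_pi_nhds]
  refine ⟨(Lp.tendsto_Lp_iff_tendsto_eLpNorm' _ _).2 ?_, fun j =>
    (Lp.tendsto_Lp_iff_tendsto_eLpNorm' _ _).2 ?_⟩
  · refine (tendsto_eLpNorm_cutoff z.1.1).congr fun n => eLpNorm_congr_ae ?_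
    filter_upwards [h1 n] with x hx
    rw [Pi.sub_apply, hx]
  · obtain ⟨C, hC0, hC⟩ := exists_fderiv_cutoff_le
    have hlim : Tendsto (fun n : ℕ => eLpNorm (fun x => (cutoff n x : ℂ) * z.1.2 j x - z.1.2 j x) 2
        (volume.restrict (wedge φ)) + ENNReal.ofReal (C * (n + 1 : ℝ)⁻¹) *
          eLpNorm z.1.1 2 (volume.restrict (wedge φ))) atTop (𝓝 0) := by
      have h3 : Tendsto (fun n : ℕ => C * (n + 1 : ℝ)⁻¹) atTop (𝓝 0) := by
        simpa [one_div] using (tendsto_one_div_add_atTop_nhds_zero_nat (𝕜 := ℝ)).const_mul C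
      have h4 := ENNReal.Tendsto.mul_const (ENNReal.tendsto_ofReal h3)
        (b := eLpNorm z.1.1 2 (volume.restrict (wedge φ))) (Or.inr (Lp.eLpNorm_ne_top z.1.1))
      simpa using (tendsto_eLpNorm_cutoff (z.1.2 j)).add h4
    refine tendsto_of_tendsto_of_tendsto_of_le_of_le tendsto_const_nhds hlim (fun _ => zero_le)
      fun n => ?_
    obtain ⟨G, hG⟩ : ∃ G : Plane → ℂ, G = fun x =>
      Complex.I * (fderiv ℝ (cutoff n) x (EuclideanSpace.single j 1) : ℂ) * z.1.1 x := ⟨_, rfl⟩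
    have hGle : eLpNorm G 2 (volume.restrict (wedge φ)) ≤ ENNReal.ofReal (C * (n + 1 : ℝ)⁻¹) *
          eLpNorm z.1.1 2 (volume.restrict (wedge φ)) := by
      refine eLpNorm_le_mul_eLpNorm_of_ae_le_mul ?_ 2
      filter_upwards with x
      rw [hG]
      simp only [norm_mul, Complex.norm_I, one_mul, Complex.norm_real]
      gcongr
      refine ((fderiv ℝ (cutoff n) x).le_opNorm _).trans ?_
      simpa using hC n x
    have hχ : Continuous fun x => (cutoff n x : ℂ) :=
      Complex.continuous_ofReal.comp (contDiff_cutoff n).continuous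
    have hχ' : Continuous fun x => Complex.I *
        (fderiv ℝ (cutoff n) x (EuclideanSpace.single j 1) : ℂ) := by
      refine continuous_const.mul (Complex.continuous_ofReal.comp ?_)
      exact ((contDiff_cutoff n).continuous_fderiv (by simp)).clm_apply continuous_const
    have m1 := Lp.aestronglyMeasurable (z.1.2 j)
    have m2 := Lp.aestronglyMeasurable z.1.1
    have e : ((s n).1.2 j - z.1.2 j : Plane → ℂ) =ᵐ[volume.restrict (wedge φ)]
        (fun x => (cutoff n x : ℂ) * z.1.2 j x - z.1.2 j x) + G := by
      filter_upwards [h2 n j] with x hx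
      rw [Pi.sub_apply, hx, Pi.add_apply, hG]
      ring
    refine (eLpNorm_congr_ae e).trans_le ?_
    refine (eLpNorm_add_le ((hχ.aestronglyMeasurable.mul m1).sub m1)
      (hG ▸ hχ'.aestronglyMeasurable.mul m2) (by norm_num)).trans ?_
    exact add_le_add_right hGle _

/-! ### Density of smooth functions -/

/-- The convolution `g ∗ ρ` of a complex function with a real one. -/
noncomputable def mollify (g : Plane → ℂ) (ρ : Plane → ℝ) : Plane → ℂ :=
  convolution g ρ (ContinuousLinearMap.lsmul ℝ ℝ : ℝ →L[ℝ] ℂ →L[ℝ] ℂ).flip volume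

theorem mollify_apply (g : Plane → ℂ) (ρ : Plane → ℝ) (x : Plane) :
    mollify g ρ x = ∫ y, g y * (ρ (x - y) : ℂ) := by
  simp only [mollify, convolution_def, ContinuousLinearMap.flip_apply,
    ContinuousLinearMap.lsmul_apply, Complex.real_smul, mul_comm]

theorem locallyIntegrable_of_memLp {g : Plane → ℂ} (hg : MemLp g 2 volume) :
    LocallyIntegrable g volume := hg.locallyIntegrable (by norm_num)

theorem integrable_mollify {g : Plane → ℂ} (hg : MemLp g 2 volume) {ρ : Plane → ℝ}
    (hρ : Continuous ρ) (hc : HasCompactSupport ρ) (x : Plane) :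
    Integrable fun y => g y * (ρ (x - y) : ℂ) := by
  have h := hc.convolutionExists_right
    (ContinuousLinearMap.lsmul ℝ ℝ : ℝ →L[ℝ] ℂ →L[ℝ] ℂ).flip (locallyIntegrable_of_memLp hg) hρ x
  simpa only [ConvolutionExistsAt, ContinuousLinearMap.flip_apply,
    ContinuousLinearMap.lsmul_apply, Complex.real_smul, mul_comm] using h

theorem fderiv_mollify {g : Plane → ℂ} (hg : MemLp g 2 volume) {ρ : Plane → ℝ}
    (hρ : ContDiff ℝ 1 ρ) (hc : HasCompactSupport ρ) (x v : Plane) :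
    fderiv ℝ (mollify g ρ) x v = ∫ y, g y * (fderiv ℝ ρ (x - y) v : ℂ) := by
  have h := hc.hasFDerivAt_convolution_right
    (ContinuousLinearMap.lsmul ℝ ℝ : ℝ →L[ℝ] ℂ →L[ℝ] ℂ).flip (locallyIntegrable_of_memLp hg) hρ x
  rw [mollify, h.fderiv, convolution_precompR_apply (𝕜 := ℝ) _ (locallyIntegrable_of_memLp hg)
    (hc.fderiv (𝕜 := ℝ)) (hρ.continuous_fderiv (by simp))]
  simp only [convolution_def, ContinuousLinearMap.flip_apply,
    ContinuousLinearMap.lsmul_apply, Complex.real_smul, mul_comm]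

theorem contDiff_mollify {g : Plane → ℂ} (hg : MemLp g 2 volume) {ρ : Plane → ℝ}
    (hρ : ContDiff ℝ ∞ ρ) (hc : HasCompactSupport ρ) : ContDiff ℝ ∞ (mollify g ρ) :=
  hc.contDiff_convolution_right (n := ⊤) _ (locallyIntegrable_of_memLp hg) hρ

/-- Mollifiers of small support form an approximate identity in `L²`. -/
theorem exists_mollify_small {g : Plane → ℂ} (hgm : StronglyMeasurable g)
    (hg : MemLp g 2 volume) {ε : ENNReal} (hε : ε ≠ 0) :
    ∃ δ > 0, ∀ ρ : Plane → ℝ, Continuous ρ → HasCompactSupport ρ → (∀ x, 0 ≤ ρ x) →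
      ∫ x, ρ x = 1 → (∀ y ∈ tsupport ρ, ‖y‖ < δ) →
      eLpNorm (fun x => mollify g ρ x - g x) 2 volume ≤ ε := by
  obtain ⟨δ, hδ, h⟩ := exists_average_small hgm hg hε
  refine ⟨δ, hδ, fun ρ hρ hc h0 h1 hs => ?_⟩
  set r : Plane → NNReal := fun y => (ρ y).toNNReal with hr
  have hrm : Measurable r := hρ.measurable.real_toNNReal
  have hrc : ∀ y, (r y : ℝ) = ρ y := fun y => Real.coe_toNNReal _ (h0 y)
  have hρi : Integrable ρ := hρ.integrable_of_hasCompactSupport hc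
  have hsm : ∀ x y, (r y) • g (x - y) = g (x - y) * (ρ (x - (x - y)) : ℂ) := fun x y => by
    rw [NNReal.smul_def, hrc, sub_sub_cancel, Complex.real_smul, mul_comm]
  have e : ∀ x, ∫ y, g (x - y) ∂(volume.withDensity fun y => (r y : ENNReal)) = mollify g ρ x := by
    intro x
    rw [integral_withDensity_eq_integral_smul hrm, mollify_apply,
      ← integral_sub_left_eq_self (fun y => g y * (ρ (x - y) : ℂ)) _ x]
    exact integral_congr_ae (Eventually.of_forall fun y => hsm x y)
  have := h (volume.withDensity fun y => (r y : ENNReal)) ⟨?_⟩ ?_ ?_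
  · simpa only [e] using this
  · rw [withDensity_apply _ MeasurableSet.univ, setLIntegral_univ]
    have := ofReal_integral_eq_lintegral_ofReal hρi (Eventually.of_forall h0)
    rw [h1, ENNReal.ofReal_one] at this
    exact this.symm
  · rw [ae_withDensity_iff (by fun_prop)]
    filter_upwards with y hy
    refine hs y (subset_tsupport _ fun h => hy ?_)
    simp [hr, h]
  · intro x
    rw [integrable_withDensity_iff_integrable_smul hrm]
    refine Integrable.congr ((integrable_mollify hg hρ hc x).comp_sub_left x) ?_
    exact Eventually.of_forall fun y => (hsm x y).symm

/-- At points of the wedge, mollifiers supported in `-Ω` are admissible test functions, so that the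
magnetic gradient of `u ∗ ρ` is expressed by the distributional gradient of `u`. -/
theorem magGrad_mollify {φ : ℝ} (hφ : φ ∈ Ioo 0 Real.pi) {j : Fin 2} {U P : L2Wedge φ}
    (h : IsMagneticDeriv φ j U P) {u p v : Plane → ℂ}
    (huz : U =ᵐ[volume.restrict (wedge φ)] u) (hpz : P =ᵐ[volume.restrict (wedge φ)] p)
    (huw : ∀ x, x ∉ wedge φ → u x = 0) (hpw : ∀ x, x ∉ wedge φ → p x = 0)
    (huv : ∀ x, v x = (vectorPotential x j : ℂ) * u x)
    (hu2 : MemLp u 2 volume) (hv2 : MemLp v 2 volume)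
    {ρ : Plane → ℝ} (hρ : ContDiff ℝ ∞ ρ) (hρc : HasCompactSupport ρ)
    (hρs : ∀ y ∈ tsupport ρ, -y ∈ wedge φ) {x : Plane} (hx : x ∈ wedge φ) :
    magGrad j (mollify u ρ) x =
      mollify p ρ x - mollify v ρ x + (vectorPotential x j : ℂ) * mollify u ρ x := by
  set e : Plane := EuclideanSpace.single j 1 with he
  have hη : ContDiff ℝ ∞ fun y => ρ (x - y) := hρ.comp (contDiff_const.sub contDiff_id)
  have hηc : HasCompactSupport fun y => ρ (x - y) := hρc.comp_homeomorph (Homeomorph.subLeft x)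
  have hηs : tsupport (fun y => ρ (x - y)) ⊆ wedge φ := by
    intro y hy
    have h1 : x - y ∈ tsupport ρ := by
      have hcl : IsClosed {y | x - y ∈ tsupport ρ} :=
        (isClosed_tsupport ρ).preimage (continuous_const.sub continuous_id)
      exact (closure_minimal (fun y hy => subset_tsupport ρ hy) hcl :
        _ ⊆ {y | x - y ∈ tsupport ρ}) hy
    have h2 := add_mem_wedge hφ hx (hρs _ h1)
    rwa [neg_sub, add_sub_cancel] at h2
  have hd : ∀ y, fderiv ℝ (fun y => ρ (x - y)) y e = -fderiv ℝ ρ (x - y) e := by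
    intro y
    have h1 : HasFDerivAt (fun y => ρ (x - y))
        ((fderiv ℝ ρ (x - y)).comp (-ContinuousLinearMap.id ℝ Plane)) y :=
      HasFDerivAt.comp y ((hρ.differentiable (by simp)) (x - y)).hasFDerivAt
        ((hasFDerivAt_id y).const_sub x)
    rw [h1.fderiv]
    simp
  have h1 := h _ hη hηc hηs
  have e1 : ∫ y in wedge φ, P y * ((ρ (x - y) : ℝ) : ℂ) = mollify p ρ x := by
    rw [mollify_apply, ← setIntegral_eq_integral_of_forall_compl_eq_zero (μ := volume)
      (s := wedge φ) fun y hy => by rw [hpw y hy, zero_mul]]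
    refine integral_congr_ae ?_
    filter_upwards [hpz] with y hy
    rw [hy]
  have hρ1c : Continuous fun y => fderiv ℝ ρ y e :=
    (hρ.continuous_fderiv (by simp)).clm_apply continuous_const
  have i1 := integrable_mollify hu2 hρ1c (hρc.fderiv_apply (𝕜 := ℝ) e) x
  have i2 := integrable_mollify (hv2) hρ.continuous hρc x
  have e2 : ∫ y in wedge φ, U y *
      (-Complex.I * ((fderiv ℝ (fun y => ρ (x - y)) y e : ℝ) : ℂ)
        + ((vectorPotential y j * ρ (x - y) : ℝ) : ℂ)) =
      Complex.I * fderiv ℝ (mollify u ρ) x e + mollify v ρ x := by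
    rw [fderiv_mollify hu2 (hρ.of_le (by simp)) hρc, mollify_apply, ← integral_const_mul,
      ← integral_add (i1.const_mul _) i2,
      ← setIntegral_eq_integral_of_forall_compl_eq_zero (μ := volume) (s := wedge φ)
      fun y hy => by simp only [huv, huw y hy, mul_zero, zero_mul, add_zero]]
    refine integral_congr_ae ?_
    filter_upwards [huz] with y hy
    rw [hy, hd, huv]
    push_cast
    ring
  rw [← he, e2, e1] at h1
  rw [magGrad, ← he, ← h1]
  ring

/-- The extensions by zero of an element of the graph with bounded support. -/
theorem exists_extension {φ : ℝ} (z : sobolevGraph φ)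
    {R : ℝ} (hz : ∀ᵐ x ∂(volume.restrict (wedge φ)), R ≤ ‖x‖ → z.1.1 x = 0) :
    ∃ (u : Plane → ℂ) (p : Fin 2 → Plane → ℂ),
      StronglyMeasurable u ∧ MemLp u 2 volume ∧ (z.1.1 =ᵐ[volume.restrict (wedge φ)] u) ∧
      (∀ x, R ≤ ‖x‖ → u x = 0) ∧ (∀ x, x ∉ wedge φ → u x = 0) ∧
      (∀ j, StronglyMeasurable (p j)) ∧ (∀ j, MemLp (p j) 2 volume) ∧
      (∀ j, z.1.2 j =ᵐ[volume.restrict (wedge φ)] p j) ∧ ∀ j x, x ∉ wedge φ → p j x = 0 := by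
  have hW : MeasurableSet (wedge φ) := (isOpen_wedge φ).measurableSet
  have hB : MeasurableSet (wedge φ ∩ Metric.ball 0 R) := hW.inter measurableSet_ball
  obtain ⟨u, hu⟩ : ∃ u : Plane → ℂ, u = (wedge φ ∩ Metric.ball 0 R).indicator z.1.1 := ⟨_, rfl⟩
  have hum : StronglyMeasurable u := hu ▸ (Lp.stronglyMeasurable z.1.1).indicator hB
  have huz : z.1.1 =ᵐ[volume.restrict (wedge φ)] u := by
    filter_upwards [hz, ae_restrict_mem hW] with x hx hxw
    by_cases h : x ∈ wedge φ ∩ Metric.ball 0 R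
    · rw [hu, indicator_of_mem h]
    · rw [hu, indicator_of_notMem h]
      exact hx (not_lt.1 fun h' => h ⟨hxw, by simpa using h'⟩)
  have hu0 : ∀ x, R ≤ ‖x‖ → u x = 0 := fun x hx =>
    hu ▸ indicator_of_notMem (fun h => (mem_ball_zero_iff.1 h.2).not_ge hx) _
  have huw : ∀ x, x ∉ wedge φ → u x = 0 := fun x hx =>
    hu ▸ indicator_of_notMem (fun h => hx h.1) _
  have hu2 : MemLp u 2 volume := by
    have h1 : MemLp ((wedge φ).indicator z.1.1) 2 volume :=
      (memLp_indicator_iff_restrict hW).2 (Lp.memLp _)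
    refine h1.mono hum.aestronglyMeasurable (Eventually.of_forall fun x => ?_)
    rw [hu]
    by_cases hx : x ∈ wedge φ ∩ Metric.ball 0 R
    · rw [indicator_of_mem hx, indicator_of_mem hx.1]
    · rw [indicator_of_notMem hx]; simp
  obtain ⟨p, hp⟩ : ∃ p : Fin 2 → Plane → ℂ, ∀ j, p j = (wedge φ).indicator (z.1.2 j) :=
    ⟨_, fun _ => rfl⟩
  have hpm : ∀ j, StronglyMeasurable (p j) := fun j =>
    hp j ▸ (Lp.stronglyMeasurable _).indicator hW
  have hp2 : ∀ j, MemLp (p j) 2 volume := fun j =>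
    hp j ▸ (memLp_indicator_iff_restrict hW).2 (Lp.memLp _)
  have hpz : ∀ j, z.1.2 j =ᵐ[volume.restrict (wedge φ)] p j := fun j =>
    hp j ▸ (indicator_ae_eq_restrict hW).symm
  have hpw : ∀ j x, x ∉ wedge φ → p j x = 0 := fun j x hx =>
    hp j ▸ indicator_of_notMem hx _
  exact ⟨u, p, hum, hu2, huz, hu0, huw, hpm, hp2, hpz, hpw⟩

set_option maxHeartbeats 1000000 in
/-- Elements of the graph with bounded support are limits of test functions. -/
theorem mem_closure_of_bounded_support {φ : ℝ} (hφ : φ ∈ Ioo 0 Real.pi) (z : sobolevGraph φ)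
    {R : ℝ} (hz : ∀ᵐ x ∂(volume.restrict (wedge φ)), R ≤ ‖x‖ → z.1.1 x = 0) :
    z ∈ closure (range (restrictTest φ)) := by
  have hW : MeasurableSet (wedge φ) := (isOpen_wedge φ).measurableSet
  obtain ⟨u, p, hum, hu2, huz, hu0, huw, hpm, hp2, hpz, hpw⟩ := exists_extension z hz
  obtain ⟨v, hv⟩ : ∃ v : Fin 2 → Plane → ℂ, ∀ j, v j = fun x => (vectorPotential x j : ℂ) * u x :=
    ⟨_, fun _ => rfl⟩
  have hvm : ∀ j, StronglyMeasurable (v j) := fun j =>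
    hv j ▸ (Complex.continuous_ofReal.comp
      (continuous_vectorPotential j)).stronglyMeasurable.mul hum
  -- Supports are confined to this ball, so that the potential acts as a bounded multiplier.
  obtain ⟨M, hM⟩ : ∃ M : ℝ, ∀ j : Fin 2, ∀ x : Plane, ‖x‖ ≤ R + 1 →
      ‖(vectorPotential x j : ℂ)‖ ≤ M := by
    have h1 : ∀ j : Fin 2, ∃ M : ℝ, ∀ x : Plane, ‖x‖ ≤ R + 1 → ‖(vectorPotential x j : ℂ)‖ ≤ M := by
      intro j
      obtain ⟨M, hM⟩ := (isCompact_closedBall (0 : Plane) (R + 1)).exists_bound_of_continuousOn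
        (Complex.continuous_ofReal.comp (continuous_vectorPotential j)).continuousOn
      exact ⟨M, fun x hx => hM x (by simpa using hx)⟩
    choose N hN using h1
    exact ⟨max (N 0) (N 1), fun j x hx => (hN j x hx).trans (by fin_cases j <;> simp)⟩
  have hv2 : ∀ j, MemLp (v j) 2 volume := fun j => by
    refine hu2.of_le_mul (c := M) (hvm j).aestronglyMeasurable (Eventually.of_forall fun x => ?_)
    rw [hv]
    by_cases hx : ‖x‖ ≤ R + 1
    · simp only [norm_mul]
      gcongr
      exact hM j x hx
    · simp [hu0 x (by linarith)]
  rw [EMetric.mem_closure_iff]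
  intro ε hε
  obtain ⟨ε', hε', hlt⟩ := ENNReal.exists_pos_mul_lt
    (ENNReal.add_ne_top.2 ⟨(by norm_num : (3 : ENNReal) ≠ ⊤), (ENNReal.ofReal_ne_top (r := M))⟩)
    hε.ne'
  obtain ⟨δ₀, hδ₀, hdu⟩ := exists_mollify_small hum hu2 hε'.ne'
  choose δ₁ hδ₁ hdp using fun j => exists_mollify_small (hpm j) (hp2 j) hε'.ne'
  choose δ₂ hδ₂ hdv using fun j => exists_mollify_small (hvm j) (hv2 j) hε'.ne'
  obtain ⟨δ, hδ, hle⟩ : ∃ δ > 0, δ ≤ 1 ∧ δ ≤ δ₀ ∧ (∀ j, δ ≤ δ₁ j) ∧ ∀ j, δ ≤ δ₂ j := by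
    refine ⟨min 1 (min δ₀ (min (min (δ₁ 0) (δ₁ 1)) (min (δ₂ 0) (δ₂ 1)))), ?_, ?_, ?_, ?_, ?_⟩
    · simp [hδ₀, hδ₁, hδ₂]
    · exact min_le_left _ _
    · simp
    · intro j; fin_cases j <;> simp
    · intro j; fin_cases j <;> simp
  obtain ⟨ρ, hρ, hρc, hρ0, hρ1, hρs⟩ := exists_mollifier hφ.1 hδ
  have hdu' := hdu ρ hρ.continuous hρc hρ0 hρ1 fun y hy => (hρs y hy).2.trans_le hle.2.1
  have hdp' := fun j => hdp j ρ hρ.continuous hρc hρ0 hρ1 fun y hy =>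
    (hρs y hy).2.trans_le (hle.2.2.1 j)
  have hdv' := fun j => hdv j ρ hρ.continuous hρc hρ0 hρ1 fun y hy =>
    (hρs y hy).2.trans_le (hle.2.2.2 j)
  have hucs : HasCompactSupport u := HasCompactSupport.intro (isCompact_closedBall (0 : Plane) R)
    fun x hx => hu0 x (not_le.1 (by simpa using hx)).le
  have hwc : HasCompactSupport (mollify u ρ) := hucs.convolution _ hρc
  have hws := contDiff_mollify hu2 hρ hρc
  have hgrad : ∀ j, ∀ x ∈ wedge φ, magGrad j (mollify u ρ) x =
      mollify (p j) ρ x - mollify (v j) ρ x + (vectorPotential x j : ℂ) * mollify u ρ x :=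
    fun j x hx => magGrad_mollify hφ (z.2 j) huz (hpz j) huw (hpw j)
      (fun x => congrFun (hv j) x) hu2 (hv2 j) hρ hρc (fun y hy => (hρs y hy).1) hx
  have hw0 : ∀ x, R + 1 < ‖x‖ → mollify u ρ x = 0 := by
    intro x hx
    rw [mollify_apply]
    refine integral_eq_zero_of_ae (Eventually.of_forall fun y => ?_)
    by_cases hy : R ≤ ‖y‖
    · simp [hu0 y hy]
    · have : ρ (x - y) = 0 := by
        by_contra h
        have h1 := (hρs _ (subset_tsupport ρ h)).2
        have h2 := norm_sub_norm_le x y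
        linarith [hle.1]
      simp [this]
  refine ⟨_, ⟨⟨mollify u ρ, hws, hwc⟩, rfl⟩, lt_of_le_of_lt ?_ hlt⟩
  have hres : ∀ F : Plane → ℂ, eLpNorm F 2 (volume.restrict (wedge φ)) ≤ eLpNorm F 2 volume :=
    fun F => eLpNorm_mono_measure _ Measure.restrict_le_self
  rw [Subtype.edist_eq, edist_comm, Prod.edist_eq, edist_pi_def]
  refine max_le ?_ (Finset.sup_le fun j _ => ?_)
  · rw [Lp.edist_def]
    calc _ = eLpNorm (fun x => mollify u ρ x - u x) 2 (volume.restrict (wedge φ)) := by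
          refine eLpNorm_congr_ae ?_
          filter_upwards [huz, restrictTest_fst (φ := φ) ⟨mollify u ρ, hws, hwc⟩] with x h1 h2
          rw [Pi.sub_apply, h1, h2]
      _ ≤ ε' * 1 := by rw [mul_one]; exact (hres _).trans hdu'
      _ ≤ ε' * (3 + ENNReal.ofReal M) := by gcongr; exact le_add_right (by norm_num)
  · rw [Lp.edist_def]
    have c1 : StronglyMeasurable fun x => mollify (p j) ρ x - p j x :=
      (contDiff_mollify (hp2 j) hρ hρc).continuous.stronglyMeasurable.sub (hpm j)
    have c2 : StronglyMeasurable fun x => mollify (v j) ρ x - v j x :=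
      (contDiff_mollify (hv2 j) hρ hρc).continuous.stronglyMeasurable.sub (hvm j)
    have c3 : StronglyMeasurable fun x => (vectorPotential x j : ℂ) * (mollify u ρ x - u x) :=
      (Complex.continuous_ofReal.comp (continuous_vectorPotential j)).stronglyMeasurable.mul
        (hws.continuous.stronglyMeasurable.sub hum)
    have b3 : eLpNorm (fun x => (vectorPotential x j : ℂ) * (mollify u ρ x - u x)) 2 volume ≤
        ENNReal.ofReal M * ε' := by
      refine (eLpNorm_le_mul_eLpNorm_of_ae_le_mul (Eventually.of_forall fun x => ?_) 2).trans
        (mul_le_mul_right hdu' _)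
      by_cases hx : ‖x‖ ≤ R + 1
      · rw [norm_mul]
        gcongr
        exact hM j x hx
      · rw [hw0 x (not_le.1 hx), hu0 x (by linarith [not_le.1 hx])]
        simp
    have e : ((restrictTest φ ⟨mollify u ρ, hws, hwc⟩).1.2 j - z.1.2 j : Plane → ℂ)
        =ᵐ[volume.restrict (wedge φ)] ((fun x => mollify (p j) ρ x - p j x) -
          fun x => mollify (v j) ρ x - v j x) +
          fun x => (vectorPotential x j : ℂ) * (mollify u ρ x - u x) := by
      filter_upwards [hpz j, restrictTest_snd (φ := φ) ⟨mollify u ρ, hws, hwc⟩ j,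
        ae_restrict_mem hW] with x h1 h2 h3
      rw [Pi.sub_apply, h1, h2, Pi.add_apply, Pi.sub_apply]
      rw [hgrad j x h3, hv]
      ring
    refine (eLpNorm_congr_ae e).trans_le ((hres _).trans ?_)
    refine (eLpNorm_add_le (c1.sub c2).aestronglyMeasurable c3.aestronglyMeasurable
      (by norm_num)).trans ?_
    refine (add_le_add (eLpNorm_sub_le c1.aestronglyMeasurable c2.aestronglyMeasurable
      (by norm_num)) b3).trans ?_
    calc _ ≤ ε' + ε' + ENNReal.ofReal M * ε' := by gcongr; exacts [hdp' j, hdv' j]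
      _ = ε' * (2 + ENNReal.ofReal M) := by ring
      _ ≤ ε' * (3 + ENNReal.ofReal M) := by gcongr; norm_num

/-- Restrictions of test functions are dense in `H¹_A(Ω)`. -/
theorem denseRange_restrictTest {φ : ℝ} (hφ : φ ∈ Ioo 0 Real.pi) :
    DenseRange (restrictTest φ) := by
  intro z
  choose s h1 h2 using exists_cutoff_mul z
  refine isClosed_closure.mem_of_tendsto (tendsto_cutoff_mul h1 h2)
    (Eventually.of_forall fun n => ?_)
  refine mem_closure_of_bounded_support hφ (s n) (R := 2 * (n + 1 : ℝ)) ?_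
  filter_upwards [h1 n] with x hx hR
  rw [hx, cutoff_eq_zero hR]
  simp

/-! ### The trace inequality and the trace operator -/

/-- The derivative of `|w|²` along a vector with coordinates in `[-1, 1]` is controlled by the
magnetic gradient: the vector potential only contributes to the imaginary part of `w̄ ∂w`. -/
theorem abs_inner_fderiv_le (w : Plane → ℂ) (x q : Plane) (hq : ∀ i, |q i| ≤ 1) :
    |inner ℝ (w x) (fderiv ℝ w x q)| ≤ ‖w x‖ * (‖magGrad 0 w x‖ + ‖magGrad 1 w x‖) := by
  have hqe : q = q 0 • EuclideanSpace.single 0 1 + q 1 • EuclideanSpace.single 1 1 := by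
    ext i; fin_cases i <;> simp
  have h1 : fderiv ℝ w x q = -Complex.I * (q 0 * magGrad 0 w x + q 1 * magGrad 1 w x)
      + ((q 0 * vectorPotential x 0 + q 1 * vectorPotential x 1 : ℝ) : ℂ) * Complex.I * w x := by
    conv_lhs => rw [hqe, map_add, map_smul, map_smul]
    simp only [magGrad, Complex.real_smul]
    push_cast
    linear_combination ((q 0 : ℂ) * fderiv ℝ w x (EuclideanSpace.single 0 1)
      + (q 1 : ℂ) * fderiv ℝ w x (EuclideanSpace.single 1 1)) * Complex.I_sq
  have h2 : inner ℝ (w x) (fderiv ℝ w x q) =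
      inner ℝ (w x) (-Complex.I * (q 0 * magGrad 0 w x + q 1 * magGrad 1 w x)) := by
    rw [h1, inner_add_right]
    simp only [Complex.inner]
    simp
    ring
  rw [h2]
  refine (abs_real_inner_le_norm _ _).trans ?_
  gcongr
  rw [norm_mul, norm_neg, Complex.norm_I, one_mul]
  refine (norm_add_le _ _).trans ?_
  rw [norm_mul, norm_mul, Complex.norm_real, Complex.norm_real, Real.norm_eq_abs, Real.norm_eq_abs]
  exact add_le_add (mul_le_of_le_one_left (norm_nonneg _) (hq 0))
    (mul_le_of_le_one_left (norm_nonneg _) (hq 1))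

/-- The value of `|w|²` at a point is bounded by an integral along the ray in direction `q`. -/
theorem enorm_sq_le_lintegral_ray (w : testSpace) (y q : Plane) (hq : ∀ i, |q i| ≤ 1)
    (hq0 : q ≠ 0) :
    ‖(w : Plane → ℂ) y‖ₑ ^ 2 ≤ ∫⁻ b in Ioi (0 : ℝ), 2 * (‖(w : Plane → ℂ) (y + b • q)‖ₑ *
      (‖magGrad 0 w (y + b • q)‖ₑ + ‖magGrad 1 w (y + b • q)‖ₑ)) := by
  obtain ⟨w, hw, hc⟩ := w
  simp only
  set F : ℝ → ℝ := fun b => ‖w (y + b • q)‖ ^ 2 with hF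
  have hline : ContDiff ℝ ∞ fun b : ℝ => y + b • q :=
    contDiff_const.add (contDiff_id.smul contDiff_const)
  have hF1 : ContDiff ℝ 1 F := ((hw.comp hline).norm_sq ℝ).of_le (by simp)
  obtain ⟨R, hR⟩ := hc.isCompact.isBounded.exists_norm_le
  have hFc : HasCompactSupport F := by
    refine HasCompactSupport.intro (isCompact_closedBall (0 : ℝ) ((R + ‖y‖) / ‖q‖)) fun b hb => ?_
    have hq' : 0 < ‖q‖ := norm_pos_iff.2 hq0
    have h1 : R + ‖y‖ < ‖b‖ * ‖q‖ := by
      rw [← div_lt_iff₀ hq']; simpa using hb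
    have h2 : w (y + b • q) = 0 := by
      by_contra h
      have h3 := hR _ (subset_tsupport w h)
      have h4 := norm_sub_le (y + b • q) y
      rw [add_sub_cancel_left, norm_smul] at h4
      linarith
    simp [hF, h2]
  have hd : ∀ b, deriv F b = 2 * inner ℝ (w (y + b • q)) (fderiv ℝ w (y + b • q) q) := by
    intro b
    have h1 : HasDerivAt (fun b : ℝ => y + b • q) q b := by
      simpa using ((hasDerivAt_id b).smul_const q).const_add y
    have h2 := ((hw.differentiable (by simp)) (y + b • q)).hasFDerivAt.comp_hasDerivAt b h1
    exact h2.norm_sq.deriv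
  have h0 := HasCompactSupport.integral_Ioi_deriv_eq hF1 hFc 0
  have h1 : ‖F 0‖ₑ ≤ ∫⁻ b in Ioi (0 : ℝ), ‖deriv F b‖ₑ := by
    rw [← enorm_neg, ← h0]
    exact enorm_integral_le_lintegral_enorm _
  have h2 : ‖F 0‖ₑ = ‖w y‖ₑ ^ 2 := by
    simp [hF]
  rw [← h2]
  refine h1.trans (lintegral_mono fun b => ?_)
  rw [hd]
  have h3 := abs_inner_fderiv_le w (y + b • q) q hq
  have h4 : ∀ z : ℂ, ‖z‖ₑ = ENNReal.ofReal ‖z‖ := fun z => (ofReal_norm z).symm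
  rw [enorm_mul, Real.enorm_eq_ofReal_abs, Real.enorm_eq_ofReal_abs, h4, h4, h4,
    ← ENNReal.ofReal_add (norm_nonneg _) (norm_nonneg _), ← ENNReal.ofReal_mul (norm_nonneg _),
    abs_of_pos (by norm_num : (0 : ℝ) < 2), ENNReal.ofReal_ofNat]
  gcongr

/-- Integration over a quadrant, in oblique coordinates inside the wedge. -/
theorem exists_lintegral_quadrant_le {φ : ℝ} {p q : Plane} (hdet : p 0 * q 1 - p 1 * q 0 ≠ 0)
    (hcone : ∀ a b : ℝ, 0 < a → 0 < b → a • p + b • q ∈ wedge φ) :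
    ∃ c : NNReal, ∀ g : Plane → ENNReal, Measurable g →
      ∫⁻ a in Ioi (0 : ℝ), ∫⁻ b in Ioi (0 : ℝ), g (a • p + b • q) ≤ c * ∫⁻ x in wedge φ, g x := by
  let Λ₀ : ℝ × ℝ →ₗ[ℝ] Plane :=
    (LinearMap.fst ℝ ℝ ℝ).smulRight p + (LinearMap.snd ℝ ℝ ℝ).smulRight q
  have hΛ₀ : ∀ z, Λ₀ z = z.1 • p + z.2 • q := fun z => rfl
  have hinj : Function.Injective Λ₀ := by
    rw [← LinearMap.ker_eq_bot, LinearMap.ker_eq_bot']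
    rintro ⟨a, b⟩ h
    rw [hΛ₀] at h
    have h0 := congrArg (fun x : Plane => x 0) h
    have h1 := congrArg (fun x : Plane => x 1) h
    simp at h0 h1
    have ha : a * (p 0 * q 1 - p 1 * q 0) = 0 := by linear_combination q 1 * h0 - q 0 * h1
    have hb : b * (p 0 * q 1 - p 1 * q 0) = 0 := by linear_combination p 0 * h1 - p 1 * h0
    rw [Prod.mk_eq_zero]
    exact ⟨(mul_eq_zero.1 ha).resolve_right hdet, (mul_eq_zero.1 hb).resolve_right hdet⟩
  let Λ : (ℝ × ℝ) ≃L[ℝ] Plane :=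
    (LinearEquiv.ofInjectiveOfFinrankEq Λ₀ hinj (by simp)).toContinuousLinearEquiv
  have hΛ : ∀ z, Λ z = z.1 • p + z.2 • q := fun z => rfl
  have : ((volume : Measure (ℝ × ℝ)).map Λ).IsAddHaarMeasure := Λ.isAddHaarMeasure_map _
  obtain ⟨c, hsmul⟩ : ∃ c : NNReal, (volume : Measure (ℝ × ℝ)).map Λ = c • volume :=
    ⟨_, Measure.isAddLeftInvariant_eq_smul _ _⟩
  refine ⟨c, fun g hg => ?_⟩
  have hgw : Measurable ((wedge φ).indicator g) := hg.indicator (isOpen_wedge φ).measurableSet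
  calc ∫⁻ a in Ioi (0 : ℝ), ∫⁻ b in Ioi (0 : ℝ), g (a • p + b • q)
      = ∫⁻ a in Ioi (0 : ℝ), ∫⁻ b in Ioi (0 : ℝ), (wedge φ).indicator g (Λ (a, b)) := by
        refine setLIntegral_congr_fun measurableSet_Ioi fun a ha => ?_
        refine setLIntegral_congr_fun measurableSet_Ioi fun b hb => ?_
        rw [hΛ, indicator_of_mem (hcone a b ha hb)]
    _ ≤ ∫⁻ a : ℝ, ∫⁻ b : ℝ, (wedge φ).indicator g (Λ (a, b)) :=
        (setLIntegral_le_lintegral _ _).trans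
          (lintegral_mono fun a => setLIntegral_le_lintegral _ _)
    _ = ∫⁻ z, (wedge φ).indicator g (Λ z) := by
        rw [Measure.volume_eq_prod, lintegral_prod]
        exact (hgw.comp Λ.continuous.measurable).aemeasurable
    _ = ∫⁻ x, (wedge φ).indicator g x ∂((volume : Measure (ℝ × ℝ)).map Λ) := by
        rw [lintegral_map hgw Λ.continuous.measurable]
    _ = _ := by
        rw [hsmul, lintegral_smul_measure, lintegral_indicator (isOpen_wedge φ).measurableSet]
        rfl

/-- The trace inequality on one side of the wedge, spanned by `p`, by integration along the rays in
direction `q`. -/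
theorem exists_lintegral_boundary_ray_le {φ : ℝ} {p q : Plane} (hdet : p 0 * q 1 - p 1 * q 0 ≠ 0)
    (hcone : ∀ a b : ℝ, 0 < a → 0 < b → a • p + b • q ∈ wedge φ) (hq : ∀ i, |q i| ≤ 1) :
    ∃ c : NNReal, ∀ w : testSpace, ∫⁻ a in Ioi (0 : ℝ), ‖(w : Plane → ℂ) (a • p)‖ₑ ^ 2 ≤
      c * (eLpNorm (w : Plane → ℂ) 2 (volume.restrict (wedge φ)) *
        ∑ j, eLpNorm (magGrad j (w : Plane → ℂ)) 2 (volume.restrict (wedge φ))) := by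
  obtain ⟨c, hc⟩ := exists_lintegral_quadrant_le hdet hcone
  refine ⟨c * 2, fun w => ?_⟩
  have hq0 : q ≠ 0 := by rintro rfl; simp at hdet
  have hwc := w.2.1.continuous
  have hg : ∀ j, Continuous (magGrad j (w : Plane → ℂ)) := fun j =>
    continuous_magGrad j (w.2.1.of_le (by simp))
  have hm : ∀ F : Plane → ℂ, Continuous F → Measurable fun x => ‖F x‖ₑ := fun F hF =>
    hF.enorm.measurable
  have hsq : ∀ F : Plane → ℂ, eLpNorm F 2 (volume.restrict (wedge φ)) =
      (∫⁻ x in wedge φ, ‖F x‖ₑ ^ (2 : ℝ)) ^ (1 / 2 : ℝ) := fun F => by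
    simpa using eLpNorm_eq_lintegral_rpow_enorm_toReal (μ := volume.restrict (wedge φ)) (f := F)
      (p := 2) (by norm_num) (by norm_num)
  have hold : ∀ j, ∫⁻ x in wedge φ, ‖(w : Plane → ℂ) x‖ₑ * ‖magGrad j (w : Plane → ℂ) x‖ₑ ≤
      eLpNorm (w : Plane → ℂ) 2 (volume.restrict (wedge φ)) *
        eLpNorm (magGrad j (w : Plane → ℂ)) 2 (volume.restrict (wedge φ)) := fun j => by
    rw [hsq, hsq]
    exact ENNReal.lintegral_mul_le_Lp_mul_Lq _ Real.HolderConjugate.two_two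
      (hm _ hwc).aemeasurable (hm _ (hg j)).aemeasurable
  have hm0 : Measurable fun x => ‖(w : Plane → ℂ) x‖ₑ * ‖magGrad 0 (w : Plane → ℂ) x‖ₑ :=
    (hm _ hwc).mul (hm _ (hg 0))
  have hm1 : Measurable fun x => ‖(w : Plane → ℂ) x‖ₑ *
      (‖magGrad 0 (w : Plane → ℂ) x‖ₑ + ‖magGrad 1 (w : Plane → ℂ) x‖ₑ) :=
    (hm _ hwc).mul ((hm _ (hg 0)).add (hm _ (hg 1)))
  calc ∫⁻ a in Ioi (0 : ℝ), ‖(w : Plane → ℂ) (a • p)‖ₑ ^ 2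
      ≤ ∫⁻ a in Ioi (0 : ℝ), ∫⁻ b in Ioi (0 : ℝ), 2 * (‖(w : Plane → ℂ) (a • p + b • q)‖ₑ *
      (‖magGrad 0 w (a • p + b • q)‖ₑ + ‖magGrad 1 w (a • p + b • q)‖ₑ)) :=
        lintegral_mono fun a => enorm_sq_le_lintegral_ray w _ q hq hq0
    _ ≤ c * ∫⁻ x in wedge φ, 2 * (‖(w : Plane → ℂ) x‖ₑ * (‖magGrad 0 w x‖ₑ + ‖magGrad 1 w x‖ₑ)) :=
        hc (fun x => 2 * (‖(w : Plane → ℂ) x‖ₑ * (‖magGrad 0 w x‖ₑ + ‖magGrad 1 w x‖ₑ)))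
          (((hm _ hwc).mul ((hm _ (hg 0)).add (hm _ (hg 1)))).const_mul 2)
    _ = c * (2 * ((∫⁻ x in wedge φ, ‖(w : Plane → ℂ) x‖ₑ * ‖magGrad 0 w x‖ₑ) +
          ∫⁻ x in wedge φ, ‖(w : Plane → ℂ) x‖ₑ * ‖magGrad 1 w x‖ₑ)) := by
        rw [lintegral_const_mul 2 hm1]
        simp_rw [mul_add]
        rw [lintegral_add_left hm0, mul_add, mul_add]
    _ ≤ c * (2 * (eLpNorm (w : Plane → ℂ) 2 (volume.restrict (wedge φ)) *
        eLpNorm (magGrad 0 (w : Plane → ℂ)) 2 (volume.restrict (wedge φ)) +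
        eLpNorm (w : Plane → ℂ) 2 (volume.restrict (wedge φ)) *
        eLpNorm (magGrad 1 (w : Plane → ℂ)) 2 (volume.restrict (wedge φ)))) := by
        gcongr
        exacts [hold 0, hold 1]
    _ = _ := by
        rw [Fin.sum_univ_two]
        push_cast
        ring

theorem measurable_polar (θ : ℝ) : Measurable fun r : ℝ => polar r θ := by
  unfold polar
  have : Continuous fun r : ℝ => (!₂[r * Real.cos θ, r * Real.sin θ] : Plane) := by fun_prop
  exact this.measurable

/-- The trace inequality for test functions. -/
theorem exists_eLpNorm_boundary_le {φ : ℝ} (hφ : φ ∈ Ioo 0 Real.pi) :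
    ∃ c : NNReal, ∀ w : testSpace, eLpNorm (w : Plane → ℂ) 2 (boundaryMeasure φ) ^ 2 ≤
      c * (eLpNorm (w : Plane → ℂ) 2 (volume.restrict (wedge φ)) *
        ∑ j, eLpNorm (magGrad j (w : Plane → ℂ)) 2 (volume.restrict (wedge φ))) := by
  have hs : 0 < Real.sin φ := Real.sin_pos_of_pos_of_lt_pi hφ.1 hφ.2
  have hcone : ∀ a b : ℝ, 0 < a → 0 < b → a • polar 1 0 + b • polar 1 φ ∈ wedge φ := by
    intro a b ha hb
    rw [mem_wedge_iff hφ]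
    simp only [polar, PiLp.add_apply, PiLp.smul_apply, Matrix.cons_val_zero, Matrix.cons_val_one,
      Real.cos_zero, Real.sin_zero, smul_eq_mul, one_mul, mul_one, mul_zero, zero_add]
    refine ⟨mul_pos hb hs, ?_⟩
    nlinarith [mul_pos ha hs]
  have hle : ∀ θ i, |polar 1 θ i| ≤ 1 := by
    intro θ i
    fin_cases i <;> simp [polar, Real.abs_cos_le_one, Real.abs_sin_le_one]
  have hsm : ∀ a θ, a • polar 1 θ = polar a θ := by
    intro a θ
    ext i
    fin_cases i <;> simp [polar]
  obtain ⟨c₁, h₁⟩ := exists_lintegral_boundary_ray_le (φ := φ) (p := polar 1 0) (q := polar 1 φ)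
    (by simp [polar, hs.ne']) hcone (hle φ)
  obtain ⟨c₂, h₂⟩ := exists_lintegral_boundary_ray_le (φ := φ) (p := polar 1 φ) (q := polar 1 0)
    (by simp [polar, hs.ne']) (fun a b ha hb => by rw [add_comm]; exact hcone b a hb ha) (hle 0)
  refine ⟨c₁ + c₂, fun w => ?_⟩
  have hsq : eLpNorm (w : Plane → ℂ) 2 (boundaryMeasure φ) ^ 2 =
      ∫⁻ x, ‖(w : Plane → ℂ) x‖ₑ ^ 2 ∂(boundaryMeasure φ) := by
    simpa using eLpNorm_nnreal_pow_eq_lintegral (μ := boundaryMeasure φ) (f := (w : Plane → ℂ))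
      (p := 2) (by norm_num)
  have hm : Measurable fun x => ‖(w : Plane → ℂ) x‖ₑ ^ 2 :=
    w.2.1.continuous.enorm.measurable.pow_const 2
  rw [hsq, boundaryMeasure, lintegral_add_measure, lintegral_map hm (measurable_polar 0),
    lintegral_map hm (measurable_polar φ)]
  rw [ENNReal.coe_add, add_mul]
  have a1 := h₁ w
  have a2 := h₂ w
  simp only [hsm] at a1 a2
  exact add_le_add a1 a2

theorem memLp_boundary {φ : ℝ} (hφ : φ ∈ Ioo 0 Real.pi) (w : testSpace) :
    MemLp (w : Plane → ℂ) 2 (boundaryMeasure φ) := by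
  refine ⟨w.2.1.continuous.aestronglyMeasurable, ?_⟩
  obtain ⟨c, hc⟩ := exists_eLpNorm_boundary_le hφ
  have h : eLpNorm (w : Plane → ℂ) 2 (boundaryMeasure φ) ^ 2 < ⊤ := (hc w).trans_lt <|
    ENNReal.mul_lt_top ENNReal.coe_lt_top <| ENNReal.mul_lt_top (memLp_testSpace w _).2 <|
      ENNReal.sum_lt_top.2 fun j _ => (memLp_magGrad w j φ).2
  by_contra h'
  rw [not_lt_top_iff.1 h'] at h
  simp at h

/-- The restriction of test functions to the boundary. -/
noncomputable def boundaryTest {φ : ℝ} (hφ : φ ∈ Ioo 0 Real.pi) :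
    testSpace →ₗ[ℂ] L2Boundary φ where
  toFun w := (memLp_boundary hφ w).toLp w
  map_add' _ _ := rfl
  map_smul' _ _ := rfl

theorem boundaryTest_ae_eq {φ : ℝ} (hφ : φ ∈ Ioo 0 Real.pi) (w : testSpace) :
    boundaryTest hφ w =ᵐ[boundaryMeasure φ] w :=
  (memLp_boundary hφ w).coeFn_toLp

attribute [irreducible] boundaryTest

theorem norm_boundaryTest {φ : ℝ} (hφ : φ ∈ Ioo 0 Real.pi) (w : testSpace) :
    ‖boundaryTest hφ w‖ = (eLpNorm (w : Plane → ℂ) 2 (boundaryMeasure φ)).toReal := by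
  rw [Lp.norm_def, eLpNorm_congr_ae (boundaryTest_ae_eq hφ w)]

theorem exists_norm_boundaryTest_sq_le {φ : ℝ} (hφ : φ ∈ Ioo 0 Real.pi) :
    ∃ C : ℝ, 0 ≤ C ∧ ∀ w : testSpace, ‖boundaryTest hφ w‖ ^ 2 ≤
      C * (‖(restrictTest φ w).1.1‖ * ∑ j, ‖(restrictTest φ w).1.2 j‖) := by
  obtain ⟨c, hc⟩ := exists_eLpNorm_boundary_le hφ
  refine ⟨c, c.2, fun w => ?_⟩
  simp only [norm_boundaryTest, norm_restrictTest_fst, norm_restrictTest_snd]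
  have hfin : ∀ j ∈ Finset.univ,
      eLpNorm (magGrad j (w : Plane → ℂ)) 2 (volume.restrict (wedge φ)) ≠ ⊤ :=
    fun j _ => (memLp_magGrad w j φ).2.ne
  have := ENNReal.toReal_mono (ENNReal.mul_ne_top ENNReal.coe_ne_top
    (ENNReal.mul_ne_top (memLp_testSpace w (volume.restrict (wedge φ))).2.ne
      (ENNReal.sum_ne_top.2 hfin))) (hc w)
  rwa [ENNReal.toReal_pow, ENNReal.toReal_mul, ENNReal.toReal_mul, ENNReal.toReal_sum hfin] at this

theorem exists_norm_boundaryTest_le {φ : ℝ} (hφ : φ ∈ Ioo 0 Real.pi) :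
    ∃ C : ℝ, ∀ w : testSpace, ‖boundaryTest hφ w‖ ≤ C * ‖restrictTest φ w‖ := by
  obtain ⟨C, hC0, hC⟩ := exists_norm_boundaryTest_sq_le hφ
  refine ⟨Real.sqrt (C * 2), fun w => ?_⟩
  refine (pow_le_pow_iff_left₀ (norm_nonneg _) (by positivity) two_ne_zero).1 ?_
  rw [mul_pow, Real.sq_sqrt (by positivity)]
  calc ‖boundaryTest hφ w‖ ^ 2 ≤ _ := hC w
    _ ≤ C * (2 * ‖restrictTest φ w‖ ^ 2) :=
        mul_le_mul_of_nonneg_left (norm_mul_sum_norm_le _) hC0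
    _ = C * 2 * ‖restrictTest φ w‖ ^ 2 := by ring

theorem exists_isTraceOperator {φ : ℝ} (hφ : φ ∈ Ioo 0 Real.pi) :
    ∃ T, IsTraceOperator φ T := by
  obtain ⟨C, hC⟩ := exists_norm_boundaryTest_le hφ
  have hd := denseRange_restrictTest hφ
  obtain ⟨T, hT1, hT2⟩ : ∃ T : sobolevGraph φ →L[ℂ] L2Boundary φ, (∀ z, ‖T z‖ ≤ C * ‖z‖) ∧
      ∀ w, T (restrictTest φ w) = boundaryTest hφ w :=
    ⟨(boundaryTest hφ).extendOfNorm (restrictTest φ),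
      LinearMap.norm_extendOfNorm_apply_le hd C hC, LinearMap.extendOfNorm_eq hd ⟨C, hC⟩⟩
  refine ⟨T.toLinearMap ∘ₗ toSobolevGraph φ, ⟨|C|, fun u => ?_⟩, fun w hw hc u hu => ?_⟩
  · have h1 : ‖T (toSobolevGraph φ u)‖ ≤ C * ‖toSobolevGraph φ u‖ := hT1 _
    have h2 : ‖toSobolevGraph φ u‖ ≤ ‖(u : L2Wedge φ)‖ + ∑ j, ‖magneticDeriv φ j u‖ := by
      have h3 : ‖toSobolevGraph φ u‖ =
          max ‖(u : L2Wedge φ)‖ ‖fun j => magneticDeriv φ j u‖ := rfl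
      rw [h3]
      have h4 : 0 ≤ ∑ j, ‖magneticDeriv φ j u‖ := Finset.sum_nonneg fun _ _ => norm_nonneg _
      refine max_le (le_add_of_nonneg_right h4) (le_add_of_nonneg_of_le (norm_nonneg _) ?_)
      exact (pi_norm_le_iff_of_nonneg h4).2 fun j =>
        Finset.single_le_sum (f := fun j => ‖magneticDeriv φ j u‖) (fun _ _ => norm_nonneg _)
          (Finset.mem_univ j)
    exact h1.trans (mul_le_mul (le_abs_self C) h2 (norm_nonneg _) (abs_nonneg C))
  · have h1 : toSobolevGraph φ u = restrictTest φ ⟨w, hw, hc⟩ :=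
      sobolevGraph_ext (Lp.ext (hu.trans (restrictTest_fst (φ := φ) ⟨w, hw, hc⟩).symm))
    have h3 : (T.toLinearMap ∘ₗ toSobolevGraph φ) u = boundaryTest hφ ⟨w, hw, hc⟩ :=
      (congrArg T h1).trans (hT2 _)
    rw [h3]
    exact boundaryTest_ae_eq hφ ⟨w, hw, hc⟩

theorem isTraceOperator_trace {φ : ℝ} (hφ : φ ∈ Ioo 0 Real.pi) : IsTraceOperator φ (trace φ) := by
  have h := exists_isTraceOperator hφ
  rw [trace, dif_pos h]
  exact h.choose_spec

/-- The trace as a linear map on the graph of the magnetic gradient. -/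
noncomputable def graphTrace (φ : ℝ) : sobolevGraph φ →ₗ[ℂ] L2Boundary φ :=
  trace φ ∘ₗ ofSobolevGraph φ

theorem continuous_graphTrace {φ : ℝ} (hφ : φ ∈ Ioo 0 Real.pi) : Continuous (graphTrace φ) := by
  obtain ⟨⟨C, hC⟩, -⟩ := isTraceOperator_trace hφ
  refine AddMonoidHomClass.continuous_of_bound (graphTrace φ) (|C| * 3) fun z => ?_
  have h := hC (ofSobolevGraph φ z)
  simp only [magneticDeriv_ofSobolevGraph] at h
  obtain ⟨h1, h2⟩ := norm_le_of_mem_sobolevGraph z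
  have h3 : ‖((ofSobolevGraph φ z : magneticSobolev φ) : L2Wedge φ)‖ + ∑ j, ‖z.1.2 j‖ ≤
      3 * ‖z‖ := by
    rw [Fin.sum_univ_two]
    change ‖z.1.1‖ + _ ≤ _
    linarith [h2 0, h2 1]
  rw [mul_assoc]
  exact h.trans (mul_le_mul (le_abs_self C) h3 (by positivity) (abs_nonneg C))

theorem graphTrace_restrictTest {φ : ℝ} (hφ : φ ∈ Ioo 0 Real.pi) (w : testSpace) :
    graphTrace φ (restrictTest φ w) =ᵐ[boundaryMeasure φ] w :=
  (isTraceOperator_trace hφ).2 w w.2.1 w.2.2 _ (restrictTest_fst w)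

/-- The trace inequality in multiplicative form. -/
theorem exists_norm_graphTrace_sq_le {φ : ℝ} (hφ : φ ∈ Ioo 0 Real.pi) :
    ∃ C : ℝ, 0 ≤ C ∧ ∀ z : sobolevGraph φ,
      ‖graphTrace φ z‖ ^ 2 ≤ C * (‖z.1.1‖ * ∑ j, ‖z.1.2 j‖) := by
  obtain ⟨C, hC0, hC⟩ := exists_norm_boundaryTest_sq_le hφ
  refine ⟨C, hC0, fun z => ?_⟩
  have hcont := continuous_graphTrace hφ
  refine (denseRange_restrictTest hφ).induction_on
    (p := fun z => ‖graphTrace φ z‖ ^ 2 ≤ C * (‖z.1.1‖ * ∑ j, ‖z.1.2 j‖)) z ?_ fun w => ?_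
  · exact isClosed_le (by fun_prop) (by fun_prop)
  · have : graphTrace φ (restrictTest φ w) = boundaryTest hφ w :=
      Lp.ext ((graphTrace_restrictTest hφ w).trans (boundaryTest_ae_eq hφ w).symm)
    rw [this]
    exact hC w

/-! ### The form of the magnetic Robin Laplacian -/

/-- A bounded coercive Hermitian form on a Banach space is the inner product of a Hilbert space with
an equivalent norm. The Hilbert space is realized on a separate type so that the two norms can be
used side by side. -/
theorem exists_hilbert_of_core {V X : Type} [AddCommGroup V] [Module ℂ V]
    [NormedAddCommGroup X] [NormedSpace ℂ X] [CompleteSpace X]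
    (cd : InnerProductSpace.Core ℂ V) (e : V ≃ₗ[ℂ] X) {c C : ℝ} (hc : 0 < c)
    (hlow : ∀ v, c * ‖e v‖ ^ 2 ≤ RCLike.re (cd.inner v v))
    (hup : ∀ v, RCLike.re (cd.inner v v) ≤ C * ‖e v‖ ^ 2) :
    ∃ (W : Type) (_ : NormedAddCommGroup W) (_ : InnerProductSpace ℂ W) (_ : CompleteSpace W)
      (f : W ≃L[ℂ] X), ∀ v w : W, inner ℂ v w = cd.inner (e.symm (f v)) (e.symm (f w)) := by
  let i1 : NormedAddCommGroup V := cd.toNormedAddCommGroup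
  let i2 : InnerProductSpace ℂ V := InnerProductSpace.ofCore cd.toCore
  have hn : ∀ v : V, ‖v‖ ^ 2 = RCLike.re (cd.inner v v) := fun v =>
    (norm_sq_eq_re_inner (𝕜 := ℂ) v)
  have h1 : ∀ v, ‖e v‖ ≤ Real.sqrt c⁻¹ * ‖v‖ := by
    intro v
    refine (pow_le_pow_iff_left₀ (norm_nonneg _) (by positivity) two_ne_zero).1 ?_
    rw [mul_pow, Real.sq_sqrt (by positivity), hn, inv_mul_eq_div, le_div_iff₀ hc, mul_comm]
    exact hlow v
  have h2 : ∀ x, ‖e.symm x‖ ≤ Real.sqrt |C| * ‖x‖ := by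
    intro x
    refine (pow_le_pow_iff_left₀ (norm_nonneg _) (by positivity) two_ne_zero).1 ?_
    rw [mul_pow, Real.sq_sqrt (by positivity), hn]
    refine (hup _).trans ?_
    rw [e.apply_symm_apply]
    gcongr
    exact le_abs_self C
  let f : V ≃L[ℂ] X := e.toContinuousLinearEquivOfBounds _ _ h1 h2
  have i3 : CompleteSpace V := by
    rw [completeSpace_congr (e := (f : V ≃ X)) f.isUniformEmbedding]
    infer_instance
  refine ⟨V, i1, i2, i3, f, fun v w => ?_⟩
  have hf : ∀ v, e.symm (f v) = v := fun v => e.symm_apply_apply v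
  rw [hf, hf]

/-- The embedding of `H¹_A(Ω)` into `L²(Ω)`. -/
noncomputable def graphFst (φ : ℝ) : sobolevGraph φ →L[ℂ] L2Wedge φ :=
  (ContinuousLinearMap.fst ℂ (L2Wedge φ) (Fin 2 → L2Wedge φ)).comp (sobolevGraph φ).subtypeL

theorem graphFst_apply {φ : ℝ} (z : sobolevGraph φ) : graphFst φ z = z.1.1 := rfl

/-- The form of the magnetic Robin Laplacian, shifted by `m`, on the graph of the gradient. -/
noncomputable def shiftedForm (φ β m : ℝ) (z z' : sobolevGraph φ) : ℂ :=
  (∑ j, inner ℂ (z.1.2 j) (z'.1.2 j)) - (β : ℂ) * inner ℂ (graphTrace φ z) (graphTrace φ z')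
    + (m : ℂ) * inner ℂ z.1.1 z'.1.1

theorem shiftedForm_self_re (φ β m : ℝ) (z : sobolevGraph φ) :
    RCLike.re (shiftedForm φ β m z z) =
      ∑ j, ‖z.1.2 j‖ ^ 2 - β * ‖graphTrace φ z‖ ^ 2 + m * ‖z.1.1‖ ^ 2 := by
  simp only [shiftedForm, inner_self_eq_norm_sq_to_K]
  simp [← Complex.ofReal_pow]

theorem robinForm_eq_shiftedForm {φ β m : ℝ} (z z' : sobolevGraph φ) :
    robinForm φ β (ofSobolevGraph φ z) (ofSobolevGraph φ z') =
      shiftedForm φ β m z z' - (m : ℂ) * inner ℂ z.1.1 z'.1.1 := by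
  simp only [robinForm, shiftedForm, magneticDeriv_ofSobolevGraph, add_sub_cancel_right]
  rfl

/-- Young's inequality, for the form with `d₀`, `d₁` the norms of the components of the gradient,
`τ` the squared norm of the trace, and `N` the graph norm. -/
theorem form_bounds {u d₀ d₁ τ β K N : ℝ} (hu : 0 ≤ u) (hd₀ : 0 ≤ d₀) (hd₁ : 0 ≤ d₁) (hK : 0 ≤ K)
    (hτ0 : 0 ≤ τ) (huN : u ≤ N) (hd₀N : d₀ ≤ N) (hd₁N : d₁ ≤ N)
    (hN : u * (d₀ + d₁) ≤ 2 * N ^ 2) (hN' : N ^ 2 ≤ u ^ 2 + (d₀ ^ 2 + d₁ ^ 2))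
    (hτ : τ ≤ K * (u * (d₀ + d₁))) :
    1 / 2 * N ^ 2 ≤ d₀ ^ 2 + d₁ ^ 2 - β * τ + ((|β| * K) ^ 2 + 1) * u ^ 2 ∧
      d₀ ^ 2 + d₁ ^ 2 - β * τ + ((|β| * K) ^ 2 + 1) * u ^ 2
        ≤ (2 + 2 * (|β| * K) + ((|β| * K) ^ 2 + 1)) * N ^ 2 := by
  have h1 : |β| * τ ≤ |β| * K * (u * (d₀ + d₁)) := by
    rw [mul_assoc]
    exact mul_le_mul_of_nonneg_left hτ (abs_nonneg _)
  have h2 : |β * τ| ≤ |β| * K * (u * (d₀ + d₁)) := by rwa [abs_mul, abs_of_nonneg hτ0]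
  have hk : 0 ≤ |β| * K := mul_nonneg (abs_nonneg _) hK
  generalize |β| * K = k at *
  obtain ⟨h3, h4⟩ := abs_le.1 h2
  have e0 := pow_le_pow_left₀ hd₀ hd₀N 2
  have e1 := pow_le_pow_left₀ hd₁ hd₁N 2
  have e2 := pow_le_pow_left₀ hu huN 2
  constructor
  · nlinarith [sq_nonneg (k * u - (d₀ + d₁) / 2), sq_nonneg (d₀ - d₁)]
  · nlinarith [mul_le_mul_of_nonneg_left hN hk, mul_le_mul_of_nonneg_left e2 (sq_nonneg k)]

/-- By the trace inequality, the form is bounded below and a suitable shift of it is equivalent to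
the graph norm. -/
theorem exists_shiftedForm_bounds {φ : ℝ} (hφ : φ ∈ Ioo 0 Real.pi) (β : ℝ) :
    ∃ m C : ℝ, ∀ z : sobolevGraph φ,
      1 / 2 * ‖z‖ ^ 2 ≤ RCLike.re (shiftedForm φ β m z z) ∧
        RCLike.re (shiftedForm φ β m z z) ≤ C * ‖z‖ ^ 2 := by
  obtain ⟨K, hK0, hK⟩ := exists_norm_graphTrace_sq_le hφ
  refine ⟨(|β| * K) ^ 2 + 1, 2 + 2 * (|β| * K) + ((|β| * K) ^ 2 + 1), fun z => ?_⟩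
  obtain ⟨h1, h2⟩ := norm_le_of_mem_sobolevGraph z
  have h3 := norm_mul_sum_norm_le z
  have h4 := norm_sq_le_of_mem_sobolevGraph z
  have h5 := hK z
  rw [Fin.sum_univ_two] at h3 h4 h5
  have h6 := shiftedForm_self_re φ β ((|β| * K) ^ 2 + 1) z
  rw [Fin.sum_univ_two] at h6
  rw [h6]
  exact form_bounds (norm_nonneg _) (norm_nonneg _) (norm_nonneg _) hK0 (sq_nonneg _) h1 (h2 0)
    (h2 1) h3 h4 h5

/-- The graph of the operator, in terms of the shifted form. -/
theorem mem_graph_robinLaplacian_iff {φ β m : ℝ} (x y : L2Wedge φ) :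
    (x, y) ∈ (robinLaplacian φ β).graph ↔ ∃ z : sobolevGraph φ, z.1.1 = x ∧
      ∀ z' : sobolevGraph φ, shiftedForm φ β m z' z - (m : ℂ) * inner ℂ z'.1.1 z.1.1
        = inner ℂ z'.1.1 y := by
  rw [robinLaplacian, Submodule.toLinearPMap_graph_eq _ (robinGraph_functional φ β)]
  constructor
  · rintro ⟨u, hu, huv⟩
    exact ⟨toSobolevGraph φ u, hu, fun z' =>
      (robinForm_eq_shiftedForm z' (toSobolevGraph φ u)).symm.trans (huv (ofSobolevGraph φ z'))⟩
  · rintro ⟨z, hz, hz'⟩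
    exact ⟨ofSobolevGraph φ z, hz, fun v =>
      (robinForm_eq_shiftedForm (toSobolevGraph φ v) z).trans (hz' (toSobolevGraph φ v))⟩

/-- The form domain `H¹_A(Ω)` is a Hilbert space for a suitable shift of the form. -/
theorem exists_hilbert_of_shiftedForm {φ : ℝ} (hφ : φ ∈ Ioo 0 Real.pi) (β : ℝ) :
    ∃ (m : ℝ) (W : Type) (_ : NormedAddCommGroup W) (_ : InnerProductSpace ℂ W)
      (_ : CompleteSpace W) (f : W → sobolevGraph φ) (J : W →L[ℂ] L2Wedge φ),
      Function.Surjective f ∧ (∀ v, J v = (f v).1.1) ∧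
      ∀ v w : W, inner ℂ v w = shiftedForm φ β m (f v) (f w) := by
  obtain ⟨m, C, hm⟩ := exists_shiftedForm_bounds hφ β
  have hcomp : CompleteSpace (sobolevGraph φ) :=
    (isClosed_sobolevGraph φ).completeSpace_coe
  let cd : InnerProductSpace.Core ℂ (sobolevGraph φ) :=
    { inner := shiftedForm φ β m
      conj_inner_symm := fun z z' => by
        simp only [shiftedForm, map_add, map_sub, map_mul, map_sum, inner_conj_symm,
          Complex.conj_ofReal]
      re_inner_nonneg := fun z => le_trans (by positivity) (hm z).1
      add_left := fun z z' z'' => by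
        simp only [shiftedForm, map_add, Submodule.coe_add, Prod.fst_add, Prod.snd_add,
          Pi.add_apply, inner_add_left, Finset.sum_add_distrib]
        ring
      smul_left := fun z z' r => by
        simp only [shiftedForm, map_smul, Submodule.coe_smul, Prod.smul_fst, Prod.smul_snd,
          Pi.smul_apply, inner_smul_left, ← Finset.mul_sum]
        ring
      definite := fun z hz => by
        have h := (hm z).1
        rw [hz] at h
        simp only [map_zero] at h
        have : ‖z‖ ^ 2 ≤ 0 := by linarith
        exact norm_eq_zero.1 (by nlinarith [norm_nonneg z]) }
  obtain ⟨W, i1, i2, i3, f, hf⟩ := exists_hilbert_of_core cd (LinearEquiv.refl ℂ _)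
    (by norm_num : (0 : ℝ) < 1 / 2) (fun z => (hm z).1) (fun z => (hm z).2)
  exact ⟨m, W, i1, i2, i3, f, (graphFst φ).comp f.toContinuousLinearMap, f.surjective,
    fun v => graphFst_apply (f v), hf⟩

/-- The realization of the magnetic Robin Laplacian by its form on a Hilbert space. -/
theorem exists_hilbert_of_robinLaplacian {φ : ℝ} (hφ : φ ∈ Ioo 0 Real.pi) (β : ℝ) :
    ∃ (m : ℝ) (W : Type) (_ : NormedAddCommGroup W) (_ : InnerProductSpace ℂ W)
      (_ : CompleteSpace W) (f : W → sobolevGraph φ) (J : W →L[ℂ] L2Wedge φ),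
      Function.Surjective f ∧ (∀ v, J v = (f v).1.1) ∧
      (∀ v : W, ‖v‖ ^ 2 = ∑ j, ‖(f v).1.2 j‖ ^ 2 - β * ‖graphTrace φ (f v)‖ ^ 2
        + m * ‖(f v).1.1‖ ^ 2) ∧
      ∀ x y, (x, y) ∈ (robinLaplacian φ β).graph ↔ ∃ u : W, J u = x ∧
        ∀ v, inner ℂ v u - (m : ℂ) * inner ℂ (J v) (J u) = inner ℂ (J v) y := by
  obtain ⟨m, W, i1, i2, i3, f, J, hf, hJ, hinner⟩ := exists_hilbert_of_shiftedForm hφ β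
  refine ⟨m, W, i1, i2, i3, f, J, hf, hJ, fun v => ?_, fun x y => ?_⟩
  · exact (norm_sq_eq_re_inner (𝕜 := ℂ) v).trans
      ((congrArg RCLike.re (hinner v v)).trans (shiftedForm_self_re φ β m (f v)))
  · simp only [mem_graph_robinLaplacian_iff (m := m), hinner, hJ]
    constructor
    · rintro ⟨z, hz, hz'⟩
      obtain ⟨u, rfl⟩ := hf z
      exact ⟨u, hz, fun v => hz' (f v)⟩
    · rintro ⟨u, hu, huv⟩
      refine ⟨f u, hu, fun z' => ?_⟩
      obtain ⟨v, rfl⟩ := hf z'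
      exact huv v

/-- The operator is semibounded, and every Rayleigh quotient of the form dominates a point of the
spectrum. -/
theorem exists_spectrum_bounds {φ : ℝ} (hφ : φ ∈ Ioo 0 Real.pi) (β : ℝ) :
    (∃ m : ℝ, ∀ t : ℝ, (t : ℂ) ∈ spectrum (robinLaplacian φ β) → -m ≤ t) ∧
      ∀ z : sobolevGraph φ, z.1.1 ≠ 0 → ∃ t : ℝ, (t : ℂ) ∈ spectrum (robinLaplacian φ β) ∧
        t * ‖z.1.1‖ ^ 2 ≤ ∑ j, ‖z.1.2 j‖ ^ 2 - β * ‖graphTrace φ z‖ ^ 2 := by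
  obtain ⟨m, W, i1, i2, i3, f, J, hf, hJ, hnorm, hT⟩ := exists_hilbert_of_robinLaplacian hφ β
  refine ⟨⟨m, fun t ht => neg_le_of_mem_spectrum J hT ht⟩, fun z hz => ?_⟩
  obtain ⟨u, rfl⟩ := hf z
  obtain ⟨t, ht, hle⟩ := exists_mem_spectrum_le J hT (u := u) (by rwa [hJ])
  refine ⟨t, ht, ?_⟩
  rw [hJ, hnorm] at hle
  exact hle.trans_eq (add_sub_cancel_right _ _)

/-- It suffices to find a function whose Rayleigh quotient lies below the threshold. Below the
threshold all spectral points are discrete: as the essential spectrum is bounded below, its infimum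
is a lower bound of it, also in the case that it is empty. -/
theorem exists_discreteSpectrum_lt {φ : ℝ} (hφ : φ ∈ Ioo 0 Real.pi) {β : ℝ}
    (z : sobolevGraph φ) (hz : ∑ j, ‖z.1.2 j‖ ^ 2 - β * ‖graphTrace φ z‖ ^ 2
      < robinThreshold φ β * ‖z.1.1‖ ^ 2) (hz0 : z.1.1 ≠ 0) :
    ∃ t : ℝ, (t : ℂ) ∈ discreteSpectrum (robinLaplacian φ β) ∧ t < robinThreshold φ β := by
  obtain ⟨⟨m, hm⟩, h⟩ := exists_spectrum_bounds hφ β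
  obtain ⟨t, ht, hle⟩ := h z hz0
  have hpos : 0 < ‖z.1.1‖ ^ 2 := by positivity
  have hlt : t < robinThreshold φ β := lt_of_mul_lt_mul_right (hle.trans_lt hz) hpos.le
  refine ⟨t, ?_, hlt⟩
  by_contra hd
  have hess : (t : ℂ) ∈ essentialSpectrum (robinLaplacian φ β) := ⟨ht, hd⟩
  refine hlt.not_ge (csInf_le ⟨-m, fun s hs => hm s hs.1⟩ hess)

/-! ### Functions that are smooth up to the boundary, with unbounded support -/

theorem magGrad_smooth_mul {χ : Plane → ℝ} {w : Plane → ℂ} (hχ : Differentiable ℝ χ)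
    (hw : Differentiable ℝ w) (j : Fin 2) (x : Plane) :
    magGrad j (fun x => (χ x : ℂ) * w x) x = (χ x : ℂ) * magGrad j w x +
      Complex.I * (fderiv ℝ χ x (EuclideanSpace.single j 1) : ℂ) * w x := by
  have h : (fun x => (χ x : ℂ) * w x) = fun x => χ x • w x := by
    ext x; rw [Complex.real_smul]
  rw [magGrad, magGrad, h, fderiv_fun_smul (hχ x) (hw x)]
  simp only [add_apply, smul_apply,
    ContinuousLinearMap.smulRight_apply, Complex.real_smul]
  ring

/-- The trace of a smooth function of finite energy, whose support need not be bounded, is its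
restriction. -/
theorem exists_graph_of_contDiff {φ : ℝ} (hφ : φ ∈ Ioo 0 Real.pi) {w : Plane → ℂ}
    (hw : ContDiff ℝ ∞ w) (h : MemLp w 2 (volume.restrict (wedge φ)))
    (h' : ∀ j, MemLp (magGrad j w) 2 (volume.restrict (wedge φ))) :
    ∃ z : sobolevGraph φ, (z.1.1 =ᵐ[volume.restrict (wedge φ)] w) ∧
      (∀ j, z.1.2 j =ᵐ[volume.restrict (wedge φ)] magGrad j w) ∧
      graphTrace φ z =ᵐ[boundaryMeasure φ] w := by
  obtain ⟨z, hz1, hz2⟩ : ∃ z : sobolevGraph φ, (z.1.1 =ᵐ[volume.restrict (wedge φ)] w) ∧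
      ∀ j, z.1.2 j =ᵐ[volume.restrict (wedge φ)] magGrad j w :=
    ⟨graphOfContDiff φ (hw.of_le (by simp)) h h', h.coeFn_toLp, fun j => (h' j).coeFn_toLp⟩
  refine ⟨z, hz1, hz2, ?_⟩
  obtain ⟨W, hW⟩ : ∃ W : ℕ → testSpace, ∀ n, (W n : Plane → ℂ) = fun x => (cutoff n x : ℂ) * w x :=
    ⟨fun n => ⟨fun x => (cutoff n x : ℂ) * w x,
      (Complex.ofRealCLM.contDiff.comp (contDiff_cutoff n)).mul hw,
      ((hasCompactSupport_cutoff n).comp_left (g := ((↑) : ℝ → ℂ)) Complex.ofReal_zero).mul_right⟩,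
      fun _ => rfl⟩
  have hlim : Tendsto (fun n => restrictTest φ (W n)) atTop (𝓝 z) := by
    refine tendsto_cutoff_mul (fun n => ?_) fun n j => ?_
    · filter_upwards [restrictTest_fst (φ := φ) (W n), hz1] with x h1 h2
      rw [h1, h2, hW]
    · filter_upwards [restrictTest_snd (φ := φ) (W n) j, hz1, hz2 j] with x h1 h2 h3
      rw [h1, h2, h3, hW, magGrad_smooth_mul ((contDiff_cutoff n).differentiable (by simp))
        (hw.differentiable (by simp))]
  have hT := ((continuous_graphTrace hφ).tendsto z).comp hlim
  obtain ⟨ns, hns, hae⟩ := (tendstoInMeasure_of_tendsto_Lp hT).exists_seq_tendsto_ae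
  have hall : ∀ᵐ x ∂(boundaryMeasure φ), ∀ n, graphTrace φ (restrictTest φ (W n)) x =
      (W n : Plane → ℂ) x :=
    ae_all_iff.2 fun n => graphTrace_restrictTest hφ (W n)
  filter_upwards [hae, hall] with x h1 h2
  refine tendsto_nhds_unique h1 (tendsto_const_nhds.congr' ?_)
  filter_upwards [hns.tendsto_atTop.eventually (eventually_cutoff_eq_one x)] with n hn
  rw [Function.comp_apply, h2, hW]
  simp [hn]

theorem norm_sq_eq_integral {μ : Measure Plane} (u : Lp ℂ 2 μ) {F : Plane → ℂ} (h : u =ᵐ[μ] F) :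
    ‖u‖ ^ 2 = ∫ x, ‖F x‖ ^ 2 ∂μ := by
  have h1 : ((‖u‖ ^ 2 : ℝ) : ℂ) = ((∫ x, ‖F x‖ ^ 2 ∂μ : ℝ) : ℂ) := by
    have h2 := inner_self_eq_norm_sq_to_K (𝕜 := ℂ) u
    rw [Complex.ofReal_pow]
    refine h2.symm.trans ?_
    rw [L2.inner_def, ← integral_complex_ofReal]
    refine integral_congr_ae ?_
    filter_upwards [h] with x hx
    rw [hx, inner_self_eq_norm_sq_to_K]
    simp
  exact_mod_cast h1

/-! ### Integrals in polar coordinates -/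

theorem polar_mem_wedge_iff {φ r θ : ℝ} (hφ : φ ∈ Ioo 0 Real.pi) (hr : 0 < r)
    (hθ : θ ∈ Ioo (-Real.pi) Real.pi) : polar r θ ∈ wedge φ ↔ θ ∈ Ioo 0 φ := by
  refine ⟨fun h => ?_, fun h => ⟨r, θ, hr, h.1, h.2, rfl⟩⟩
  obtain ⟨h1, h2⟩ := (mem_wedge_iff hφ _).1 h
  simp only [polar, Matrix.cons_val_zero, Matrix.cons_val_one] at h1 h2
  have h3 : 0 < Real.sin θ := (mul_pos_iff_of_pos_left hr).1 h1
  have h4 : 0 < θ := by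
    by_contra! hle
    exact h3.not_ge (Real.sin_nonpos_of_nonpos_of_neg_pi_le hle hθ.1.le)
  refine ⟨h4, ?_⟩
  by_contra! hle
  have h5 := Real.sin_nonneg_of_nonneg_of_le_pi (x := θ - φ) (by linarith)
    (by linarith [hθ.2, hφ.1])
  rw [Real.sin_sub] at h5
  nlinarith [mul_nonneg hr.le h5]

/-- Integration over the wedge in polar coordinates. -/
theorem integral_wedge_eq {φ : ℝ} (hφ : φ ∈ Ioo 0 Real.pi) (F : Plane → ℝ) :
    ∫ x in wedge φ, F x = ∫ p in Ioi (0 : ℝ) ×ˢ Ioo 0 φ, p.1 * F (polar p.1 p.2) := by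
  let e : ℝ × ℝ ≃ᵐ Plane :=
    (MeasurableEquiv.finTwoArrow (α := ℝ)).symm.trans (MeasurableEquiv.toLp 2 (Fin 2 → ℝ))
  have he : MeasurePreserving e volume volume :=
    (PiLp.volume_preserving_toLp (Fin 2)).comp
      (volume_preserving_finTwoArrow ℝ).symm
  have hep : ∀ r θ : ℝ, e (polarCoord.symm (r, θ)) = polar r θ := by
    intro r θ
    ext i
    fin_cases i <;> simp [e, polar, polarCoord, MeasurableEquiv.finTwoArrow]
  rw [← integral_indicator (isOpen_wedge φ).measurableSet,
    ← he.integral_comp e.measurableEmbedding, ← integral_comp_polarCoord_symm]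
  have hsub : Ioi (0 : ℝ) ×ˢ Ioo 0 φ ⊆ polarCoord.target := by
    rintro ⟨r, θ⟩ ⟨h1, h2⟩
    exact ⟨h1, by linarith [h2.1, Real.pi_pos], h2.2.trans hφ.2⟩
  rw [← integral_indicator (measurableSet_Ioi.prod measurableSet_Ioo),
    ← integral_indicator polarCoord.open_target.measurableSet]
  congr 1
  ext ⟨r, θ⟩
  by_cases h : (r, θ) ∈ polarCoord.target
  · rw [indicator_of_mem h, hep]
    obtain ⟨hr, hθ⟩ := h
    have h1 := polar_mem_wedge_iff hφ hr hθ
    by_cases h2 : θ ∈ Ioo 0 φ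
    · rw [indicator_of_mem (h1.2 h2), indicator_of_mem (mk_mem_prod hr h2)]
      rfl
    · rw [indicator_of_notMem (fun h => h2 (h1.1 h)), indicator_of_notMem (fun h => h2 h.2)]
      simp
  · rw [indicator_of_notMem h, indicator_of_notMem (fun h' => h (hsub h'))]

/-! ### Gaussian moments -/

theorem integrableOn_pow_mul_gaussian {a : ℝ} (ha : 0 < a) (n : ℕ) :
    IntegrableOn (fun r : ℝ => r ^ n * Real.exp (-a * r ^ 2)) (Ioi 0) := by
  have h := (integrable_rpow_mul_exp_neg_mul_sq ha (s := n)
    (by have : (0 : ℝ) ≤ n := Nat.cast_nonneg n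
        linarith)).integrableOn (s := Ioi (0 : ℝ))
  simpa only [Real.rpow_natCast] using h

theorem integral_pow_mul_gaussian {a : ℝ} (ha : 0 < a) (n : ℕ) :
    ∫ r in Ioi (0 : ℝ), r ^ n * Real.exp (-a * r ^ 2) =
      a ^ (-((n : ℝ) + 1) / 2) * (1 / 2) * Real.Gamma (((n : ℝ) + 1) / 2) := by
  have h := integral_rpow_mul_exp_neg_mul_rpow (p := 2) (q := n) (b := a) (by norm_num)
    (by have : (0 : ℝ) ≤ n := Nat.cast_nonneg n
        linarith) ha
  rw [← h]
  refine setIntegral_congr_fun measurableSet_Ioi fun r _ => ?_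
  simp

theorem inv_sq_rpow {X : ℝ} (hX : 0 < X) (s : ℝ) : ((X ^ 2)⁻¹) ^ (-s / 2) = X ^ s := by
  rw [← Real.rpow_natCast, ← Real.rpow_neg hX.le, ← Real.rpow_mul hX.le]
  congr 1
  push_cast
  ring

theorem integral_gaussian_zero {X : ℝ} (hX : 0 < X) :
    ∫ r in Ioi (0 : ℝ), Real.exp (-(X ^ 2)⁻¹ * r ^ 2) = X * Real.sqrt Real.pi / 2 := by
  have h := integral_pow_mul_gaussian (a := (X ^ 2)⁻¹) (by positivity) 0
  simp only [pow_zero, one_mul] at h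
  rw [h, inv_sq_rpow hX]
  norm_num [Real.Gamma_one_half_eq]
  ring

theorem integral_gaussian_one {X : ℝ} (hX : 0 < X) :
    ∫ r in Ioi (0 : ℝ), r * Real.exp (-(X ^ 2)⁻¹ * r ^ 2) = X ^ 2 / 2 := by
  have h := integral_pow_mul_gaussian (a := (X ^ 2)⁻¹) (by positivity) 1
  simp only [pow_one] at h
  rw [h, inv_sq_rpow hX]
  norm_num
  ring

theorem integral_gaussian_two {X : ℝ} (hX : 0 < X) :
    ∫ r in Ioi (0 : ℝ), r ^ 2 * Real.exp (-(X ^ 2)⁻¹ * r ^ 2) = Real.sqrt Real.pi * X ^ 3 / 4 := by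
  rw [integral_pow_mul_gaussian (a := (X ^ 2)⁻¹) (by positivity) 2, inv_sq_rpow hX]
  have h1 : Real.Gamma (((2 : ℕ) + 1 : ℝ) / 2) = Real.sqrt Real.pi / 2 := by
    rw [show ((2 : ℕ) + 1 : ℝ) / 2 = 1 / 2 + 1 by norm_num, Real.Gamma_add_one (by norm_num),
      Real.Gamma_one_half_eq]
    ring
  rw [h1, show ((2 : ℕ) + 1 : ℝ) = (3 : ℕ) by norm_num, Real.rpow_natCast]
  ring

theorem integral_gaussian_three {X : ℝ} (hX : 0 < X) :
    ∫ r in Ioi (0 : ℝ), r ^ 3 * Real.exp (-(X ^ 2)⁻¹ * r ^ 2) = X ^ 4 / 2 := by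
  rw [integral_pow_mul_gaussian (a := (X ^ 2)⁻¹) (by positivity) 3, inv_sq_rpow hX]
  rw [show ((3 : ℕ) + 1 : ℝ) / 2 = (1 : ℕ) + 1 by norm_num, Real.Gamma_nat_eq_factorial,
    show ((3 : ℕ) + 1 : ℝ) = (4 : ℕ) by norm_num, Real.rpow_natCast]
  simp
  ring

theorem integral_cosh_sub {ψ : ℝ} (hψ : 0 ≤ ψ) :
    ∫ θ in Ioo 0 (2 * ψ), Real.cosh (θ - ψ) = 2 * Real.sinh ψ := by
  have hd : ∀ θ : ℝ, HasDerivAt (fun θ => Real.sinh (θ - ψ)) (Real.cosh (θ - ψ)) θ := fun θ => by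
    simpa using ((hasDerivAt_id θ).sub_const ψ).sinh
  rw [← integral_Ioc_eq_integral_Ioo, ← intervalIntegral.integral_of_le (by linarith),
    intervalIntegral.integral_eq_sub_of_hasDerivAt (fun θ _ => hd θ)
      ((by fun_prop : Continuous fun θ => Real.cosh (θ - ψ)).intervalIntegrable _ _),
    zero_sub, Real.sinh_neg]
  ring_nf

theorem integral_sinh_sq_add_cosh_sq {ψ : ℝ} (hψ : 0 ≤ ψ) :
    ∫ θ in Ioo 0 (2 * ψ), (Real.sinh (θ - ψ) ^ 2 + Real.cosh (θ - ψ) ^ 2) =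
      2 * (Real.sinh ψ * Real.cosh ψ) := by
  have hd : ∀ θ : ℝ, HasDerivAt (fun θ => Real.sinh (θ - ψ) * Real.cosh (θ - ψ))
      (Real.sinh (θ - ψ) ^ 2 + Real.cosh (θ - ψ) ^ 2) θ := fun θ => by
    have h1 : HasDerivAt (fun θ => Real.sinh (θ - ψ)) (Real.cosh (θ - ψ)) θ := by
      simpa using ((hasDerivAt_id θ).sub_const ψ).sinh
    have h2 : HasDerivAt (fun θ => Real.cosh (θ - ψ)) (Real.sinh (θ - ψ)) θ := by
      simpa using ((hasDerivAt_id θ).sub_const ψ).cosh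
    exact (h1.mul h2).congr_deriv (by ring)
  rw [← integral_Ioc_eq_integral_Ioo, ← intervalIntegral.integral_of_le (by linarith),
    intervalIntegral.integral_eq_sub_of_hasDerivAt (fun θ _ => hd θ)
      ((by fun_prop : Continuous fun θ =>
        Real.sinh (θ - ψ) ^ 2 + Real.cosh (θ - ψ) ^ 2).intervalIntegrable _ _),
    zero_sub, Real.sinh_neg, Real.cosh_neg]
  ring_nf

/-! ### The phase of the test function -/

/-- The regularized distance `√(|x|² + ε)` to the apex. -/
noncomputable def regDist (ε : ℝ) (x : Plane) : ℝ := Real.sqrt (x 0 ^ 2 + x 1 ^ 2 + ε)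

/-- The coordinate orthogonal to the line at angle `ψ`; in polar coordinates it is
`r sin (θ - ψ)`. -/
noncomputable def transverse (ψ : ℝ) (x : Plane) : ℝ := Real.cos ψ * x 1 - Real.sin ψ * x 0

/-- The function `r sinh (θ - ψ)` for `ε = 0` (on the half-plane `|θ - ψ| < π / 2`). For `ε > 0` it
is smooth on the whole plane, the apex included. -/
noncomputable def phase (ψ ε : ℝ) (x : Plane) : ℝ :=
  regDist ε x * Real.sinh (Real.arcsin (transverse ψ x / regDist ε x))

/-- The derivative of the phase in the direction `e`. -/
noncomputable def phaseDeriv (ψ ε : ℝ) (e x : Plane) : ℝ :=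
  (x 0 * e 0 + x 1 * e 1) / regDist ε x *
      Real.sinh (Real.arcsin (transverse ψ x / regDist ε x)) +
    Real.cosh (Real.arcsin (transverse ψ x / regDist ε x)) /
      Real.sqrt (1 - (transverse ψ x / regDist ε x) ^ 2) *
      (transverse ψ e - transverse ψ x / regDist ε x *
        ((x 0 * e 0 + x 1 * e 1) / regDist ε x))

theorem transverse_sq_le (ψ : ℝ) (x : Plane) : transverse ψ x ^ 2 ≤ x 0 ^ 2 + x 1 ^ 2 := by
  have h := Real.sin_sq_add_cos_sq ψ
  unfold transverse
  have : x 0 ^ 2 + x 1 ^ 2 = (Real.cos ψ * x 1 - Real.sin ψ * x 0) ^ 2 +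
      (Real.cos ψ * x 0 + Real.sin ψ * x 1) ^ 2 := by
    linear_combination (-(x 0 ^ 2 + x 1 ^ 2)) * h
  rw [this]
  exact le_add_of_nonneg_right (sq_nonneg _)

theorem regDist_sq {ε : ℝ} (hε : 0 ≤ ε) (x : Plane) :
    regDist ε x ^ 2 = x 0 ^ 2 + x 1 ^ 2 + ε := Real.sq_sqrt (by positivity)

theorem regDist_pos {ε : ℝ} (hε : 0 < ε) (x : Plane) : 0 < regDist ε x :=
  Real.sqrt_pos.2 (by positivity)

/-- The argument of `arcsin` in the phase stays in `(-1, 1)`, where `arcsin` is smooth. -/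
theorem sq_ratio_lt_one {ε : ℝ} (hε : 0 < ε) (ψ : ℝ) (x : Plane) :
    (transverse ψ x / regDist ε x) ^ 2 < 1 := by
  have h := regDist_pos hε x
  rw [div_pow, div_lt_one (by positivity), regDist_sq hε.le]
  linarith [transverse_sq_le ψ x]

theorem contDiff_phase {ε : ℝ} (hε : 0 < ε) (ψ : ℝ) : ContDiff ℝ ∞ (phase ψ ε) := by
  have h1 : ContDiff ℝ ∞ (regDist ε) := by
    refine ContDiff.sqrt (by fun_prop) fun x => ?_
    positivity
  have h2 : ContDiff ℝ ∞ (transverse ψ) := by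
    unfold transverse
    fun_prop
  have h3 : ContDiff ℝ ∞ fun x => transverse ψ x / regDist ε x :=
    h2.div h1 fun x => (regDist_pos hε x).ne'
  refine h1.mul (ContDiff.sinh (contDiff_iff_contDiffAt.2 fun x => ?_))
  have h4 := sq_ratio_lt_one hε ψ x
  have h5 : ContDiffAt ℝ ∞ Real.arcsin (transverse ψ x / regDist ε x) := by
    refine Real.contDiffAt_arcsin ?_ ?_
    · intro h; rw [h] at h4; norm_num at h4
    · intro h; rw [h] at h4; norm_num at h4
  exact ContDiffAt.comp (g := Real.arcsin) x h5 h3.contDiffAt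

/-- For `ε > 0` the function `phaseDeriv` is the derivative of the phase. -/
theorem fderiv_phase {ε : ℝ} (hε : 0 < ε) (ψ : ℝ) (x e : Plane) :
    fderiv ℝ (phase ψ ε) x e = phaseDeriv ψ ε e x := by
  have hline : HasDerivAt (fun t : ℝ => x + t • e) e 0 := by
    simpa using ((hasDerivAt_id (0 : ℝ)).smul_const e).const_add x
  have h0 : x + (0 : ℝ) • e = x := by simp
  have hcomp : HasDerivAt (fun t : ℝ => phase ψ ε (x + t • e)) (fderiv ℝ (phase ψ ε) x e) 0 := by
    have h1 : HasFDerivAt (phase ψ ε) (fderiv ℝ (phase ψ ε) x) (x + (0 : ℝ) • e) := by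
      rw [h0]
      exact (((contDiff_phase hε ψ).differentiable (by simp)) x).hasFDerivAt
    exact h1.comp_hasDerivAt 0 hline
  have hρ0 := regDist_pos hε x
  have hcoord : ∀ i, HasDerivAt (fun t : ℝ => (x + t • e) i) (e i) 0 := fun i => by
    simpa using ((hasDerivAt_id (0 : ℝ)).mul_const (e i)).const_add (x i)
  have hρ : HasDerivAt (fun t : ℝ => regDist ε (x + t • e))
      ((x 0 * e 0 + x 1 * e 1) / regDist ε x) 0 := by
    have h1 := (((hcoord 0).pow 2).add ((hcoord 1).pow 2)).add_const ε
    have h2 := h1.sqrt (by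
      simp only [Pi.add_apply, Pi.pow_apply, h0]
      positivity)
    refine h2.congr_deriv ?_
    simp only [Pi.add_apply, Pi.pow_apply, h0]
    change _ / (2 * regDist ε x) = _
    field_simp
    ring
  have hl : HasDerivAt (fun t : ℝ => transverse ψ (x + t • e)) (transverse ψ e) 0 :=
    ((hcoord 1).const_mul (Real.cos ψ)).sub ((hcoord 0).const_mul (Real.sin ψ))
  have hlt := sq_ratio_lt_one hε ψ x
  have hs := hl.div hρ (by rw [h0]; exact hρ0.ne')
  have harc : HasDerivAt Real.arcsin
      (1 / Real.sqrt (1 - (transverse ψ x / regDist ε x) ^ 2))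
      (transverse ψ (x + (0 : ℝ) • e) / regDist ε (x + (0 : ℝ) • e)) := by
    rw [h0]
    refine Real.hasDerivAt_arcsin ?_ ?_
    · intro h; rw [h] at hlt; norm_num at hlt
    · intro h; rw [h] at hlt; norm_num at hlt
  have hα := (HasDerivAt.comp (0 : ℝ) harc hs).sinh
  have hfin := hρ.mul hα
  have := hcomp.unique hfin
  rw [this]
  simp only [Function.comp_apply, Pi.div_apply, h0, phaseDeriv]
  field_simp

/-- The bound is uniform in `ε`. It uses `|sin (θ - ψ)| ≤ sin ψ < 1` on the wedge, which keeps the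
argument of `arcsin` away from `±1`. -/
theorem abs_phaseDeriv_le {ψ ε : ℝ} (hψ : ψ ∈ Ioo 0 (Real.pi / 2)) (hε : 0 ≤ ε) {x : Plane}
    (hx : x ∈ wedge (2 * ψ)) (j : Fin 2) :
    |phaseDeriv ψ ε (EuclideanSpace.single j 1) x| ≤
      Real.cosh (Real.pi / 2) + Real.cosh (Real.pi / 2) / Real.cos ψ * 2 := by
  have hcos : 0 < Real.cos ψ := Real.cos_pos_of_mem_Ioo ⟨by linarith [hψ.1, Real.pi_pos], hψ.2⟩
  have hx0 : 0 < x 0 ^ 2 + x 1 ^ 2 := by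
    obtain ⟨h1, -⟩ := (mem_wedge_iff ⟨by linarith [hψ.1], by linarith [hψ.2]⟩ x).1 hx
    positivity
  have hρ : 0 < regDist ε x := Real.sqrt_pos.2 (by positivity)
  have hd : |(x 0 * (EuclideanSpace.single j (1 : ℝ) : Plane) 0 +
      x 1 * (EuclideanSpace.single j (1 : ℝ) : Plane) 1) / regDist ε x| ≤ 1 := by
    rw [← sq_le_one_iff_abs_le_one, div_pow, div_le_one (by positivity), regDist_sq hε]
    fin_cases j
    · simp; nlinarith [sq_nonneg (x 1)]
    · simp; nlinarith [sq_nonneg (x 0)]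
  have hs : (transverse ψ x / regDist ε x) ^ 2 ≤ Real.sin ψ ^ 2 := by
    rw [div_pow, div_le_iff₀ (by positivity), regDist_sq hε]
    obtain ⟨r, θ, hr, h1, h2, rfl⟩ := hx
    have e1 : transverse ψ (polar r θ) = r * Real.sin (θ - ψ) := by
      simp only [transverse, polar, Matrix.cons_val_zero, Matrix.cons_val_one, Real.sin_sub]
      ring
    have e2 : polar r θ 0 ^ 2 + polar r θ 1 ^ 2 = r ^ 2 := by
      simp only [polar, Matrix.cons_val_zero, Matrix.cons_val_one]
      linear_combination r ^ 2 * Real.sin_sq_add_cos_sq θ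
    have h3 : Real.sin (θ - ψ) ^ 2 ≤ Real.sin ψ ^ 2 := by
      refine sq_le_sq' ?_ ?_
      · rw [← Real.sin_neg]
        exact Real.sin_le_sin_of_le_of_le_pi_div_two (by linarith [hψ.2]) (by linarith [hψ.2])
          (by linarith)
      · exact Real.sin_le_sin_of_le_of_le_pi_div_two (by linarith [hψ.2]) (by linarith [hψ.2])
          (by linarith)
    rw [e1, e2]
    nlinarith [mul_le_mul_of_nonneg_left h3 (sq_nonneg r), mul_nonneg (sq_nonneg (Real.sin ψ)) hε]
  have hs1 : |transverse ψ x / regDist ε x| ≤ 1 := by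
    rw [← sq_le_one_iff_abs_le_one]
    exact hs.trans (Real.sin_sq_le_one ψ)
  have hroot : Real.cos ψ ≤ Real.sqrt (1 - (transverse ψ x / regDist ε x) ^ 2) := by
    refine Real.le_sqrt_of_sq_le ?_
    linarith [Real.sin_sq_add_cos_sq ψ]
  have hcosh : Real.cosh (Real.arcsin (transverse ψ x / regDist ε x)) ≤
      Real.cosh (Real.pi / 2) := by
    rw [Real.cosh_le_cosh, abs_of_pos Real.pi_div_two_pos, abs_le]
    exact ⟨Real.neg_pi_div_two_le_arcsin _, Real.arcsin_le_pi_div_two _⟩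
  have hsinh : |Real.sinh (Real.arcsin (transverse ψ x / regDist ε x))| ≤
      Real.cosh (Real.pi / 2) := by
    refine le_trans (abs_le_of_sq_le_sq ?_ (Real.cosh_pos _).le) hcosh
    rw [Real.sinh_sq]
    linarith
  have htr : |transverse ψ (EuclideanSpace.single j (1 : ℝ) : Plane)| ≤ 1 := by
    fin_cases j
    · simpa [transverse] using Real.abs_sin_le_one ψ
    · simpa [transverse] using Real.abs_cos_le_one ψ
  unfold phaseDeriv
  refine (abs_add_le _ _).trans (add_le_add ?_ ?_)
  · rw [abs_mul]
    exact (mul_le_of_le_one_left (abs_nonneg _) hd).trans hsinh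
  · rw [abs_mul, abs_div, abs_of_pos (Real.cosh_pos _), abs_of_nonneg (Real.sqrt_nonneg _)]
    gcongr
    refine (abs_sub _ _).trans ?_
    rw [abs_mul]
    nlinarith [mul_le_mul hs1 hd (abs_nonneg _) zero_le_one]

/-- For `ε = 0` the gradient of the phase has radial component `sinh (θ - ψ)` and angular component
`cosh (θ - ψ)`. -/
theorem phaseDeriv_zero_polar {ψ r θ : ℝ} (hr : 0 < r)
    (hθ : θ - ψ ∈ Ioo (-(Real.pi / 2)) (Real.pi / 2)) (e : Plane) :
    phaseDeriv ψ 0 e (polar r θ) =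
      (Real.cos θ * e 0 + Real.sin θ * e 1) * Real.sinh (θ - ψ) +
        Real.cosh (θ - ψ) * (Real.cos θ * e 1 - Real.sin θ * e 0) := by
  have hc : 0 < Real.cos (θ - ψ) := Real.cos_pos_of_mem_Ioo hθ
  have e1 : regDist 0 (polar r θ) = r := by
    rw [regDist, show polar r θ 0 ^ 2 + polar r θ 1 ^ 2 + 0 = r ^ 2 by
      simp only [polar, Matrix.cons_val_zero, Matrix.cons_val_one]
      linear_combination r ^ 2 * Real.sin_sq_add_cos_sq θ]
    exact Real.sqrt_sq hr.le
  have e2 : transverse ψ (polar r θ) / r = Real.sin (θ - ψ) := by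
    rw [div_eq_iff hr.ne']
    simp only [transverse, polar, Matrix.cons_val_zero, Matrix.cons_val_one, Real.sin_sub]
    ring
  have e3 : (polar r θ 0 * e 0 + polar r θ 1 * e 1) / r = Real.cos θ * e 0 + Real.sin θ * e 1 := by
    rw [div_eq_iff hr.ne']
    simp only [polar, Matrix.cons_val_zero, Matrix.cons_val_one]
    ring
  have e4 : Real.sqrt (1 - Real.sin (θ - ψ) ^ 2) = Real.cos (θ - ψ) :=
    (Real.cos_eq_sqrt_one_sub_sin_sq hθ.1.le hθ.2.le).symm
  have e5 : transverse ψ e - Real.sin (θ - ψ) * (Real.cos θ * e 0 + Real.sin θ * e 1) =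
      Real.cos (θ - ψ) * (Real.cos θ * e 1 - Real.sin θ * e 0) := by
    have h1 : Real.sin ψ = Real.sin θ * Real.cos (θ - ψ) - Real.cos θ * Real.sin (θ - ψ) := by
      rw [← Real.sin_sub]; ring_nf
    have h2 : Real.cos ψ = Real.cos θ * Real.cos (θ - ψ) + Real.sin θ * Real.sin (θ - ψ) := by
      rw [← Real.cos_sub]; ring_nf
    rw [transverse, h1, h2]
    ring
  rw [phaseDeriv, e1, e2, e3, e4, Real.arcsin_sin hθ.1.le hθ.2.le, e5]
  field_simp

theorem continuousAt_phaseDeriv {ψ : ℝ} (hψ : ψ ∈ Ioo 0 (Real.pi / 2)) {x : Plane}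
    (hx : x ∈ wedge (2 * ψ)) (e : Plane) : ContinuousAt (fun ε => phaseDeriv ψ ε e x) 0 := by
  have hx0 : 0 < x 0 ^ 2 + x 1 ^ 2 := by
    obtain ⟨h1, -⟩ := (mem_wedge_iff ⟨by linarith [hψ.1], by linarith [hψ.2]⟩ x).1 hx
    positivity
  have hρ : 0 < regDist 0 x := Real.sqrt_pos.2 (by linarith)
  have hρc : ContinuousAt (fun ε => regDist ε x) 0 := by
    unfold regDist
    fun_prop
  have hroot : Real.sqrt (1 - (transverse ψ x / regDist 0 x) ^ 2) ≠ 0 := by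
    obtain ⟨r, θ, hr, h1, h2, rfl⟩ := hx
    have e1 : regDist 0 (polar r θ) = r := by
      rw [regDist, show polar r θ 0 ^ 2 + polar r θ 1 ^ 2 + 0 = r ^ 2 by
        simp only [polar, Matrix.cons_val_zero, Matrix.cons_val_one]
        linear_combination r ^ 2 * Real.sin_sq_add_cos_sq θ]
      exact Real.sqrt_sq hr.le
    have e2 : transverse ψ (polar r θ) / r = Real.sin (θ - ψ) := by
      rw [div_eq_iff hr.ne']
      simp only [transverse, polar, Matrix.cons_val_zero, Matrix.cons_val_one, Real.sin_sub]
      ring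
    rw [e1, e2, ← Real.cos_eq_sqrt_one_sub_sin_sq (by linarith [hψ.2]) (by linarith [hψ.2])]
    exact (Real.cos_pos_of_mem_Ioo ⟨by linarith [hψ.2], by linarith [hψ.2]⟩).ne'
  have hs : ContinuousAt (fun ε => transverse ψ x / regDist ε x) 0 :=
    continuousAt_const.div hρc hρ.ne'
  have hα : ContinuousAt (fun ε => Real.arcsin (transverse ψ x / regDist ε x)) 0 :=
    Real.continuous_arcsin.continuousAt.comp hs
  have hd : ContinuousAt (fun ε => (x 0 * e 0 + x 1 * e 1) / regDist ε x) 0 :=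
    continuousAt_const.div hρc hρ.ne'
  have hr : ContinuousAt (fun ε => Real.sqrt (1 - (transverse ψ x / regDist ε x) ^ 2)) 0 :=
    (continuousAt_const.sub (hs.pow 2)).sqrt
  unfold phaseDeriv
  exact (hd.mul (Real.continuous_sinh.continuousAt.comp hα)).add
    (((Real.continuous_cosh.continuousAt.comp hα).div hr hroot).mul
      (continuousAt_const.sub (hs.mul hd)))

/-! ### The energy of a Gaussian with a phase -/

/-- The Gaussian of exponent `a`, modulated by the phase `g`. -/
noncomputable def gaussPhase (a : ℝ) (g : Plane → ℝ) (x : Plane) : ℂ :=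
  Complex.exp ((-a / 2 * (x 0 ^ 2 + x 1 ^ 2) : ℝ) + (g x : ℝ) * Complex.I)

theorem contDiff_gaussPhase (a : ℝ) {g : Plane → ℝ} (hg : ContDiff ℝ ∞ g) :
    ContDiff ℝ ∞ (gaussPhase a g) := by
  refine ContDiff.cexp (ContDiff.add ?_ ?_)
  · exact Complex.ofRealCLM.contDiff.comp
      (by fun_prop : ContDiff ℝ ∞ fun x : Plane => -a / 2 * (x 0 ^ 2 + x 1 ^ 2))
  · exact (Complex.ofRealCLM.contDiff.comp hg).mul contDiff_const

theorem norm_sq_gaussPhase (a : ℝ) (g : Plane → ℝ) (x : Plane) :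
    ‖gaussPhase a g x‖ ^ 2 = Real.exp (-a * (x 0 ^ 2 + x 1 ^ 2)) := by
  rw [gaussPhase, Complex.norm_exp, ← Real.exp_nat_mul]
  congr 1
  rw [Complex.add_re, Complex.ofReal_re, Complex.re_ofReal_mul, Complex.I_re]
  push_cast
  ring

/-- The two terms come from the gradients of the modulus and of the phase. -/
theorem norm_sq_magGrad_gaussPhase (a : ℝ) {g : Plane → ℝ} (hg : ContDiff ℝ ∞ g) (j : Fin 2)
    (x : Plane) :
    ‖magGrad j (gaussPhase a g) x‖ ^ 2 = Real.exp (-a * (x 0 ^ 2 + x 1 ^ 2)) *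
      ((a * x j) ^ 2 +
        (vectorPotential x j - fderiv ℝ g x (EuclideanSpace.single j 1)) ^ 2) := by
  obtain ⟨e, he⟩ : ∃ e : Plane, e = EuclideanSpace.single j 1 := ⟨_, rfl⟩
  obtain ⟨G, hG⟩ : ∃ G : ℝ, G = fderiv ℝ g x e := ⟨_, rfl⟩
  have hline : HasDerivAt (fun t : ℝ => x + t • e) e 0 := by
    simpa using ((hasDerivAt_id (0 : ℝ)).smul_const e).const_add x
  have h0 : x + (0 : ℝ) • e = x := by simp
  have hcomp : ∀ {F : Type} [NormedAddCommGroup F] [NormedSpace ℝ F] {f : Plane → F},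
      ContDiff ℝ ∞ f → HasDerivAt (fun t : ℝ => f (x + t • e)) (fderiv ℝ f x e) 0 := by
    intro F _ _ f hf
    have h1 : HasFDerivAt f (fderiv ℝ f x) (x + (0 : ℝ) • e) := by
      rw [h0]
      exact ((hf.differentiable (by simp)) x).hasFDerivAt
    exact h1.comp_hasDerivAt 0 hline
  have hcoord : ∀ i, HasDerivAt (fun t : ℝ => (x + t • e) i) (e i) 0 := fun i => by
    simpa using ((hasDerivAt_id (0 : ℝ)).mul_const (e i)).const_add (x i)
  have hq : HasDerivAt (fun t : ℝ => -a / 2 * ((x + t • e) 0 ^ 2 + (x + t • e) 1 ^ 2))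
      (-a * x j) 0 := by
    have h1 := (((hcoord 0).pow 2).add ((hcoord 1).pow 2)).const_mul (-a / 2)
    refine h1.congr_deriv ?_
    rw [h0, he]
    fin_cases j
    · simp; ring
    · simp; ring
  have hw : HasDerivAt (fun t : ℝ => gaussPhase a g (x + t • e))
      (gaussPhase a g x * ((-a * x j : ℝ) + (G : ℝ) * Complex.I)) 0 := by
    have h1 := (hq.ofReal_comp.add ((hcomp hg).ofReal_comp.mul_const Complex.I)).cexp
    refine h1.congr_deriv ?_
    simp only [Pi.add_apply, h0, gaussPhase, hG]
  have hfd := (hcomp (contDiff_gaussPhase a hg)).unique hw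
  have hmag : magGrad j (gaussPhase a g) x = gaussPhase a g x *
      ((vectorPotential x j - G : ℝ) + (-(a * x j) : ℝ) * Complex.I) := by
    rw [magGrad, ← he, hfd]
    push_cast
    linear_combination (gaussPhase a g x * G) * Complex.I_mul_I
  rw [← he, ← hG, hmag, norm_mul, mul_pow, norm_sq_gaussPhase, ← Complex.normSq_eq_norm_sq,
    Complex.normSq_add_mul_I]
  ring

theorem integrable_gaussian {b : ℝ} (hb : 0 < b) :
    Integrable fun x : Plane => Real.exp (-b * (x 0 ^ 2 + x 1 ^ 2)) := by
  have h := (GaussianFourier.integrable_cexp_neg_mul_sq_norm_add (V := Plane) (b := (b : ℂ))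
    (by simpa using hb) 0 0).norm
  refine h.congr (Eventually.of_forall fun x => ?_)
  have h2 : ‖x‖ ^ 2 = x 0 ^ 2 + x 1 ^ 2 := by
    rw [EuclideanSpace.norm_sq_eq, Fin.sum_univ_two]
    simp
  simp only [Complex.norm_exp, ← h2]
  congr 1
  norm_cast
  simp

/-- The energy density of the Gaussian with the phase `k * phase ψ ε`. -/
noncomputable def energyDensity (a k ψ ε : ℝ) (x : Plane) : ℝ :=
  ∑ j, Real.exp (-a * (x 0 ^ 2 + x 1 ^ 2)) * ((a * x j) ^ 2 +
    (vectorPotential x j - k * phaseDeriv ψ ε (EuclideanSpace.single j 1) x) ^ 2)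

theorem gaussian_mul_le {a k B G v y n : ℝ} (ha : 0 < a) (hn : 0 ≤ n) (hy : y ^ 2 ≤ n)
    (hv : v ^ 2 ≤ n / 4) (hG : |G| ≤ B) :
    Real.exp (-a * n) * ((a * y) ^ 2 + (v - k * G) ^ 2) ≤
      ((a ^ 2 + 1 / 2) * (2 / a) + 2 * k ^ 2 * B ^ 2) * Real.exp (-(a / 2) * n) := by
  have hG2 : G ^ 2 ≤ B ^ 2 := by
    rw [← sq_abs G]
    exact pow_le_pow_left₀ (abs_nonneg G) hG 2
  have h1 : (a * y) ^ 2 + (v - k * G) ^ 2 ≤ (a ^ 2 + 1 / 2) * n + 2 * k ^ 2 * B ^ 2 := by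
    nlinarith [sq_nonneg (v + k * G), mul_le_mul_of_nonneg_left hG2 (sq_nonneg k),
      mul_le_mul_of_nonneg_left hy (sq_nonneg a)]
  -- Half of the Gaussian decay is spent on the polynomial factor.
  have h2 : n ≤ 2 / a * Real.exp (a / 2 * n) := by
    have h3 : a / 2 * n ≤ Real.exp (a / 2 * n) := by linarith [Real.add_one_le_exp (a / 2 * n)]
    calc n = 2 / a * (a / 2 * n) := by field_simp
      _ ≤ _ := mul_le_mul_of_nonneg_left h3 (by positivity)
  have h4 : 1 ≤ Real.exp (a / 2 * n) := Real.one_le_exp (by positivity)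
  have h5 : (a ^ 2 + 1 / 2) * n + 2 * k ^ 2 * B ^ 2 ≤
      ((a ^ 2 + 1 / 2) * (2 / a) + 2 * k ^ 2 * B ^ 2) * Real.exp (a / 2 * n) := by
    have h6 := mul_le_mul_of_nonneg_left h2 (by positivity : 0 ≤ a ^ 2 + 1 / 2)
    have h7 := mul_le_mul_of_nonneg_left h4 (by positivity : 0 ≤ 2 * k ^ 2 * B ^ 2)
    linarith
  calc _ ≤ Real.exp (-a * n) *
        (((a ^ 2 + 1 / 2) * (2 / a) + 2 * k ^ 2 * B ^ 2) * Real.exp (a / 2 * n)) :=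
        mul_le_mul_of_nonneg_left (h1.trans h5) (Real.exp_pos _).le
    _ = _ := by
        rw [mul_left_comm, ← Real.exp_add]
        ring_nf

theorem exists_energyDensity_le {a ψ : ℝ} (ha : 0 < a) (k : ℝ) (hψ : ψ ∈ Ioo 0 (Real.pi / 2)) :
    ∃ C : ℝ, ∀ ε, 0 ≤ ε → ∀ x ∈ wedge (2 * ψ), ∀ j,
      Real.exp (-a * (x 0 ^ 2 + x 1 ^ 2)) * ((a * x j) ^ 2 +
        (vectorPotential x j - k * phaseDeriv ψ ε (EuclideanSpace.single j 1) x) ^ 2) ≤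
      C * Real.exp (-(a / 2) * (x 0 ^ 2 + x 1 ^ 2)) := by
  refine ⟨_, fun ε hε x hx j => gaussian_mul_le ha (by positivity) ?_ ?_
    (abs_phaseDeriv_le hψ hε hx j)⟩
  · fin_cases j
    · simp; positivity
    · simp; positivity
  · fin_cases j
    · simp [vectorPotential]; nlinarith [sq_nonneg (x 0)]
    · simp [vectorPotential]; nlinarith [sq_nonneg (x 1)]

/-- Removing the regularization at the apex: dominated convergence with a Gaussian majorant. -/
theorem tendsto_integral_energyDensity {a ψ : ℝ} (ha : 0 < a) (k : ℝ)
    (hψ : ψ ∈ Ioo 0 (Real.pi / 2)) :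
    Tendsto (fun n : ℕ => ∫ x in wedge (2 * ψ), energyDensity a k ψ (1 / ((n : ℝ) + 1)) x) atTop
      (𝓝 (∫ x in wedge (2 * ψ), energyDensity a k ψ 0 x)) := by
  obtain ⟨C, hC⟩ := exists_energyDensity_le ha k hψ
  have hmem : ∀ᵐ x ∂(volume.restrict (wedge (2 * ψ))), x ∈ wedge (2 * ψ) :=
    ae_restrict_mem (isOpen_wedge _).measurableSet
  refine tendsto_integral_of_dominated_convergence
    (fun x => 2 * (C * Real.exp (-(a / 2) * (x 0 ^ 2 + x 1 ^ 2)))) (fun n => ?_) ?_ (fun n => ?_) ?_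
  · have hε : (0 : ℝ) < 1 / ((n : ℝ) + 1) := by positivity
    have hg : ContDiff ℝ ∞ fun x => k * phase ψ (1 / ((n : ℝ) + 1)) x :=
      contDiff_const.mul (contDiff_phase hε ψ)
    refine Continuous.aestronglyMeasurable ?_
    have h1 : energyDensity a k ψ (1 / ((n : ℝ) + 1)) = fun x =>
        ∑ j, ‖magGrad j (gaussPhase a fun x => k * phase ψ (1 / ((n : ℝ) + 1)) x) x‖ ^ 2 := by
      ext x
      refine Finset.sum_congr rfl fun j _ => ?_
      rw [norm_sq_magGrad_gaussPhase a hg, fderiv_const_mul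
        (((contDiff_phase hε ψ).differentiable (by simp)) x), smul_apply, fderiv_phase hε,
        smul_eq_mul]
    rw [h1]
    exact continuous_finsetSum _ fun j _ =>
      (continuous_magGrad j ((contDiff_gaussPhase a hg).of_le (by simp))).norm.pow 2
  · exact (((integrable_gaussian (half_pos ha)).const_mul C).const_mul 2).restrict
  · filter_upwards [hmem] with x hx
    rw [energyDensity, Real.norm_of_nonneg (Finset.sum_nonneg fun j _ => by positivity),
      Fin.sum_univ_two]
    linarith [hC (1 / ((n : ℝ) + 1)) (by positivity) x hx 0,
      hC (1 / ((n : ℝ) + 1)) (by positivity) x hx 1]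
  · filter_upwards [hmem] with x hx
    refine tendsto_finsetSum _ fun j _ => Tendsto.const_mul _ (Tendsto.const_add _
      ((Tendsto.const_sub _ (Tendsto.const_mul _ ?_)).pow 2))
    exact (continuousAt_phaseDeriv hψ hx _).tendsto.comp
      (tendsto_one_div_add_atTop_nhds_zero_nat (𝕜 := ℝ))

theorem integral_wedge_gaussian {φ X : ℝ} (hφ : φ ∈ Ioo 0 Real.pi) (hX : 0 < X) :
    ∫ x in wedge φ, Real.exp (-(X ^ 2)⁻¹ * (x 0 ^ 2 + x 1 ^ 2)) = φ * X ^ 2 / 2 := by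
  rw [integral_wedge_eq hφ]
  have h1 : ∀ p : ℝ × ℝ, p.1 * Real.exp (-(X ^ 2)⁻¹ *
      (polar p.1 p.2 0 ^ 2 + polar p.1 p.2 1 ^ 2)) =
      (p.1 * Real.exp (-(X ^ 2)⁻¹ * p.1 ^ 2)) * 1 := fun p => by
    have : polar p.1 p.2 0 ^ 2 + polar p.1 p.2 1 ^ 2 = p.1 ^ 2 := by
      simp only [polar, Matrix.cons_val_zero, Matrix.cons_val_one]
      linear_combination p.1 ^ 2 * Real.sin_sq_add_cos_sq p.2
    rw [this, mul_one]
  simp only [h1]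
  have h := setIntegral_prod_mul (μ := volume) (ν := volume)
    (fun r : ℝ => r * Real.exp (-(X ^ 2)⁻¹ * r ^ 2)) (fun _ : ℝ => (1 : ℝ)) (Ioi 0) (Ioo 0 φ)
  rw [← Measure.volume_eq_prod] at h
  rw [h, integral_gaussian_one hX]
  simp [hφ.1.le]
  ring

theorem integral_boundary_gaussian {φ X : ℝ} (hX : 0 < X) :
    ∫ x, Real.exp (-(X ^ 2)⁻¹ * (x 0 ^ 2 + x 1 ^ 2)) ∂(boundaryMeasure φ) =
      X * Real.sqrt Real.pi := by
  have h1 : ∀ r θ : ℝ, polar r θ 0 ^ 2 + polar r θ 1 ^ 2 = r ^ 2 := fun r θ => by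
    simp only [polar, Matrix.cons_val_zero, Matrix.cons_val_one]
    linear_combination r ^ 2 * Real.sin_sq_add_cos_sq θ
  have hc : Continuous fun x : Plane => Real.exp (-(X ^ 2)⁻¹ * (x 0 ^ 2 + x 1 ^ 2)) := by fun_prop
  have hi : IntegrableOn (fun r : ℝ => Real.exp (-(X ^ 2)⁻¹ * r ^ 2)) (Ioi 0) := by
    simpa using integrableOn_pow_mul_gaussian (a := (X ^ 2)⁻¹) (by positivity) 0
  have hint : ∀ θ, Integrable (fun x : Plane => Real.exp (-(X ^ 2)⁻¹ * (x 0 ^ 2 + x 1 ^ 2)))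
      ((volume.restrict (Ioi (0 : ℝ))).map fun r => polar r θ) := fun θ => by
    rw [integrable_map_measure hc.aestronglyMeasurable (measurable_polar θ).aemeasurable]
    simp only [Function.comp_def, h1]
    exact hi
  have hval : ∀ θ, ∫ x, Real.exp (-(X ^ 2)⁻¹ * (x 0 ^ 2 + x 1 ^ 2))
      ∂((volume.restrict (Ioi (0 : ℝ))).map fun r => polar r θ) = X * Real.sqrt Real.pi / 2 :=
    fun θ => by
      rw [integral_map (measurable_polar θ).aemeasurable hc.aestronglyMeasurable]
      simp only [h1]
      exact integral_gaussian_zero hX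
  rw [boundaryMeasure, integral_add_measure (hint 0) (hint φ), hval, hval]
  ring

theorem energyDensity_zero_polar {ψ r θ : ℝ} (a k : ℝ) (hr : 0 < r)
    (hθ : θ - ψ ∈ Ioo (-(Real.pi / 2)) (Real.pi / 2)) :
    energyDensity a k ψ 0 (polar r θ) = Real.exp (-a * r ^ 2) * ((a ^ 2 + 1 / 4) * r ^ 2 -
      k * (r * Real.cosh (θ - ψ)) +
        k ^ 2 * (Real.sinh (θ - ψ) ^ 2 + Real.cosh (θ - ψ) ^ 2)) := by
  have h1 : polar r θ 0 ^ 2 + polar r θ 1 ^ 2 = r ^ 2 := by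
    simp only [polar, Matrix.cons_val_zero, Matrix.cons_val_one]
    linear_combination r ^ 2 * Real.sin_sq_add_cos_sq θ
  rw [energyDensity, Fin.sum_univ_two, phaseDeriv_zero_polar hr hθ, phaseDeriv_zero_polar hr hθ, h1,
    ← mul_add]
  congr 1
  simp only [vectorPotential, polar, Matrix.cons_val_zero, Matrix.cons_val_one, PiLp.single_apply]
  simp
  linear_combination (a ^ 2 * r ^ 2 + r ^ 2 / 4 - k * r * Real.cosh (θ - ψ) +
    k ^ 2 * (Real.sinh (θ - ψ) ^ 2 + Real.cosh (θ - ψ) ^ 2)) * Real.sin_sq_add_cos_sq θ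

theorem integral_energyDensity_zero {ψ X : ℝ} (k : ℝ) (hψ : ψ ∈ Ioo 0 (Real.pi / 2)) (hX : 0 < X) :
    ∫ x in wedge (2 * ψ), energyDensity (X ^ 2)⁻¹ k ψ 0 x =
      ((X ^ 2)⁻¹ ^ 2 + 1 / 4) * (X ^ 4 / 2 * (2 * ψ)) -
        k * (Real.sqrt Real.pi * X ^ 3 / 4 * (2 * Real.sinh ψ)) +
        k ^ 2 * (X ^ 2 / 2 * (2 * (Real.sinh ψ * Real.cosh ψ))) := by
  obtain ⟨a, ha⟩ : ∃ a : ℝ, a = (X ^ 2)⁻¹ := ⟨_, rfl⟩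
  have ha0 : 0 < a := by rw [ha]; positivity
  rw [integral_wedge_eq ⟨by linarith [hψ.1], by linarith [hψ.2]⟩, ← ha]
  have hcong : ∀ p ∈ Ioi (0 : ℝ) ×ˢ Ioo 0 (2 * ψ),
      p.1 * energyDensity a k ψ 0 (polar p.1 p.2) =
      (a ^ 2 + 1 / 4) * ((p.1 ^ 3 * Real.exp (-a * p.1 ^ 2)) * 1) -
        k * ((p.1 ^ 2 * Real.exp (-a * p.1 ^ 2)) * Real.cosh (p.2 - ψ)) +
        k ^ 2 * ((p.1 * Real.exp (-a * p.1 ^ 2)) *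
          (Real.sinh (p.2 - ψ) ^ 2 + Real.cosh (p.2 - ψ) ^ 2)) := by
    rintro ⟨r, θ⟩ ⟨hr, hθ⟩
    simp only [mem_Ioi, mem_Ioo] at hr hθ
    rw [energyDensity_zero_polar a k hr ⟨by linarith [hψ.2], by linarith [hψ.2]⟩]
    ring
  rw [setIntegral_congr_fun (measurableSet_Ioi.prod measurableSet_Ioo) hcong]
  have hint : ∀ {f g : ℝ → ℝ}, IntegrableOn f (Ioi 0) → Continuous g →
      IntegrableOn (fun p : ℝ × ℝ => f p.1 * g p.2) (Ioi (0 : ℝ) ×ˢ Ioo 0 (2 * ψ)) := by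
    intro f g hf hg
    have hg' : IntegrableOn g (Ioo 0 (2 * ψ)) :=
      hg.continuousOn.integrableOn_Icc.mono_set Ioo_subset_Icc_self
    rw [IntegrableOn, Measure.volume_eq_prod, ← Measure.prod_restrict]
    exact Integrable.mul_prod hf hg'
  have hprod : ∀ f g : ℝ → ℝ, ∫ p in Ioi (0 : ℝ) ×ˢ Ioo 0 (2 * ψ), f p.1 * g p.2 =
      (∫ r in Ioi (0 : ℝ), f r) * ∫ θ in Ioo 0 (2 * ψ), g θ := fun f g => by
    rw [Measure.volume_eq_prod]
    exact setIntegral_prod_mul f g _ _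
  have i1 := hint (integrableOn_pow_mul_gaussian ha0 3) (continuous_const (y := (1 : ℝ)))
  have i2 := hint (integrableOn_pow_mul_gaussian ha0 2)
    (by fun_prop : Continuous fun θ => Real.cosh (θ - ψ))
  have i3 := hint (g := fun θ => Real.sinh (θ - ψ) ^ 2 + Real.cosh (θ - ψ) ^ 2)
    (by simpa only [pow_one] using integrableOn_pow_mul_gaussian ha0 1) (by fun_prop)
  have i4 : IntegrableOn (fun p : ℝ × ℝ =>
      (a ^ 2 + 1 / 4) * ((p.1 ^ 3 * Real.exp (-a * p.1 ^ 2)) * 1) -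
        k * ((p.1 ^ 2 * Real.exp (-a * p.1 ^ 2)) * Real.cosh (p.2 - ψ)))
      (Ioi (0 : ℝ) ×ˢ Ioo 0 (2 * ψ)) := (i1.const_mul _).sub (i2.const_mul _)
  rw [integral_add i4 (i3.const_mul _),
    integral_sub (i1.const_mul _) (i2.const_mul _), integral_const_mul, integral_const_mul,
    integral_const_mul, hprod (fun r => r ^ 3 * Real.exp (-a * r ^ 2)) fun _ => 1,
    hprod (fun r => r ^ 2 * Real.exp (-a * r ^ 2)) fun θ => Real.cosh (θ - ψ),
    hprod (fun r => r * Real.exp (-a * r ^ 2))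
      fun θ => Real.sinh (θ - ψ) ^ 2 + Real.cosh (θ - ψ) ^ 2,
    integral_cosh_sub hψ.1.le, integral_sinh_sq_add_cosh_sq hψ.1.le, ha, integral_gaussian_one hX,
    integral_gaussian_two hX, integral_gaussian_three hX]
  simp [hψ.1.le]

/-- The phase makes the energy a quadratic polynomial in its strength `k`; this is the value at the
optimal strength. -/
theorem energy_optimal {ψ X : ℝ} (hX : 0 < X) :
    ((X ^ 2)⁻¹ ^ 2 + 1 / 4) * (X ^ 4 / 2 * (2 * ψ)) -
        (Real.sqrt Real.pi * X / (4 * Real.cosh ψ)) *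
          (Real.sqrt Real.pi * X ^ 3 / 4 * (2 * Real.sinh ψ)) +
        (Real.sqrt Real.pi * X / (4 * Real.cosh ψ)) ^ 2 *
          (X ^ 2 / 2 * (2 * (Real.sinh ψ * Real.cosh ψ))) =
      ψ + X ^ 4 * (4 * ψ - Real.pi * Real.tanh ψ) / 16 := by
  have hc := (Real.cosh_pos ψ).ne'
  have hs : Real.sqrt Real.pi ^ 2 = Real.pi := Real.sq_sqrt Real.pi_pos.le
  rw [Real.tanh_eq_sinh_div_cosh]
  field_simp
  rw [hs]
  ring

/-- The Gaussian with the regularized phase belongs to `H¹_A(Ω)`. Neither of its two `L²` norms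
depends on the phase. -/
theorem exists_graph_gaussPhase {ψ X : ℝ} (hψ : ψ ∈ Ioo 0 (Real.pi / 2)) (hX : 0 < X) (k : ℝ)
    {ε : ℝ} (hε : 0 < ε) :
    ∃ z : sobolevGraph (2 * ψ), ‖z.1.1‖ ^ 2 = 2 * ψ * X ^ 2 / 2 ∧
      ‖graphTrace (2 * ψ) z‖ ^ 2 = X * Real.sqrt Real.pi ∧
      ∑ j, ‖z.1.2 j‖ ^ 2 = ∫ x in wedge (2 * ψ), energyDensity (X ^ 2)⁻¹ k ψ ε x := by
  have hφ : 2 * ψ ∈ Ioo 0 Real.pi := ⟨by linarith [hψ.1], by linarith [hψ.2]⟩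
  obtain ⟨a, ha⟩ : ∃ a : ℝ, a = (X ^ 2)⁻¹ := ⟨_, rfl⟩
  have ha0 : 0 < a := by rw [ha]; positivity
  have hg : ContDiff ℝ ∞ fun x => k * phase ψ ε x := contDiff_const.mul (contDiff_phase hε ψ)
  obtain ⟨w, hw⟩ : ∃ w : Plane → ℂ, w = gaussPhase a fun x => k * phase ψ ε x := ⟨_, rfl⟩
  have hwc : ContDiff ℝ ∞ w := hw ▸ contDiff_gaussPhase a hg
  have hmem : ∀ᵐ x ∂(volume.restrict (wedge (2 * ψ))), x ∈ wedge (2 * ψ) :=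
    ae_restrict_mem (isOpen_wedge _).measurableSet
  have hn : ∀ x, ‖w x‖ ^ 2 = Real.exp (-a * (x 0 ^ 2 + x 1 ^ 2)) := fun x => by
    rw [hw, norm_sq_gaussPhase]
  have hm : ∀ j x, ‖magGrad j w x‖ ^ 2 = Real.exp (-a * (x 0 ^ 2 + x 1 ^ 2)) * ((a * x j) ^ 2 +
      (vectorPotential x j - k * phaseDeriv ψ ε (EuclideanSpace.single j 1) x) ^ 2) :=
    fun j x => by
      rw [hw, norm_sq_magGrad_gaussPhase a hg, fderiv_const_mul
        (((contDiff_phase hε ψ).differentiable (by simp)) x), smul_apply, fderiv_phase hε,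
        smul_eq_mul]
  have hcm : ∀ j, Continuous (magGrad j w) := fun j => continuous_magGrad j (hwc.of_le (by simp))
  have hmi : ∀ j, IntegrableOn (fun x => ‖magGrad j w x‖ ^ 2) (wedge (2 * ψ)) := fun j => by
    obtain ⟨C, hC⟩ := exists_energyDensity_le ha0 k hψ
    refine Integrable.mono' (((integrable_gaussian (half_pos ha0)).const_mul C).restrict)
      ((hcm j).norm.pow 2).aestronglyMeasurable ?_
    filter_upwards [hmem] with x hx
    rw [Real.norm_of_nonneg (by positivity), hm]
    exact hC ε hε.le x hx j
  obtain ⟨z, hz1, hz2, hz3⟩ := exists_graph_of_contDiff hφ hwc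
    ((memLp_two_iff_integrable_sq_norm hwc.continuous.aestronglyMeasurable).2
      (by simpa only [hn] using (integrable_gaussian ha0).restrict))
    fun j => (memLp_two_iff_integrable_sq_norm (hcm j).aestronglyMeasurable).2 (hmi j)
  refine ⟨z, ?_, ?_, ?_⟩
  · rw [norm_sq_eq_integral _ hz1]
    simp only [hn, ha]
    exact integral_wedge_gaussian hφ hX
  · rw [norm_sq_eq_integral _ hz3]
    simp only [hn, ha]
    exact integral_boundary_gaussian hX
  · rw [Finset.sum_congr rfl fun j _ => norm_sq_eq_integral _ (hz2 j),
      ← integral_finsetSum _ fun j _ => hmi j]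
    simp only [hm, energyDensity, ha]

theorem exists_discreteSpectrum_of_robinPoly {ψ β : ℝ} (hψ : ψ ∈ Ioo 0 (Real.pi / 2)) {X : ℝ}
    (hX : 0 < X) (hP : robinPoly (2 * ψ) β X < 0) :
    ∃ t : ℝ, (t : ℂ) ∈ discreteSpectrum (robinLaplacian (2 * ψ) β) ∧
      t < robinThreshold (2 * ψ) β := by
  have hφ : 2 * ψ ∈ Ioo 0 Real.pi := ⟨by linarith [hψ.1], by linarith [hψ.2]⟩
  -- This strength of the phase minimizes the energy.
  obtain ⟨k, hk⟩ : ∃ k : ℝ, k = Real.sqrt Real.pi * X / (4 * Real.cosh ψ) := ⟨_, rfl⟩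
  have hlim := tendsto_integral_energyDensity (a := (X ^ 2)⁻¹) (by positivity) k hψ
  have hE := integral_energyDensity_zero k hψ hX
  rw [hk, energy_optimal hX, ← hk] at hE
  have hlt : ∫ x in wedge (2 * ψ), energyDensity (X ^ 2)⁻¹ k ψ 0 x <
      β * (X * Real.sqrt Real.pi) + robinThreshold (2 * ψ) β * (2 * ψ * X ^ 2 / 2) := by
    rw [hE]
    rw [robinPoly, mul_div_cancel_left₀ ψ two_ne_zero] at hP
    linarith
  obtain ⟨n, hn⟩ := (hlim.eventually_lt_const hlt).exists
  obtain ⟨z, h1, h2, h3⟩ := exists_graph_gaussPhase hψ hX k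
    (by positivity : (0 : ℝ) < 1 / ((n : ℝ) + 1))
  refine exists_discreteSpectrum_lt hφ z ?_ ?_
  · rw [h1, h2, h3]
    linarith
  · intro h0
    rw [h0, norm_zero] at h1
    have := hψ.1
    have h4 : 0 < 2 * ψ * X ^ 2 / 2 := by positivity
    rw [← h1] at h4
    norm_num at h4

end MagneticWedge

theorem theorem1 (φ β : ℝ) (hφ : φ ∈ Set.Ioo 0 Real.pi)
    (hP : ∃ x : ℝ, 0 < x ∧ MagneticWedge.robinPoly φ β x < 0) :
    ∃ t : ℝ, (t : ℂ) ∈ MagneticWedge.discreteSpectrum (MagneticWedge.robinLaplacian φ β) ∧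
      t < MagneticWedge.robinThreshold φ β := by
  obtain ⟨x, hx, hPx⟩ := hP
  obtain ⟨ψ, rfl⟩ : ∃ ψ, φ = 2 * ψ := ⟨φ / 2, by ring⟩
  exact MagneticWedge.exists_discreteSpectrum_of_robinPoly
    ⟨by linarith [hφ.1], by linarith [hφ.2]⟩ hx hPx
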